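/- A \emph{partial double tree} is a connected graph $G$ that embeds isometrically, with respect to shortest-path distances, into the Cartesian product of two trees. For a finite graph $G=(V,E)$ one can decide in linear time $O(|V|+|E|)$ whether $G$ is a partial double tree: there are a single deterministic random access machine program and a constant $C$ such that, for every finite graph $G=(V,E)$ given by adjacency lists (with the vertices numbered $0,\dots,|V|-1$ and the neighbours of each vertex listed in any order), the program halts after at most $C\,(|V|+|E|+1)$ steps, with output $1$ if $G$ is a partial double tree and with output $0$ otherwise. Here the machine has unit cost, finitely many registers and finitely many indirectly addressed arrays of natural numbers, all zero except for the input; its instructions are assignment of constants, copying, adding and subtracting $1$ (truncated at $0$), reading and writing an array cell, and branching and looping on comparisons of registers. -/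

import Mathlib

universe u

/-! ### Partial double trees -/

/-- A *partial double tree*: a connected graph `G`, with its shortest-path metric, that embeds
isometrically into the Cartesian (box) product of two trees.  The trees may be infinite. -/
def IsPartialDoubleTree {V : Type u} (G : SimpleGraph V) : Prop :=
  G.Connected ∧
    ∃ (V₁ V₂ : Type u) (T₁ : SimpleGraph V₁) (T₂ : SimpleGraph V₂),
      T₁.IsTree ∧ T₂.IsTree ∧
        ∃ f : V → V₁ × V₂, ∀ x y : V, (T₁.boxProd T₂).dist (f x) (f y) = G.dist x y

/-! ### A unit-cost random access machine

The store has registers and one-dimensional arrays, all with entries in `ℕ`.  Registers and arrays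
are named by constants of the program, so a program uses finitely many of them; cells of an array
are addressed indirectly, through the value of a register.  The only arithmetic is adding and
subtracting `1`, so in `t` steps no entry grows by more than `t` (or beyond a constant of the
program plus `t`): a run of linear length only uses words of logarithmic length. -/

namespace RAM

/-- The store: `reg r` is the value of register `r`, `arr a i` the value of cell `i` of array
`a`. -/
structure Store where
  reg : ℕ → ℕ
  arr : ℕ → ℕ → ℕ

/-- Elementary instructions. -/
inductive Instr where
  /-- `r := k`, for a constant `k` -/
  | const (r k : ℕ)
  /-- `r := q` -/
  | copy (r q : ℕ)
  /-- `r := r + 1` -/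
  | inc (r : ℕ)
  /-- `r := r - 1`, truncated at `0` -/
  | dec (r : ℕ)
  /-- `r := a[q]` -/
  | load (r a q : ℕ)
  /-- `a[q] := r` -/
  | store (a q r : ℕ)

/-- The effect of an elementary instruction. -/
def Instr.exec : Instr → Store → Store
  | .const r k, s => { s with reg := Function.update s.reg r k }
  | .copy r q, s => { s with reg := Function.update s.reg r (s.reg q) }
  | .inc r, s => { s with reg := Function.update s.reg r (s.reg r + 1) }
  | .dec r, s => { s with reg := Function.update s.reg r (s.reg r - 1) }
  | .load r a q, s => { s with reg := Function.update s.reg r (s.arr a (s.reg q)) }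
  | .store a q r, s =>
      { s with arr := Function.update s.arr a (Function.update (s.arr a) (s.reg q) (s.reg r)) }

/-- Tests: comparisons of two registers. -/
inductive Test where
  | eq (r q : ℕ)
  | lt (r q : ℕ)

/-- The outcome of a test. -/
def Test.eval : Test → Store → Bool
  | .eq r q, s => decide (s.reg r = s.reg q)
  | .lt r q, s => decide (s.reg r < s.reg q)

/-- Programs. -/
inductive Program where
  /-- do nothing -/
  | skip
  /-- an elementary instruction -/
  | instr (i : Instr)
  /-- first `p`, then `q` -/
  | seq (p q : Program)
  /-- if `b` then `p` else `q` -/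
  | cond (b : Test) (p q : Program)
  /-- while `b` do `p` -/
  | loop (b : Test) (p : Program)

/-- A configuration: the list of the programs that remain to be executed, in this order, and the
current store.  The machine has halted when the list is empty. -/
abbrev Config := List Program × Store

/-- One step of the machine: it executes one elementary instruction, or evaluates one test, or
unfolds one sequential composition. -/
def step : Config → Config
  | ([], s) => ([], s)
  | (.skip :: K, s) => (K, s)
  | (.instr i :: K, s) => (K, i.exec s)
  | (.seq p q :: K, s) => (p :: q :: K, s)
  | (.cond b p q :: K, s) => if b.eval s then (p :: K, s) else (q :: K, s)
  | (.loop b p :: K, s) => if b.eval s then (p :: .loop b p :: K, s) else (K, s)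

/-- Started in the store `s`, the program `p` halts after at most `t` steps, in the store `s'`. -/
def HaltsWithin (p : Program) (s : Store) (t : ℕ) (s' : Store) : Prop :=
  ∃ k ≤ t, step^[k] ([p], s) = ([], s')

end RAM

/-! ### Graphs as inputs -/

/-- A representation of a finite graph by adjacency lists: the vertices are numbered
`0, …, n - 1`, and every vertex comes with a list of its neighbours, in any order and without
repetitions. -/
structure AdjacencyLists {V : Type u} (G : SimpleGraph V) where
  n : ℕ
  vertex : Fin n ≃ V
  nbrs : Fin n → List (Fin n)
  nodup : ∀ i, (nbrs i).Nodup
  mem_nbrs : ∀ i j, j ∈ nbrs i ↔ G.Adj (vertex i) (vertex j)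

namespace AdjacencyLists

variable {V : Type u} {G : SimpleGraph V}

/-- The adjacency lists of the vertices `0, …, n - 1`, one after the other. -/
def entries (A : AdjacencyLists G) : List ℕ :=
  ((List.ofFn A.nbrs).flatten).map Fin.val

/-- The position in `entries` at which the adjacency list of vertex `k` begins, that is, the
sum of the lengths of the lists of all earlier vertices; for `k = n` the length of `entries`. -/
def offset (A : AdjacencyLists G) (k : ℕ) : ℕ :=
  (((List.ofFn A.nbrs).take k).map List.length).sum

/-- The initial store: register `0` holds the number `n` of vertices, cells `0, …, n` of array `0`
hold the offsets, array `1` holds the concatenated adjacency lists; everything else is `0`. -/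
def initialStore (A : AdjacencyLists G) : RAM.Store where
  reg r := if r = 0 then A.n else 0
  arr a i :=
    if a = 0 then (if i ≤ A.n then A.offset i else 0)
    else if a = 1 then A.entries.getD i 0
    else 0

end AdjacencyLists

/-!
Let `G` be connected, and let its vertices be numbered by a breadth-first search. The neighbours
of a vertex that come before it are its parents.

If `G` embeds isometrically into a product of two trees, root both trees at the image of the first
vertex. A step towards the first vertex in `G` then moves one of the two coordinates to its
parent, so that a vertex has at most two parents, no two vertices have the same two parents,
and two parents of one vertex have a common parent, with coordinates that complete a square
(`exists_square`). The edges fall into classes: opposite edges of such a square belong to the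
same class, and the edge down from a vertex with one parent begins a new class. All edges of a
class point along the same tree, while the two edges down from a vertex with two parents point
along different trees. Hence the graph on the classes in which these pairs of classes are joined,
called the crossing graph below, is bipartite (`HasParentPairs.exists_coloring`).

Conversely, these conditions suffice (`isPartialDoubleTree_of_coloring`). Given a proper colouring
of the crossing graph, there is one tree for each colour, whose nodes are a root and the classes of
that colour. Going down an edge of `G` moves the coordinate in the tree of its colour to its parent
and keeps the other one (`treeCoord_downEdge`), so that no edge is stretched. If `y` comes before
`x`, then one of the edges down from `x` leads closer to `y`, because the coordinate of `y` in its
tree does not lie below that of `x` (`exists_downEdge_not_isBelow`); by induction, the distance in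
`G` is at most the distance in the product.

Every condition can be checked in linear time. The search finds the parents, and a repeated pair of
parents is detected without a table of pairs: it suffices to remember, for each vertex `u`, the last
second parent that was entered next to the first parent `u`, because second parents are entered in
the order of the search. The classes are computed in the order of the search. Each vertex
with two parents contributes one edge to the crossing graph, so that this graph has linear size; its
adjacency lists are linked lists, and a second search finds a colouring that is proper if there is
a proper one (`ColorProper`). Running times are read off from the program text: a loop costs the
size of its body times the bound for the number of iterations in `Triple.loop`.
-/

/-! ### Rooted trees given by parent functions -/

/-- The graph on (a universe lift of) `ℕ` in which every `m ≠ 0` is joined to `π m`. -/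
def parentTree (π : ℕ → ℕ) (hπ : ∀ m, m ≠ 0 → π m < m) : SimpleGraph (ULift.{u} ℕ) where
  Adj a b := (a.down ≠ 0 ∧ π a.down = b.down) ∨ (b.down ≠ 0 ∧ π b.down = a.down)
  symm := ⟨fun _ _ h => h.symm⟩
  loopless := ⟨fun a h => by
    rcases h with h | h <;> exact absurd (hπ a.down h.1) (by omega)⟩

/-- `IsBelow π m a`: the node `a` is reached from `m` by iterating the parent function, that is,
`m` lies in the subtree that hangs at `a`. -/
inductive IsBelow (π : ℕ → ℕ) : ℕ → ℕ → Prop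
  | refl (a : ℕ) : IsBelow π a a
  | step {m a : ℕ} (hm : m ≠ 0) (h : IsBelow π (π m) a) : IsBelow π m a

section ParentTree

variable {π : ℕ → ℕ} (hπ : ∀ m, m ≠ 0 → π m < m)

include hπ in
theorem IsBelow.le {m a : ℕ} (h : IsBelow π m a) : a ≤ m := by
  induction h with
  | refl => exact le_rfl
  | step hm _ ih => exact ih.trans (hπ _ hm).le

theorem parentTree_adj_parent {m : ℕ} (hm : m ≠ 0) :
    (parentTree.{u} π hπ).Adj ⟨m⟩ ⟨π m⟩ := Or.inl ⟨hm, rfl⟩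

/-- The only edge that leaves the subtree at `a` joins `a` to its parent. -/
theorem eq_of_adj_of_isBelow {a : ℕ} {m m' : ULift.{u} ℕ} (h : (parentTree.{u} π hπ).Adj m m')
    (hm : IsBelow π m.down a) (hm' : ¬ IsBelow π m'.down a) :
    m.down = a ∧ m'.down = π a ∧ a ≠ 0 := by
  rcases h with ⟨h0, h⟩ | ⟨h0, h⟩
  · cases hm with
    | refl => exact ⟨rfl, h.symm, h0⟩
    | step _ hb => exact absurd (h ▸ hb) hm'
  · exact absurd (IsBelow.step h0 (h ▸ hm)) hm'

theorem parentTree_connected : (parentTree.{u} π hπ).Connected := by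
  have key : ∀ m : ℕ, (parentTree.{u} π hπ).Reachable ⟨m⟩ ⟨0⟩ := by
    intro m
    induction m using Nat.strong_induction_on with
    | _ m ih =>
      by_cases hm : m = 0
      · subst hm; exact .rfl
      · exact (parentTree_adj_parent hπ hm).reachable.trans (ih _ (hπ m hm))
  exact SimpleGraph.connected_iff_exists_forall_reachable _ |>.2 ⟨⟨0⟩, fun a => (key a.down).symm⟩

theorem parentTree_isTree : (parentTree.{u} π hπ).IsTree := by
  refine ⟨parentTree_connected hπ, SimpleGraph.isAcyclic_iff_forall_adj_isBridge.2 ?_⟩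
  have key : ∀ m : ℕ, m ≠ 0 → (parentTree.{u} π hπ).IsBridge s(⟨m⟩, ⟨π m⟩) := by
    intro m hm
    rw [SimpleGraph.isBridge_iff]
    rintro ⟨w⟩
    -- a walk that avoids the edge stays inside the subtree at `m`
    have stay : ∀ (x y : ULift.{u} ℕ)
        (_ : ((parentTree.{u} π hπ).deleteEdges {s(⟨m⟩, ⟨π m⟩)}).Walk x y),
        IsBelow π x.down m → IsBelow π y.down m := by
      intro x y w
      induction w with
      | nil => exact id
      | @cons x z y h _ ih =>
        intro hx
        refine ih ?_
        by_contra hz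
        obtain ⟨hadj, hne⟩ := SimpleGraph.deleteEdges_adj.1 h
        obtain ⟨h1, h2, _⟩ := eq_of_adj_of_isBelow hπ hadj hx hz
        apply hne
        have hx' : x = ⟨m⟩ := ULift.ext _ _ h1
        have hz' : z = ⟨π m⟩ := ULift.ext _ _ h2
        rw [hx', hz']; rfl
    have := (stay _ _ w (IsBelow.refl m)).le hπ
    have := hπ m hm
    simp only at *
    omega
  intro a b hab
  rcases hab with ⟨h0, h⟩ | ⟨h0, h⟩
  · have := key a.down h0
    rwa [h] at this
  · have := key b.down h0
    rw [h, Sym2.eq_swap] at this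
    exact this

/-- Moving from `a` to its parent brings one closer to every node outside the subtree at `a`. -/
theorem parentTree_dist_parent_lt {a c : ℕ} (h : ¬ IsBelow π c a) :
    (parentTree.{u} π hπ).dist ⟨π a⟩ ⟨c⟩ + 1 ≤ (parentTree.{u} π hπ).dist ⟨a⟩ ⟨c⟩ := by
  have key : ∀ (x y : ULift.{u} ℕ) (w : (parentTree.{u} π hπ).Walk x y),
      IsBelow π x.down a → ¬ IsBelow π y.down a →
      (parentTree.{u} π hπ).dist ⟨π a⟩ y + 1 ≤ w.length := by
    intro x y w
    induction w with
    | nil => exact fun h h' => absurd h h'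
    | @cons x z y hadj w ih =>
      intro hx hy
      by_cases hz : IsBelow π z.down a
      · have := ih hz hy
        rw [SimpleGraph.Walk.length_cons]
        omega
      · obtain ⟨_, h2, _⟩ := eq_of_adj_of_isBelow hπ hadj hx hz
        have hz' : z = ⟨π a⟩ := ULift.ext _ _ h2
        subst hz'
        rw [SimpleGraph.Walk.length_cons]
        exact Nat.add_le_add_right (SimpleGraph.dist_le w) 1
  obtain ⟨w, hw⟩ := (parentTree_connected.{u} hπ).exists_walk_length_eq_dist ⟨a⟩ ⟨c⟩
  rw [← hw]
  exact key _ _ w (IsBelow.refl a) h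

end ParentTree

/-- The depth of a node below the root `0`. -/
def depth (π : ℕ → ℕ) : ℕ → ℕ
  | 0 => 0
  | m + 1 => depth π (min (π (m + 1)) m) + 1
decreasing_by omega

theorem depth_eq {π : ℕ → ℕ} {m : ℕ} (h : π m < m) : depth π m = depth π (π m) + 1 := by
  obtain ⟨m, rfl⟩ := Nat.exists_eq_succ_of_ne_zero (by omega : m ≠ 0)
  have h : π (m + 1) < m + 1 := h
  rw [Nat.succ_eq_add_one, depth, min_eq_left (by omega)]

theorem IsBelow.depth_le {π : ℕ → ℕ} (hπ : ∀ m, m ≠ 0 → π m < m) {m a : ℕ}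
    (h : IsBelow π m a) : depth π a ≤ depth π m ∧ (depth π a = depth π m → a = m) := by
  induction h with
  | refl => exact ⟨le_rfl, fun _ => rfl⟩
  | step hm _ ih =>
    rw [depth_eq (hπ _ hm)]
    exact ⟨by omega, fun h => by omega⟩

theorem SimpleGraph.dist_boxProd {α β : Type*} {G : SimpleGraph α} {H : SimpleGraph β}
    (hG : G.Connected) (hH : H.Connected) (x y : α × β) :
    (G.boxProd H).dist x y = G.dist x.1 y.1 + H.dist x.2 y.2 := by
  have h := SimpleGraph.edist_boxProd (G := G) (H := H) x y
  rw [← ((hG.boxProd hH) x y).coe_dist_eq_edist, ← (hG _ _).coe_dist_eq_edist,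
    ← (hH _ _).coe_dist_eq_edist] at h
  exact_mod_cast h

/-! ### Search orders and their labellings -/

variable {V : Type u}

/-- `q 1, …, q n` is an enumeration of the vertices of `G` in which every vertex `q k` but the
first has an earlier neighbour; `P k` is the position of its earliest neighbour, and `P` is
monotone, as in a breadth-first search.  Positions are counted from `1`, and `0` stands for
`none`. -/
structure IsSearchOrder (G : SimpleGraph V) (n : ℕ) (q : ℕ → V) (P : ℕ → ℕ) : Prop where
  one_le : 1 ≤ n
  inj : ∀ a b, 1 ≤ a → a ≤ n → 1 ≤ b → b ≤ n → q a = q b → a = b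
  surj : ∀ v, ∃ a, 1 ≤ a ∧ a ≤ n ∧ q a = v
  first : P 1 = 0
  pos : ∀ k, 2 ≤ k → k ≤ n → 1 ≤ P k ∧ P k < k
  mono : ∀ j k, 1 ≤ j → j ≤ k → k ≤ n → P j ≤ P k
  adj : ∀ k, 2 ≤ k → k ≤ n → G.Adj (q (P k)) (q k)
  min : ∀ a k, 1 ≤ a → a < k → k ≤ n → G.Adj (q a) (q k) → P k ≤ a

/-- In a search order, every vertex has at most two earlier neighbours, at the positions `P₁ k`
and `P₂ k`, where `P₂ k = 0` if there is only one of them; and no two vertices have the same pair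
of earlier neighbours. -/
structure HasParentPairs (G : SimpleGraph V) (n : ℕ) (q : ℕ → V) (P₁ P₂ : ℕ → ℕ) : Prop where
  second : ∀ k, 1 ≤ k → k ≤ n → P₂ k ≠ 0 → P₁ k < P₂ k ∧ P₂ k < k
  adj_iff : ∀ a k, 1 ≤ a → a < k → k ≤ n → (G.Adj (q a) (q k) ↔ P₁ k = a ∨ P₂ k = a)
  unique : ∀ j k, 1 ≤ j → j < k → k ≤ n → P₂ k ≠ 0 → P₁ j = P₁ k → P₂ j = P₂ k → False

/-- The edge from position `k` down to position `p` belongs to the class `c`. -/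
def IsDownEdge (P₁ P₂ c₁ c₂ : ℕ → ℕ) (k p c : ℕ) : Prop :=
  (p = P₁ k ∧ c = c₁ k) ∨ (P₂ k ≠ 0 ∧ p = P₂ k ∧ c = c₂ k)

/-- Class labels of the downward edges: `c₁ k` and `c₂ k` belong to the edges from `k` to `P₁ k`
and to `P₂ k`.  The edge of a vertex with one parent starts a new class, and the two edges of a
vertex with two parents are opposite to two edges of a square below it. -/
def IsClassLabel (n : ℕ) (P₁ P₂ c₁ c₂ : ℕ → ℕ) : Prop :=
  ∀ k, 1 ≤ k → k ≤ n → (P₂ k = 0 → c₁ k = k) ∧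
    (P₂ k ≠ 0 → ∃ x, IsDownEdge P₁ P₂ c₁ c₂ (P₂ k) x (c₁ k) ∧
      IsDownEdge P₁ P₂ c₁ c₂ (P₁ k) x (c₂ k))

/-! ### A labelled search order yields an isometric embedding -/

/-- The coordinate of position `k` in the tree of colour `b`. The nodes of that tree are `0` and
the positions at which a class of colour `b` starts; position `1`, which has no downward edge,
counts as one of them. -/
def treeCoord (P₁ P₂ c₁ : ℕ → ℕ) (col : ℕ → Bool) (b : Bool) : ℕ → ℕ
  | 0 => 0
  | k + 1 =>
    if P₂ (k + 1) = 0 then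
      if col (c₁ (k + 1)) = b then k + 1 else treeCoord P₁ P₂ c₁ col b (min (P₁ (k + 1)) k)
    else if col (c₁ (k + 1)) = b then treeCoord P₁ P₂ c₁ col b (min (P₂ (k + 1)) k)
    else treeCoord P₁ P₂ c₁ col b (min (P₁ (k + 1)) k)
decreasing_by all_goals omega

/-- The parent function of the tree of colour `b`. The values at the nodes at which no class of
colour `b` starts are irrelevant; the minimum only secures that they are smaller than the node. -/
def treeParent (P₁ P₂ c₁ : ℕ → ℕ) (col : ℕ → Bool) (b : Bool) (m : ℕ) : ℕ :=
  treeCoord P₁ P₂ c₁ col b (min (P₁ m) (m - 1))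

theorem treeCoord_le (P₁ P₂ c₁ : ℕ → ℕ) (col : ℕ → Bool) (b : Bool) (k : ℕ) :
    treeCoord P₁ P₂ c₁ col b k ≤ k := by
  induction k using Nat.strong_induction_on with
  | _ k ih =>
    cases k with
    | zero => simp [treeCoord]
    | succ k =>
      have h1 := ih (min (P₁ (k + 1)) k) (by omega)
      have h2 := ih (min (P₂ (k + 1)) k) (by omega)
      rw [treeCoord]
      split_ifs <;> omega

theorem treeParent_lt (P₁ P₂ c₁ : ℕ → ℕ) (col : ℕ → Bool) (b : Bool) (m : ℕ) (hm : m ≠ 0) :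
    treeParent P₁ P₂ c₁ col b m < m := by
  have := treeCoord_le P₁ P₂ c₁ col b (min (P₁ m) (m - 1))
  rw [treeParent]
  omega

theorem treeCoord_of_one {P₁ P₂ c₁ : ℕ → ℕ} {col : ℕ → Bool} {b : Bool} {k : ℕ} (hk : 1 ≤ k)
    (h : P₁ k < k) (h2 : P₂ k = 0) : treeCoord P₁ P₂ c₁ col b k =
      if col (c₁ k) = b then k else treeCoord P₁ P₂ c₁ col b (P₁ k) := by
  obtain ⟨k, rfl⟩ := Nat.exists_eq_succ_of_ne_zero (by omega : k ≠ 0)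
  rw [Nat.succ_eq_add_one] at *
  rw [treeCoord, if_pos h2, min_eq_left (by omega)]

theorem treeCoord_of_two {P₁ P₂ c₁ : ℕ → ℕ} {col : ℕ → Bool} {b : Bool} {k : ℕ} (hk : 1 ≤ k)
    (h : P₁ k < k) (h2 : P₂ k ≠ 0) (h3 : P₂ k < k) : treeCoord P₁ P₂ c₁ col b k =
      if col (c₁ k) = b then treeCoord P₁ P₂ c₁ col b (P₂ k)
      else treeCoord P₁ P₂ c₁ col b (P₁ k) := by
  obtain ⟨k, rfl⟩ := Nat.exists_eq_succ_of_ne_zero (by omega : k ≠ 0)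
  rw [Nat.succ_eq_add_one] at *
  rw [treeCoord, if_neg h2, min_eq_left (by omega), min_eq_left (by omega)]

theorem treeParent_eq {P₁ P₂ c₁ : ℕ → ℕ} {col : ℕ → Bool} {b : Bool} {k : ℕ}
    (h : P₁ k < k) : treeParent P₁ P₂ c₁ col b k = treeCoord P₁ P₂ c₁ col b (P₁ k) := by
  rw [treeParent, min_eq_left (by omega)]

section Embedding

variable {G : SimpleGraph V} {n : ℕ} {q : ℕ → V} {P₁ P₂ c₁ c₂ : ℕ → ℕ} {col : ℕ → Bool}
  (hS : IsSearchOrder G n q P₁) (hP : HasParentPairs G n q P₁ P₂)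
  (hL : IsClassLabel n P₁ P₂ c₁ c₂)
  (hcol : ∀ k, 1 ≤ k → k ≤ n → P₂ k ≠ 0 → col (c₁ k) ≠ col (c₂ k))

include hS in
theorem IsSearchOrder.lt {k : ℕ} (h1 : 1 ≤ k) (hn : k ≤ n) : P₁ k < k := by
  rcases h1.eq_or_lt with rfl | h
  · rw [hS.first]; exact one_pos
  · exact (hS.pos k h hn).2

include hS hP in
theorem IsDownEdge.lt {k p c : ℕ} (h1 : 1 ≤ k) (hn : k ≤ n)
    (h : IsDownEdge P₁ P₂ c₁ c₂ k p c) : p < k := by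
  rcases h with ⟨rfl, _⟩ | ⟨h2, rfl, _⟩
  · exact hS.lt h1 hn
  · exact (hP.second k h1 hn h2).2

include hS in
theorem IsDownEdge.one_le {k p c : ℕ} (h1 : 2 ≤ k) (hn : k ≤ n)
    (h : IsDownEdge P₁ P₂ c₁ c₂ k p c) : 1 ≤ p := by
  rcases h with ⟨rfl, _⟩ | ⟨h2, rfl, _⟩
  · exact (hS.pos k h1 hn).1
  · omega

include hS hP in
theorem IsDownEdge.adj {k p c : ℕ} (h1 : 2 ≤ k) (hn : k ≤ n)
    (h : IsDownEdge P₁ P₂ c₁ c₂ k p c) : G.Adj (q p) (q k) := by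
  refine (hP.adj_iff p k (h.one_le hS h1 hn) (h.lt hS hP (by omega) hn) hn).2 ?_
  rcases h with ⟨rfl, _⟩ | ⟨h2, rfl, _⟩ <;> simp

include hS hP hL hcol in
/-- A downward edge of colour `b` is a step to the parent in the tree of colour `b`, and does not
change the coordinate in the other tree. -/
theorem treeCoord_downEdge {k p c : ℕ} (h1 : 1 ≤ k) (hn : k ≤ n)
    (h : IsDownEdge P₁ P₂ c₁ c₂ k p c) :
    treeCoord P₁ P₂ c₁ col (!col c) p = treeCoord P₁ P₂ c₁ col (!col c) k ∧
    treeCoord P₁ P₂ c₁ col (col c) p =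
      treeParent P₁ P₂ c₁ col (col c) (treeCoord P₁ P₂ c₁ col (col c) k) ∧
    treeCoord P₁ P₂ c₁ col (col c) k ≠ 0 := by
  induction k using Nat.strong_induction_on generalizing p c with
  | _ k ih =>
    have hlt := hS.lt h1 hn
    by_cases h2 : P₂ k = 0
    · rcases h with ⟨rfl, rfl⟩ | ⟨h, _⟩
      · rw [treeCoord_of_one h1 hlt h2, treeCoord_of_one h1 hlt h2, if_neg (by simp),
          if_pos rfl, treeParent_eq hlt]
        exact ⟨rfl, rfl, by omega⟩
      · exact absurd h2 h
    · obtain ⟨x, hw, hu⟩ := (hL k h1 hn).2 h2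
      obtain ⟨h12, h2k⟩ := hP.second k h1 hn h2
      have h1' : 1 ≤ P₁ k := (hS.pos k (by omega) hn).1
      obtain ⟨w1, w2, w3⟩ := ih _ h2k (by omega) (by omega) hw
      obtain ⟨u1, u2, u3⟩ := ih _ hlt h1' (by omega) hu
      have hc : col (c₂ k) = !col (c₁ k) := by
        have := hcol k h1 hn h2
        revert this
        cases col (c₁ k) <;> cases col (c₂ k) <;> simp
      rw [hc, Bool.not_not] at u1
      rw [hc] at u2 u3
      have e1 : treeCoord P₁ P₂ c₁ col (col (c₁ k)) k =
          treeCoord P₁ P₂ c₁ col (col (c₁ k)) (P₂ k) := by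
        rw [treeCoord_of_two h1 hlt h2 h2k, if_pos rfl]
      have e2 : treeCoord P₁ P₂ c₁ col (!col (c₁ k)) k =
          treeCoord P₁ P₂ c₁ col (!col (c₁ k)) (P₁ k) := by
        rw [treeCoord_of_two h1 hlt h2 h2k, if_neg (by simp)]
      rcases h with ⟨rfl, rfl⟩ | ⟨h, rfl, rfl⟩
      · rw [e1, e2]
        exact ⟨rfl, by rw [← u1, w2], w3⟩
      · rw [hc, Bool.not_not, e1, e2]
        exact ⟨rfl, by rw [← w1, u2], u3⟩

/-- The sum of the depths of the two coordinates of position `k`. -/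
def treeLevel (P₁ P₂ c₁ : ℕ → ℕ) (col : ℕ → Bool) (k : ℕ) : ℕ :=
  depth (treeParent P₁ P₂ c₁ col true) (treeCoord P₁ P₂ c₁ col true k) +
    depth (treeParent P₁ P₂ c₁ col false) (treeCoord P₁ P₂ c₁ col false k)

include hS hP hL hcol in
theorem treeLevel_downEdge {k p c : ℕ} (h1 : 1 ≤ k) (hn : k ≤ n)
    (h : IsDownEdge P₁ P₂ c₁ c₂ k p c) :
    treeLevel P₁ P₂ c₁ col k = treeLevel P₁ P₂ c₁ col p + 1 := by
  obtain ⟨e1, e2, e3⟩ := treeCoord_downEdge hS hP hL hcol h1 hn h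
  have := depth_eq (treeParent_lt P₁ P₂ c₁ col (col c) _ e3)
  rw [treeLevel, treeLevel]
  cases hb : col c <;> rw [hb] at e1 e2 this <;> simp only [Bool.not_true, Bool.not_false] at e1 <;>
    rw [e1, e2, this] <;> omega

include hS hP hL hcol in
theorem treeLevel_mono {j k : ℕ} (h : j ≤ k) (hn : k ≤ n) :
    treeLevel P₁ P₂ c₁ col j ≤ treeLevel P₁ P₂ c₁ col k := by
  induction k using Nat.strong_induction_on generalizing j with
  | _ k ih =>
    rcases Nat.eq_zero_or_pos j with rfl | hj
    · simp [treeLevel, treeCoord, depth]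
    · rw [treeLevel_downEdge hS hP hL hcol hj (by omega) (.inl ⟨rfl, rfl⟩),
        treeLevel_downEdge hS hP hL hcol (by omega) hn (.inl ⟨rfl, rfl⟩)]
      have := hS.lt (k := k) (by omega) hn
      exact Nat.add_le_add_right (ih _ this (hS.mono j k hj h hn) (by omega)) 1

include hcol in
theorem color_second {k : ℕ} (h1 : 1 ≤ k) (hn : k ≤ n) (h2 : P₂ k ≠ 0) :
    col (c₂ k) = !col (c₁ k) := by
  have := hcol k h1 hn h2
  revert this
  cases col (c₁ k) <;> cases col (c₂ k) <;> simp

include hS hP hL hcol in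
/-- Different positions have different pairs of coordinates. -/
theorem treeCoord_injective {x y : ℕ} (hy : 1 ≤ y) (hyx : y < x) (hn : x ≤ n)
    (h : ∀ b, treeCoord P₁ P₂ c₁ col b x = treeCoord P₁ P₂ c₁ col b y) : False := by
  induction x using Nat.strong_induction_on generalizing y with
  | _ x ih =>
    have hlev : treeLevel P₁ P₂ c₁ col x = treeLevel P₁ P₂ c₁ col y := by
      rw [treeLevel, treeLevel, h, h]
    have hxlt := hS.lt (by omega) hn
    have hylt := hS.lt hy (by omega)
    by_cases h2 : P₂ x = 0
    · have := h (col (c₁ x))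
      rw [treeCoord_of_one (by omega) hxlt h2, if_pos rfl] at this
      have := treeCoord_le P₁ P₂ c₁ col (col (c₁ x)) y
      omega
    obtain hc := color_second hcol (by omega) hn h2
    have edge : ∀ b, ∃ p c, IsDownEdge P₁ P₂ c₁ c₂ x p c ∧ col c = b := by
      intro b
      by_cases hb : col (c₁ x) = b
      · exact ⟨_, _, .inl ⟨rfl, rfl⟩, hb⟩
      · refine ⟨_, _, .inr ⟨h2, rfl, rfl⟩, ?_⟩
        rw [hc]
        revert hb
        cases col (c₁ x) <;> cases b <;> simp
    by_cases h2y : P₂ y = 0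
    · -- `y` starts a class, and the parent of `x` along the other colour has `y` as a coordinate
      obtain ⟨p, c, hp, hcb⟩ := edge (!col (c₁ y))
      have e := (treeCoord_downEdge hS hP hL hcol (by omega) hn hp).1
      rw [hcb, Bool.not_not, h, treeCoord_of_one hy hylt h2y, if_pos rfl] at e
      have hle := treeCoord_le P₁ P₂ c₁ col (col (c₁ y)) p
      have hpx := hp.lt hS hP (by omega) hn
      have := treeLevel_mono hS hP hL hcol (e ▸ hle) (by omega : p ≤ n)
      have := treeLevel_downEdge hS hP hL hcol (by omega) hn hp
      omega
    · have same : ∀ {p p' c c'}, IsDownEdge P₁ P₂ c₁ c₂ x p c → IsDownEdge P₁ P₂ c₁ c₂ y p' c' →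
          col c = col c' → p = p' := by
        intro p p' c c' hp hp' hcc
        obtain ⟨e1, e2, -⟩ := treeCoord_downEdge hS hP hL hcol (by omega) hn hp
        obtain ⟨e1', e2', -⟩ := treeCoord_downEdge hS hP hL hcol hy (by omega) hp'
        rw [← hcc] at e1' e2'
        have hpp : ∀ b, treeCoord P₁ P₂ c₁ col b p = treeCoord P₁ P₂ c₁ col b p' := by
          intro b
          by_cases hb : b = col c
          · rw [hb, e2, e2', h]
          · have hb' : b = !col c := by
              revert hb; cases b <;> cases col c <;> simp
            rw [hb', e1, e1', h]
        have l1 := hp.lt hS hP (by omega) hn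
        have l2 := hp'.lt hS hP hy (by omega)
        have hx2 : 2 ≤ x := by omega
        have hy2 : 2 ≤ y := by
          by_contra hlt
          have := (hP.second y hy (by omega) h2y).1
          have := (hP.second y hy (by omega) h2y).2
          omega
        have o1 := hp.one_le hS hx2 hn
        have o2 := hp'.one_le hS hy2 (by omega)
        rcases lt_trichotomy p p' with hlt | heq | hlt
        · exact (ih p' (by omega) o1 hlt (by omega) (fun b => (hpp b).symm)).elim
        · exact heq
        · exact (ih p (by omega) o2 hlt (by omega) hpp).elim
      have hcy := color_second hcol hy (by omega) h2y
      by_cases hb : col (c₁ x) = col (c₁ y)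
      · have e1 := same (.inl ⟨rfl, rfl⟩) (.inl ⟨rfl, rfl⟩) hb
        have e2 := same (.inr ⟨h2, rfl, rfl⟩) (.inr ⟨h2y, rfl, rfl⟩) (by rw [hc, hcy, hb])
        exact hP.unique y x hy hyx hn h2 e1.symm e2.symm
      · have e1 := same (.inl ⟨rfl, rfl⟩) (.inr ⟨h2y, rfl, rfl⟩) (by
          rw [hcy]; revert hb; cases col (c₁ x) <;> cases col (c₁ y) <;> simp)
        have e2 := same (.inr ⟨h2, rfl, rfl⟩) (.inl ⟨rfl, rfl⟩) (by
          rw [hc]; revert hb; cases col (c₁ x) <;> cases col (c₁ y) <;> simp)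
        have := (hP.second x (by omega) hn h2).1
        have := (hP.second y hy (by omega) h2y).1
        omega

include hS hP hL hcol in
/-- If `y` comes before `x`, then one of the edges down from `x` leads closer to `y`, because in
the tree of its colour the coordinate of `y` does not lie below that of `x`. -/
theorem exists_downEdge_not_isBelow {x y : ℕ} (hy : 1 ≤ y) (hyx : y < x) (hn : x ≤ n) :
    ∃ p c, IsDownEdge P₁ P₂ c₁ c₂ x p c ∧
      ¬ IsBelow (treeParent P₁ P₂ c₁ col (col c)) (treeCoord P₁ P₂ c₁ col (col c) y)
        (treeCoord P₁ P₂ c₁ col (col c) x) := by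
  by_contra! hcon
  have hxlt := hS.lt (by omega) hn
  have hb1 := hcon _ _ (.inl ⟨rfl, rfl⟩)
  by_cases h2 : P₂ x = 0
  · have := hb1.le (treeParent_lt P₁ P₂ c₁ col _)
    rw [treeCoord_of_one (by omega) hxlt h2, if_pos rfl] at this
    have := treeCoord_le P₁ P₂ c₁ col (col (c₁ x)) y
    omega
  · have hb2 := hcon _ _ (.inr ⟨h2, rfl, rfl⟩)
    have below : ∀ b, IsBelow (treeParent P₁ P₂ c₁ col b) (treeCoord P₁ P₂ c₁ col b y)
        (treeCoord P₁ P₂ c₁ col b x) := by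
      rw [color_second hcol (by omega) hn h2] at hb2
      intro b
      by_cases hb : b = col (c₁ x)
      · rw [hb]; exact hb1
      · have hb' : b = !col (c₁ x) := by revert hb; cases b <;> cases col (c₁ x) <;> simp
        rw [hb']; exact hb2
    have hlev := treeLevel_mono hS hP hL hcol hyx.le hn
    have ht := (below true).depth_le (treeParent_lt P₁ P₂ c₁ col true)
    have hf := (below false).depth_le (treeParent_lt P₁ P₂ c₁ col false)
    rw [treeLevel, treeLevel] at hlev
    refine treeCoord_injective hS hP hL hcol hy hyx hn fun b => ?_
    cases b
    · exact hf.2 (by omega)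
    · exact ht.2 (by omega)

/-- The tree of colour `b`. -/
abbrev colorTree (P₁ P₂ c₁ : ℕ → ℕ) (col : ℕ → Bool) (b : Bool) : SimpleGraph (ULift.{u} ℕ) :=
  parentTree (treeParent P₁ P₂ c₁ col b) (treeParent_lt P₁ P₂ c₁ col b)

/-- The pair of coordinates of position `k`. -/
def treePoint (P₁ P₂ c₁ : ℕ → ℕ) (col : ℕ → Bool) (k : ℕ) : ULift.{u} ℕ × ULift.{u} ℕ :=
  (⟨treeCoord P₁ P₂ c₁ col true k⟩, ⟨treeCoord P₁ P₂ c₁ col false k⟩)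

include hS in
theorem IsSearchOrder.connected : G.Connected := by
  have key : ∀ k, 1 ≤ k → k ≤ n → G.Reachable (q 1) (q k) := by
    intro k
    induction k using Nat.strong_induction_on with
    | _ k ih =>
      intro h1 hn
      rcases h1.eq_or_lt with rfl | h
      · exact .rfl
      · obtain ⟨a, b⟩ := hS.pos k h hn
        exact (ih _ b a (by omega)).trans (hS.adj k h hn).reachable
  refine (SimpleGraph.connected_iff_exists_forall_reachable _).2 ⟨q 1, fun v => ?_⟩
  obtain ⟨a, h1, hn, rfl⟩ := hS.surj v
  exact key a h1 hn

include hS hP hL hcol in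
theorem treePoint_adj {k p c : ℕ} (h1 : 1 ≤ k) (hn : k ≤ n)
    (h : IsDownEdge P₁ P₂ c₁ c₂ k p c) :
    ((colorTree P₁ P₂ c₁ col true).boxProd (colorTree P₁ P₂ c₁ col false)).Adj
      (treePoint.{u} P₁ P₂ c₁ col k) (treePoint P₁ P₂ c₁ col p) := by
  obtain ⟨e1, e2, e3⟩ := treeCoord_downEdge hS hP hL hcol h1 hn h
  rw [SimpleGraph.boxProd_adj]
  cases hb : col c <;> rw [hb] at e1 e2 e3
  · exact .inr ⟨.inl ⟨e3, e2.symm⟩, ULift.ext _ _ e1.symm⟩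
  · exact .inl ⟨.inl ⟨e3, e2.symm⟩, ULift.ext _ _ e1.symm⟩

include hS hP hL hcol in
theorem dist_le_dist_treePoint (x y : ℕ) (hx : 1 ≤ x) (hxn : x ≤ n) (hy : 1 ≤ y) (hyn : y ≤ n) :
    G.dist (q x) (q y) ≤
      (colorTree.{u} P₁ P₂ c₁ col true).dist ⟨treeCoord P₁ P₂ c₁ col true x⟩
        ⟨treeCoord P₁ P₂ c₁ col true y⟩ +
      (colorTree.{u} P₁ P₂ c₁ col false).dist ⟨treeCoord P₁ P₂ c₁ col false x⟩
        ⟨treeCoord P₁ P₂ c₁ col false y⟩ := by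
  induction hs : x + y using Nat.strong_induction_on generalizing x y with
  | _ s ih =>
    wlog hyx : y ≤ x generalizing x y
    · have := this y x hy hyn hx hxn (by omega) (by omega)
      rw [G.dist_comm, SimpleGraph.dist_comm (G := colorTree P₁ P₂ c₁ col true),
        SimpleGraph.dist_comm (G := colorTree P₁ P₂ c₁ col false)]
      exact this
    rcases hyx.eq_or_lt with rfl | hyx
    · simp
    obtain ⟨p, c, hp, hb⟩ := exists_downEdge_not_isBelow hS hP hL hcol hy hyx hxn
    have hpx := hp.lt hS hP hx hxn
    have hp1 := hp.one_le hS (by omega) hxn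
    have h1 := ih (p + y) (by omega) p y hp1 (by omega) hy hyn rfl
    have h2 : (colorTree.{u} P₁ P₂ c₁ col (col c)).dist ⟨_⟩ ⟨_⟩ + 1 ≤
        (colorTree.{u} P₁ P₂ c₁ col (col c)).dist ⟨_⟩ ⟨_⟩ :=
      parentTree_dist_parent_lt.{u} (treeParent_lt P₁ P₂ c₁ col (col c)) hb
    obtain ⟨e1, e2, -⟩ := treeCoord_downEdge hS hP hL hcol hx hxn hp
    have h3 := hS.connected.dist_triangle (u := q x) (v := q p) (w := q y)
    rw [SimpleGraph.dist_eq_one_iff_adj.2 (hp.adj hS hP (by omega) hxn).symm] at h3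
    rw [← e2] at h2
    cases hb : col c <;> rw [hb] at e1 h2 <;> simp only [Bool.not_true, Bool.not_false] at e1 <;>
      rw [e1] at h1 <;> omega

include hS hP hL hcol in
/-- A search order whose edge classes have a proper colouring embeds the graph isometrically into
a product of two trees. -/
theorem isPartialDoubleTree_of_coloring : IsPartialDoubleTree G := by
  refine ⟨hS.connected, ULift.{u} ℕ, ULift.{u} ℕ, colorTree P₁ P₂ c₁ col true,
    colorTree P₁ P₂ c₁ col false, parentTree_isTree _, parentTree_isTree _, ?_⟩
  choose r hr1 hrn hr using hS.surj
  let f : G →g (colorTree.{u} P₁ P₂ c₁ col true).boxProd (colorTree P₁ P₂ c₁ col false) :=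
    { toFun := fun v => treePoint P₁ P₂ c₁ col (r v)
      map_rel' := by
        have key : ∀ x y, G.Adj x y → r x < r y →
            ((colorTree.{u} P₁ P₂ c₁ col true).boxProd (colorTree P₁ P₂ c₁ col false)).Adj
              (treePoint P₁ P₂ c₁ col (r y)) (treePoint P₁ P₂ c₁ col (r x)) := by
          intro x y hxy hlt
          have hne : r x ≠ 0 := by have := hr1 x; omega
          have := (hP.adj_iff (r x) (r y) (hr1 x) hlt (hrn y)).1 (by rw [hr, hr]; exact hxy)
          rcases this with h | h
          · exact treePoint_adj hS hP hL hcol (hr1 y) (hrn y) (.inl ⟨h.symm, rfl⟩)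
          · exact treePoint_adj hS hP hL hcol (hr1 y) (hrn y) (.inr ⟨by omega, h.symm, rfl⟩)
        intro x y hxy
        rcases lt_trichotomy (r x) (r y) with h | h | h
        · exact (key x y hxy h).symm
        · exact absurd ((hr x).symm.trans ((congrArg q h).trans (hr y))) hxy.ne
        · exact key y x hxy.symm h }
  refine ⟨f, fun x y => le_antisymm ?_ ?_⟩
  · obtain ⟨w, hw⟩ := hS.connected.exists_walk_length_eq_dist x y
    rw [← hw, ← SimpleGraph.Walk.length_map f w]
    exact SimpleGraph.dist_le _
  · rw [SimpleGraph.dist_boxProd (parentTree_connected _) (parentTree_connected _)]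
    have := dist_le_dist_treePoint hS hP hL hcol (r x) (r y) (hr1 x) (hrn x) (hr1 y) (hrn y)
    rwa [hr, hr] at this

end Embedding

/-! ### Isometric embeddings into products of two trees -/

theorem SimpleGraph.IsTree.eq_of_adj_of_dist {α : Type*} {T : SimpleGraph α} (hT : T.IsTree)
    {r a x y : α} (hx : T.Adj x a) (hy : T.Adj y a) (hdx : T.dist r x + 1 = T.dist r a)
    (hdy : T.dist r y + 1 = T.dist r a) : x = y := by
  have key : ∀ z, T.Adj z a → T.dist r z + 1 = T.dist r a →
      ∃ p : T.Walk r a, p.IsPath ∧ p.penultimate = z := by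
    intro z hz hd
    obtain ⟨p, hp⟩ := hT.connected.exists_walk_length_eq_dist r z
    exact ⟨p.concat hz, (p.concat hz).isPath_of_length_eq_dist (by simp [hp, hd]), by simp⟩
  obtain ⟨p, hp, rfl⟩ := key x hx hdx
  obtain ⟨p', hp', rfl⟩ := key y hy hdy
  rw [(hT.existsUnique_path r a).unique hp hp']

theorem SimpleGraph.Connected.exists_adj_dist {α : Type*} {G : SimpleGraph α} (hG : G.Connected)
    {x y : α} (h : x ≠ y) : ∃ z, G.Adj x z ∧ G.dist z y + 1 = G.dist x y := by
  obtain ⟨w, hw⟩ := hG.exists_walk_length_eq_dist x y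
  cases w with
  | nil => exact absurd rfl h
  | @cons _ z _ hxz w =>
    refine ⟨z, hxz, ?_⟩
    have h1 := SimpleGraph.dist_le w
    have h2 := hG.dist_triangle (u := x) (v := z) (w := y)
    rw [SimpleGraph.dist_eq_one_iff_adj.2 hxz] at h2
    rw [SimpleGraph.Walk.length_cons] at hw
    omega

/-- The maps `g₁` and `g₂` into the trees `T₁` and `T₂` are the two coordinates of an isometric
embedding of `G` into the product. -/
structure IsDoubleTreeEmbedding {V V₁ V₂ : Type*} (G : SimpleGraph V) (T₁ : SimpleGraph V₁)
    (T₂ : SimpleGraph V₂) (g₁ : V → V₁) (g₂ : V → V₂) : Prop where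
  connected : G.Connected
  tree₁ : T₁.IsTree
  tree₂ : T₂.IsTree
  dist_eq : ∀ x y, G.dist x y = T₁.dist (g₁ x) (g₁ y) + T₂.dist (g₂ x) (g₂ y)

theorem IsPartialDoubleTree.exists_embedding {V : Type u} {G : SimpleGraph V}
    (h : IsPartialDoubleTree G) :
    ∃ (V₁ V₂ : Type u) (T₁ : SimpleGraph V₁) (T₂ : SimpleGraph V₂) (g₁ : V → V₁) (g₂ : V → V₂),
      IsDoubleTreeEmbedding G T₁ T₂ g₁ g₂ := by
  obtain ⟨hG, V₁, V₂, T₁, T₂, h₁, h₂, f, hf⟩ := h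
  exact ⟨V₁, V₂, T₁, T₂, fun v => (f v).1, fun v => (f v).2, hG, h₁, h₂, fun x y => by
    rw [← hf, SimpleGraph.dist_boxProd h₁.connected h₂.connected]⟩

/-- `y` is a neighbour of `x` that is closer to the root `r`. -/
def IsDown {V : Type*} (G : SimpleGraph V) (r x y : V) : Prop :=
  G.Adj y x ∧ G.dist r y + 1 = G.dist r x

namespace IsDoubleTreeEmbedding

variable {V V₁ V₂ : Type*} {G : SimpleGraph V} {T₁ : SimpleGraph V₁}
    {T₂ : SimpleGraph V₂} {g₁ : V → V₁} {g₂ : V → V₂} {r : V}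

theorem swap (E : IsDoubleTreeEmbedding G T₁ T₂ g₁ g₂) : IsDoubleTreeEmbedding G T₂ T₁ g₂ g₁ :=
  ⟨E.connected, E.tree₂, E.tree₁, fun x y => by rw [E.dist_eq, add_comm]⟩

variable (E : IsDoubleTreeEmbedding G T₁ T₂ g₁ g₂)
include E

theorem ext {x y : V} (h₁ : g₁ x = g₁ y) (h₂ : g₂ x = g₂ y) : x = y := by
  rw [← E.connected.dist_eq_zero_iff, E.dist_eq, h₁, h₂]
  simp

theorem adj_or {x y : V} (h : G.Adj x y) :
    (T₁.Adj (g₁ x) (g₁ y) ∧ g₂ x = g₂ y) ∨ (g₁ x = g₁ y ∧ T₂.Adj (g₂ x) (g₂ y)) := by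
  have := E.dist_eq x y
  rw [SimpleGraph.dist_eq_one_iff_adj.2 h] at this
  rw [← SimpleGraph.dist_eq_one_iff_adj, ← SimpleGraph.dist_eq_one_iff_adj,
    ← E.tree₁.connected.dist_eq_zero_iff, ← E.tree₂.connected.dist_eq_zero_iff]
  omega

theorem isDown_or {x y : V} (h : G.Adj x y) (r : V) : IsDown G r x y ∨ IsDown G r y x := by
  have h1 := E.dist_eq r x
  have h2 := E.dist_eq r y
  rw [IsDown, IsDown]
  rcases E.adj_or h with ⟨ha, he⟩ | ⟨he, ha⟩
  · have := E.tree₁.dist_eq_dist_add_one_of_adj (g₁ r) ha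
    rw [he] at h1
    rcases this with h' | h'
    · exact .inl ⟨h.symm, by omega⟩
    · exact .inr ⟨h, by omega⟩
  · have := E.tree₂.dist_eq_dist_add_one_of_adj (g₂ r) ha
    rw [he] at h1
    rcases this with h' | h'
    · exact .inl ⟨h.symm, by omega⟩
    · exact .inr ⟨h, by omega⟩

/-- A downward edge that changes the first coordinate moves it to its parent and keeps the
second. -/
theorem isDown_fst {x y : V} (h : IsDown G r x y) (h₁ : g₁ x ≠ g₁ y) :
    g₂ x = g₂ y ∧ T₁.Adj (g₁ y) (g₁ x) ∧ T₁.dist (g₁ r) (g₁ y) + 1 = T₁.dist (g₁ r) (g₁ x) := by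
  rcases E.adj_or h.1 with ⟨ha, he⟩ | ⟨he, ha⟩
  · refine ⟨he.symm, ha, ?_⟩
    have h1 := E.dist_eq r x
    have h2 := E.dist_eq r y
    rw [he] at h2
    have := h.2
    omega
  · exact absurd he.symm h₁

theorem isDown_snd {x y : V} (h : IsDown G r x y) (h₁ : g₁ x = g₁ y) :
    g₂ x ≠ g₂ y := fun h₂ => h.1.ne (E.ext h₁ h₂).symm

theorem isDown_unique {x y y' : V} (h : IsDown G r x y) (h' : IsDown G r x y')
    (h₁ : g₁ x ≠ g₁ y) (h₁' : g₁ x ≠ g₁ y') : y = y' := by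
  obtain ⟨e, a, d⟩ := E.isDown_fst h h₁
  obtain ⟨e', a', d'⟩ := E.isDown_fst h' h₁'
  exact E.ext (E.tree₁.eq_of_adj_of_dist a a' d d') (e.symm.trans e')

theorem isDown_ne_iff {x y y' : V} (h : IsDown G r x y) (h' : IsDown G r x y') (hne : y ≠ y') :
    g₁ x ≠ g₁ y ↔ g₁ x = g₁ y' := by
  constructor
  · intro h₁
    by_contra h₂
    exact hne (E.isDown_unique h h' h₁ h₂)
  · intro h₁ h₂
    exact hne (E.swap.isDown_unique h h' (E.isDown_snd h h₂) (E.isDown_snd h' h₁))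

/-- A vertex has at most two neighbours closer to the root: one for each tree. -/
theorem not_three_isDown {x y₁ y₂ y₃ : V} (h₁ : IsDown G r x y₁) (h₂ : IsDown G r x y₂)
    (h₃ : IsDown G r x y₃) (h₁₂ : y₁ ≠ y₂) (h₁₃ : y₁ ≠ y₃) (h₂₃ : y₂ ≠ y₃) : False := by
  have a := E.isDown_ne_iff h₁ h₂ h₁₂
  have b := E.isDown_ne_iff h₁ h₃ h₁₃
  have c := E.isDown_ne_iff h₂ h₃ h₂₃
  tauto

theorem isDown_pair_unique_aux {x x' u w : V} (hu : IsDown G r x u) (hw : IsDown G r x w)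
    (hu' : IsDown G r x' u) (hw' : IsDown G r x' w) (hne : u ≠ w) (h : g₁ x ≠ g₁ u) : x = x' := by
  have hxw := (E.isDown_ne_iff hu hw hne).1 h
  obtain ⟨e2, -, d1⟩ := E.isDown_fst hu h
  obtain ⟨-, -, d2⟩ := E.swap.isDown_fst hw (E.isDown_snd hw hxw)
  by_cases h' : g₁ x' = g₁ u
  · -- `x'` would have both coordinates one level below those of `x`
    obtain ⟨e2', -⟩ := E.isDown_fst hw' (by
      intro h2
      exact (E.isDown_ne_iff hu' hw' hne).2 h2 h')
    have l1 := E.dist_eq r x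
    have l2 := E.dist_eq r x'
    rw [h', e2'] at l2
    have := hu.2
    have := hu'.2
    omega
  · have hxw' := (E.isDown_ne_iff hu' hw' hne).1 h'
    obtain ⟨e2', -, -⟩ := E.isDown_fst hu' h'
    exact E.ext (hxw.trans hxw'.symm) (e2.trans e2'.symm)

/-- A pair of vertices has at most one common neighbour above it. -/
theorem isDown_pair_unique {x x' u w : V} (hu : IsDown G r x u) (hw : IsDown G r x w)
    (hu' : IsDown G r x' u) (hw' : IsDown G r x' w) (hne : u ≠ w) : x = x' := by
  by_cases h : g₁ x = g₁ u
  · exact E.swap.isDown_pair_unique_aux hu hw hu' hw' hne (E.isDown_snd hu h)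
  · exact E.isDown_pair_unique_aux hu hw hu' hw' hne h

/-- On a geodesic from `v` to the root, the second coordinate has to drop to its parent. -/
theorem exists_drop_snd {v : V} (h : g₂ v ≠ g₂ r) :
    ∃ z, G.dist v z + G.dist z r = G.dist v r ∧ T₂.Adj (g₂ z) (g₂ v) ∧
      T₂.dist (g₂ r) (g₂ z) + 1 = T₂.dist (g₂ r) (g₂ v) := by
  induction hd : G.dist v r using Nat.strong_induction_on generalizing v with
  | _ d ih =>
    obtain ⟨v', ha, hdist⟩ := E.connected.exists_adj_dist (x := v) (y := r)
      (fun h' => h (by rw [h']))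
    have hdown : IsDown G r v v' := ⟨ha.symm, by rw [G.dist_comm, hdist, G.dist_comm]⟩
    by_cases h2 : g₂ v = g₂ v'
    · obtain ⟨z, hz, hz'⟩ := ih _ (by omega) (v := v') (by rwa [← h2]) rfl
      rw [← h2] at hz'
      refine ⟨z, ?_, hz'⟩
      have t1 := E.connected.dist_triangle (u := v) (v := v') (w := z)
      have t2 := E.connected.dist_triangle (u := v) (v := z) (w := r)
      rw [SimpleGraph.dist_eq_one_iff_adj.2 ha] at t1
      omega
    · obtain ⟨-, a, b⟩ := E.swap.isDown_fst hdown h2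
      refine ⟨v', ?_, a, b⟩
      rw [SimpleGraph.dist_eq_one_iff_adj.2 ha]
      omega

/-- The quadrangle condition: below two neighbours `u` and `w` of `x` there is a vertex `y` that
completes a square, with the coordinates that the square must have. -/
theorem exists_square {x u w : V} (hu : IsDown G r x u) (hw : IsDown G r x w)
    (h₁ : g₁ x ≠ g₁ u) (h₂ : g₁ x = g₁ w) :
    ∃ y, IsDown G r u y ∧ IsDown G r w y ∧ g₁ y = g₁ u ∧ g₂ y = g₂ w := by
  obtain ⟨eu, au, du⟩ := E.isDown_fst hu h₁
  obtain ⟨-, aw, dw⟩ := E.swap.isDown_fst hw (E.isDown_snd hw h₂)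
  have hur : g₂ u ≠ g₂ r := by
    rw [← eu]
    intro h
    rw [h, SimpleGraph.dist_self] at dw
    omega
  obtain ⟨z, hz, az, dz⟩ := E.exists_drop_snd hur
  rw [← eu] at az dz
  have ez : g₂ z = g₂ w := E.tree₂.eq_of_adj_of_dist az aw dz dw
  -- `u` lies on a geodesic from `x` to `z`
  have hxz : G.dist x z = G.dist u z + 1 := by
    have t1 := E.connected.dist_triangle (u := x) (v := u) (w := z)
    have t2 := E.connected.dist_triangle (u := x) (v := z) (w := r)
    rw [SimpleGraph.dist_eq_one_iff_adj.2 hu.1.symm] at t1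
    have := hu.2
    rw [G.dist_comm, G.dist_comm (u := r)] at this
    omega
  have l1 := E.dist_eq x z
  have l2 := E.dist_eq u z
  have l3 := E.dist_eq w z
  rw [← eu] at l2
  rw [ez, SimpleGraph.dist_self, ← h₂] at l3
  obtain ⟨y, hy, hyz⟩ := E.connected.exists_adj_dist (x := w) (y := z) (by
    intro h
    rw [h, SimpleGraph.dist_self] at l3
    omega)
  have l4 := E.dist_eq y z
  rcases E.adj_or hy with ⟨ay, ey⟩ | ⟨ey, ay⟩
  · have e1 : g₁ y = g₁ u := by
      rw [← h₂] at ay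
      rw [← ey, ez, SimpleGraph.dist_self] at l4
      refine E.tree₁.eq_of_adj_of_dist (r := g₁ z) ay.symm au ?_ ?_
      · rw [SimpleGraph.dist_comm, SimpleGraph.dist_comm (u := g₁ z)]
        omega
      · rw [SimpleGraph.dist_comm, SimpleGraph.dist_comm (u := g₁ z)]
        omega
    have m1 := E.dist_eq r y
    have m2 := E.dist_eq r w
    have m3 := E.dist_eq r u
    rw [e1, ← ey] at m1
    rw [← h₂] at m2
    rw [← eu] at m3
    have hadj : G.Adj y u := by
      rw [← SimpleGraph.dist_eq_one_iff_adj, E.dist_eq, e1, ← ey, ← eu,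
        SimpleGraph.dist_self, SimpleGraph.dist_eq_one_iff_adj.2 aw]
    exact ⟨y, ⟨hadj, by omega⟩, ⟨hy.symm, by omega⟩, e1, ey.symm⟩
  · rw [← ey, ← h₂] at l4
    omega

end IsDoubleTreeEmbedding

/-! ### Search orders of partial double trees -/

section SearchOrder

variable {V : Type u} {G : SimpleGraph V} {n : ℕ} {q : ℕ → V} {P₁ P₂ c₁ c₂ : ℕ → ℕ}
  (hS : IsSearchOrder G n q P₁)

include hS

theorem IsSearchOrder.depth_mono {j k : ℕ} (hj : 1 ≤ j) (h : j ≤ k) (hn : k ≤ n) :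
    depth P₁ j ≤ depth P₁ k := by
  induction k using Nat.strong_induction_on generalizing j with
  | _ k ih =>
    rcases hj.eq_or_lt with rfl | hj2
    · rw [depth_eq (hS.lt le_rfl (by omega)), depth_eq (hS.lt (by omega) hn), hS.first]
      simp [depth]
    · rw [depth_eq (hS.lt hj (by omega)), depth_eq (hS.lt (by omega) hn)]
      have := hS.lt (k := k) (by omega) hn
      exact Nat.add_le_add_right (ih _ this (hS.pos j hj2 (by omega)).1 (hS.mono j k hj h hn)
        (by omega)) 1

/-- The level of a position in a search order is the distance from its first vertex. -/
theorem IsSearchOrder.dist_eq_depth {k : ℕ} (h1 : 1 ≤ k) (hn : k ≤ n) :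
    G.dist (q 1) (q k) + 1 = depth P₁ k := by
  have d1 : depth P₁ 1 = 1 := by
    rw [depth_eq (hS.lt le_rfl (by omega)), hS.first]
    simp [depth]
  apply le_antisymm
  · induction k using Nat.strong_induction_on with
    | _ k ih =>
      rcases h1.eq_or_lt with rfl | h2
      · simp [d1]
      · obtain ⟨a, b⟩ := hS.pos k h2 hn
        have := ih _ b a (by omega)
        rw [depth_eq b]
        have t := hS.connected.dist_triangle (u := q 1) (v := q (P₁ k)) (w := q k)
        rw [SimpleGraph.dist_eq_one_iff_adj.2 (hS.adj k h2 hn)] at t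
        omega
  · choose r hr1 hrn hr using hS.surj
    have rq : ∀ k, 1 ≤ k → k ≤ n → r (q k) = k := fun k h1 hn =>
      hS.inj _ _ (hr1 _) (hrn _) h1 hn (hr _)
    have key : ∀ x y (w : G.Walk x y), depth P₁ (r y) ≤ depth P₁ (r x) + w.length := by
      intro x y w
      induction w with
      | nil => simp
      | @cons x z y hxz w ih =>
        have : depth P₁ (r z) ≤ depth P₁ (r x) + 1 := by
          rcases le_or_gt (r z) (r x) with h | h
          · have := hS.depth_mono (hr1 z) h (hrn x)
            omega
          · have h3 := hS.min (r x) (r z) (hr1 x) h (hrn z) (by rwa [hr, hr])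
            have h2 : 2 ≤ r z := by have := hr1 x; omega
            rw [depth_eq (hS.lt (hr1 z) (hrn z))]
            have := hS.depth_mono (hS.pos _ h2 (hrn z)).1 h3 (hrn x)
            omega
        rw [SimpleGraph.Walk.length_cons]
        omega
    obtain ⟨w, hw⟩ := hS.connected.exists_walk_length_eq_dist (q 1) (q k)
    have := key _ _ w
    rw [rq _ h1 hn, rq _ le_rfl hS.one_le, hw, d1] at this
    omega

theorem IsSearchOrder.lt_of_isDown {j k : ℕ} (hj : 1 ≤ j) (hjn : j ≤ n) (hk : 1 ≤ k) (hkn : k ≤ n)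
    (h : IsDown G (q 1) (q k) (q j)) : j < k := by
  by_contra! hle
  have := hS.depth_mono hk hle hjn
  rw [← hS.dist_eq_depth hj hjn, ← hS.dist_eq_depth hk hkn] at this
  have := h.2
  omega

variable {V₁ V₂ : Type u} {T₁ : SimpleGraph V₁} {T₂ : SimpleGraph V₂} {g₁ : V → V₁} {g₂ : V → V₂}

theorem IsSearchOrder.isDown (E : IsDoubleTreeEmbedding G T₁ T₂ g₁ g₂) {j k : ℕ} (hj : 1 ≤ j)
    (hjk : j < k) (hn : k ≤ n) (h : G.Adj (q j) (q k)) : IsDown G (q 1) (q k) (q j) := by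
  rcases E.isDown_or h (q 1) with h' | h'
  · have := hS.lt_of_isDown (by omega) hn hj (by omega) h'
    omega
  · exact h'

theorem IsSearchOrder.ne {j k : ℕ} (hj : 1 ≤ j) (hjk : j < k) (hn : k ≤ n) : q j ≠ q k :=
  fun h => hjk.ne (hS.inj j k hj (by omega) (by omega) hn h)

theorem IsPartialDoubleTree.not_three_earlier (hG : IsPartialDoubleTree G) {a b c k : ℕ}
    (ha : 1 ≤ a) (hab : a < b) (hbc : b < c) (hck : c < k) (hk : k ≤ n)
    (h₁ : G.Adj (q a) (q k)) (h₂ : G.Adj (q b) (q k)) (h₃ : G.Adj (q c) (q k)) : False := by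
  obtain ⟨_, _, _, _, _, _, E⟩ := hG.exists_embedding
  exact E.not_three_isDown (hS.isDown E (by omega) (by omega) hk h₁)
    (hS.isDown E (by omega) (by omega) hk h₂) (hS.isDown E (by omega) hck hk h₃)
    (hS.ne ha hab (by omega)) (hS.ne ha (by omega) (by omega)) (hS.ne (by omega) hbc (by omega))

theorem IsPartialDoubleTree.not_common_earlier (hG : IsPartialDoubleTree G) {a b j k : ℕ}
    (ha : 1 ≤ a) (hab : a < b) (hbj : b < j) (hjk : j < k) (hk : k ≤ n)
    (h₁ : G.Adj (q a) (q j)) (h₂ : G.Adj (q b) (q j)) (h₃ : G.Adj (q a) (q k))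
    (h₄ : G.Adj (q b) (q k)) : False := by
  obtain ⟨_, _, _, _, _, _, E⟩ := hG.exists_embedding
  exact hS.ne (by omega) hjk hk (E.isDown_pair_unique
    (hS.isDown E (by omega) (by omega) (by omega) h₁)
    (hS.isDown E (by omega) (by omega) (by omega) h₂) (hS.isDown E (by omega) (by omega) hk h₃)
    (hS.isDown E (by omega) (by omega) hk h₄) (hS.ne ha hab (by omega)))

omit hS in
/-- Position `x` is a parent of position `k`. -/
def IsParent (P₁ P₂ : ℕ → ℕ) (k x : ℕ) : Prop := x = P₁ k ∨ (P₂ k ≠ 0 ∧ x = P₂ k)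

theorem HasParentPairs.isParent (hP : HasParentPairs G n q P₁ P₂) {k x : ℕ} (hk : 1 ≤ k)
    (hn : k ≤ n) (hx : 1 ≤ x) (hxn : x ≤ n) (h : IsDown G (q 1) (q k) (q x)) :
    IsParent P₁ P₂ k x := by
  have hlt := hS.lt_of_isDown hx hxn hk hn h
  rcases (hP.adj_iff x k hx hlt hn).1 h.1 with h | h
  · exact .inl h.symm
  · exact .inr ⟨by omega, h.symm⟩

theorem HasParentPairs.isDown (hP : HasParentPairs G n q P₁ P₂)
    (E : IsDoubleTreeEmbedding G T₁ T₂ g₁ g₂) {k x : ℕ} (hk : 2 ≤ k) (hn : k ≤ n)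
    (h : IsParent P₁ P₂ k x) : 1 ≤ x ∧ x < k ∧ IsDown G (q 1) (q k) (q x) := by
  have h1 : 1 ≤ x ∧ x < k := by
    rcases h with rfl | ⟨h2, rfl⟩
    · exact hS.pos k hk hn
    · exact ⟨by omega, (hP.second k (by omega) hn h2).2⟩
  refine ⟨h1.1, h1.2, hS.isDown E h1.1 h1.2 hn ((hP.adj_iff x k h1.1 h1.2 hn).2 ?_)⟩
  rcases h with rfl | ⟨h2, rfl⟩ <;> simp

/-- The two parents of a position have a common parent. -/
theorem HasParentPairs.exists_square (hP : HasParentPairs G n q P₁ P₂)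
    (E : IsDoubleTreeEmbedding G T₁ T₂ g₁ g₂) {k : ℕ} (hk : 1 ≤ k) (hn : k ≤ n)
    (h : P₂ k ≠ 0) : ∃ x, IsParent P₁ P₂ (P₁ k) x ∧ IsParent P₁ P₂ (P₂ k) x := by
  obtain ⟨h12, h2k⟩ := hP.second k hk hn h
  obtain ⟨hu1, huk, hu⟩ := hP.isDown hS E (by omega) hn (.inl rfl : IsParent P₁ P₂ k (P₁ k))
  obtain ⟨hw1, hwk, hw⟩ := hP.isDown hS E (by omega) hn (.inr ⟨h, rfl⟩ : IsParent P₁ P₂ k (P₂ k))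
  have hne := hS.ne hu1 h12 (by omega)
  have key : ∃ y, IsDown G (q 1) (q (P₁ k)) y ∧ IsDown G (q 1) (q (P₂ k)) y := by
    by_cases h' : g₁ (q k) = g₁ (q (P₁ k))
    · obtain ⟨y, a, b, -⟩ := E.swap.exists_square hu hw (E.isDown_snd hu h') (by
        by_contra h2
        exact hne (E.swap.isDown_unique hu hw (E.isDown_snd hu h') h2))
      exact ⟨y, a, b⟩
    · obtain ⟨y, a, b, -⟩ := E.exists_square hu hw h' ((E.isDown_ne_iff hu hw hne).1 h')
      exact ⟨y, a, b⟩
  obtain ⟨y, a, b⟩ := key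
  obtain ⟨x, hx1, hxn, rfl⟩ := hS.surj y
  exact ⟨x, hP.isParent hS hu1 (by omega) hx1 hxn a, hP.isParent hS hw1 (by omega) hx1 hxn b⟩

/-- The first coordinate changes along an edge if and only if it changes along the opposite edge
of a square. -/
theorem HasParentPairs.square_fst (hP : HasParentPairs G n q P₁ P₂)
    (E : IsDoubleTreeEmbedding G T₁ T₂ g₁ g₂) {k u w x : ℕ} (hk : 2 ≤ k) (hn : k ≤ n)
    (hu2 : 2 ≤ u) (hw2 : 2 ≤ w)
    (hu : IsParent P₁ P₂ k u) (hw : IsParent P₁ P₂ k w) (huw : u ≠ w)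
    (hux : IsParent P₁ P₂ u x) (hwx : IsParent P₁ P₂ w x) :
    g₁ (q k) = g₁ (q u) ↔ g₁ (q w) = g₁ (q x) := by
  obtain ⟨hu1, huk, hu⟩ := hP.isDown hS E hk hn hu
  obtain ⟨hw1, hwk, hw⟩ := hP.isDown hS E hk hn hw
  obtain ⟨hx1, hxu, hux⟩ := hP.isDown hS E hu2 (by omega) hux
  obtain ⟨-, hxw, hwx⟩ := hP.isDown hS E hw2 (by omega) hwx
  have hne : q u ≠ q w := fun h => huw (hS.inj _ _ hu1 (by omega) hw1 (by omega) h)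
  have hkx : q x ≠ q k := hS.ne hx1 (by omega) hn
  have hiff := E.isDown_ne_iff hu hw hne
  by_cases h : g₁ (q k) = g₁ (q u)
  · simp only [h, true_iff]
    by_contra hwx1
    have hkw : g₁ (q k) ≠ g₁ (q w) := fun h' => (hiff.2 h') h
    have e1 := (E.isDown_fst hw hkw).1
    have e2 := (E.isDown_fst hwx hwx1).1
    have hux2 : g₂ (q u) ≠ g₂ (q x) := by
      rw [← e2, ← e1]
      exact (E.isDown_snd hu h).symm
    have e3 := (E.swap.isDown_fst hux hux2).1
    exact hkx (E.ext (e3.symm.trans h.symm) (e2.symm.trans e1.symm))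
  · simp only [h, false_iff]
    intro hwx1
    have hkw := hiff.1 h
    have e1 := (E.isDown_fst hu h).1
    have hux1 : g₁ (q u) ≠ g₁ (q x) := by
      rw [← hwx1, ← hkw]
      exact fun h' => h h'.symm
    have e2 := (E.isDown_fst hux hux1).1
    exact hkx (E.ext (hwx1.symm.trans hkw.symm) (e2.symm.trans e1.symm))

omit hS in
theorem IsDownEdge.isParent {k p c : ℕ} (h : IsDownEdge P₁ P₂ c₁ c₂ k p c) :
    IsParent P₁ P₂ k p := by
  rcases h with ⟨h, -⟩ | ⟨h, h', -⟩
  · exact .inl h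
  · exact .inr ⟨h, h'⟩

theorem HasParentPairs.fst_eq_iff_of_class (hP : HasParentPairs G n q P₁ P₂)
    (hL : IsClassLabel n P₁ P₂ c₁ c₂) (E : IsDoubleTreeEmbedding G T₁ T₂ g₁ g₂) {k p c : ℕ}
    (hk : 2 ≤ k) (hn : k ≤ n) (h : IsDownEdge P₁ P₂ c₁ c₂ k p c) :
    g₁ (q c) = g₁ (q (P₁ c)) ↔ g₁ (q k) = g₁ (q p) := by
  induction k using Nat.strong_induction_on generalizing p c with
  | _ k ih =>
    by_cases h2 : P₂ k = 0
    · rcases h with ⟨rfl, rfl⟩ | ⟨h, _⟩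
      · rw [(hL k (by omega) hn).1 h2]
      · exact absurd h2 h
    · obtain ⟨x, hw, hu⟩ := (hL k (by omega) hn).2 h2
      obtain ⟨h12, h2k⟩ := hP.second k (by omega) hn h2
      have h1 := (hS.pos k hk hn).1
      have hx := (hP.isDown hS E (by omega) (by omega) hw.isParent).1
      have hu2 : 2 ≤ P₁ k := by
        have := hu.lt hS hP h1 (by omega)
        omega
      rcases h with ⟨rfl, rfl⟩ | ⟨h, rfl, rfl⟩
      · rw [ih _ h2k (by omega) (by omega) hw]
        exact (hP.square_fst hS E hk hn hu2 (by omega) (.inl rfl) (.inr ⟨h2, rfl⟩) h12.ne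
          hu.isParent hw.isParent).symm
      · rw [ih _ (by omega) hu2 (by omega) hu]
        exact (hP.square_fst hS E hk hn (by omega) hu2 (.inr ⟨h2, rfl⟩) (.inl rfl) h12.ne'
          hw.isParent hu.isParent).symm

/-- In a partial double tree, the two edges down from a vertex with two parents point along
different trees, so that the classes can be coloured. -/
theorem HasParentPairs.exists_coloring (hP : HasParentPairs G n q P₁ P₂)
    (hL : IsClassLabel n P₁ P₂ c₁ c₂) (hG : IsPartialDoubleTree G) :
    ∃ col : ℕ → Bool, ∀ k, 1 ≤ k → k ≤ n → P₂ k ≠ 0 → col (c₁ k) ≠ col (c₂ k) := by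
  classical
  obtain ⟨_, _, _, _, g₁, g₂, E⟩ := hG.exists_embedding
  refine ⟨fun c => decide (g₁ (q c) = g₁ (q (P₁ c))), fun k h1 hn h2 h => ?_⟩
  obtain ⟨h12, h2k⟩ := hP.second k h1 hn h2
  have hk : 2 ≤ k := by omega
  rw [decide_eq_decide, hP.fst_eq_iff_of_class hS hL E hk hn (.inl ⟨rfl, rfl⟩),
    hP.fst_eq_iff_of_class hS hL E hk hn (.inr ⟨h2, rfl, rfl⟩)] at h
  obtain ⟨hu1, huk, hu⟩ := hP.isDown hS E (by omega) hn (.inl rfl : IsParent P₁ P₂ k (P₁ k))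
  obtain ⟨hw1, hwk, hw⟩ := hP.isDown hS E (by omega) hn (.inr ⟨h2, rfl⟩ : IsParent P₁ P₂ k (P₂ k))
  have := E.isDown_ne_iff hu hw (hS.ne hu1 h12 (by omega))
  tauto

end SearchOrder

/-! ### Running programs -/

namespace RAM

/-- The store after a loop-free program (a junk value if there are loops). -/
def Program.eval : Program → Store → Store
  | .skip, s => s
  | .instr i, s => i.exec s
  | .seq p q, s => q.eval (p.eval s)
  | .cond b p q, s => if b.eval s then p.eval s else q.eval s
  | .loop _ _, s => s

/-- A program without loops. -/
def Program.LoopFree : Program → Prop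
  | .skip => True
  | .instr _ => True
  | .seq p q => p.LoopFree ∧ q.LoopFree
  | .cond _ p q => p.LoopFree ∧ q.LoopFree
  | .loop _ _ => False

/-- The number of nodes of the program text, which bounds the running time if there are no
loops. -/
def Program.size : Program → ℕ
  | .skip => 1
  | .instr _ => 1
  | .seq p q => p.size + q.size + 1
  | .cond _ p q => p.size + q.size + 1
  | .loop _ p => p.size + 1

/-- On top of any stack of further programs, the program `p` started in `s` is finished after at
most `t` steps, in the store `s'`. -/
def Runs (p : Program) (s : Store) (t : ℕ) (s' : Store) : Prop :=
  ∀ K, ∃ k ≤ t, step^[k] (p :: K, s) = (K, s')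

theorem Runs.haltsWithin {p : Program} {s s' : Store} {t : ℕ} (h : Runs p s t s') :
    HaltsWithin p s t s' := h []

theorem Runs.mono {p : Program} {s s' : Store} {t t' : ℕ} (h : Runs p s t s') (ht : t ≤ t') :
    Runs p s t' s' := fun K => by
  obtain ⟨k, hk, e⟩ := h K
  exact ⟨k, hk.trans ht, e⟩

theorem Runs.of_step {p q : Program} {s s' : Store} {t : ℕ}
    (h : ∀ K, step (p :: K, s) = (q :: K, s)) (hq : Runs q s t s') : Runs p s (t + 1) s' :=
  fun K => by
  obtain ⟨k, hk, e⟩ := hq K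
  exact ⟨k + 1, by omega, by rw [Function.iterate_succ_apply, h, e]⟩

theorem Runs.of_step_two {p q r : Program} {s s₁ s' : Store} {t₁ t₂ : ℕ}
    (h : ∀ K, step (p :: K, s) = (q :: r :: K, s)) (hq : Runs q s t₁ s₁) (hr : Runs r s₁ t₂ s') :
    Runs p s (t₁ + t₂ + 1) s' := fun K => by
  obtain ⟨k, hk, e⟩ := hq (r :: K)
  obtain ⟨l, hl, e'⟩ := hr K
  refine ⟨l + k + 1, by omega, ?_⟩
  rw [Function.iterate_succ_apply, h, Function.iterate_add_apply, e, e']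

theorem Runs.seq {p q : Program} {s s₁ s' : Store} {t₁ t₂ : ℕ} (hp : Runs p s t₁ s₁)
    (hq : Runs q s₁ t₂ s') : Runs (.seq p q) s (t₁ + t₂ + 1) s' :=
  .of_step_two (fun _ => rfl) hp hq

theorem Runs.cond_true {b : Test} {p q : Program} {s s' : Store} {t : ℕ} (hb : b.eval s = true)
    (hp : Runs p s t s') : Runs (.cond b p q) s (t + 1) s' :=
  .of_step (fun _ => by simp [step, hb]) hp

theorem Runs.cond_false {b : Test} {p q : Program} {s s' : Store} {t : ℕ} (hb : b.eval s = false)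
    (hq : Runs q s t s') : Runs (.cond b p q) s (t + 1) s' :=
  .of_step (fun _ => by simp [step, hb]) hq

theorem Runs.of_loopFree {p : Program} (hp : p.LoopFree) (s : Store) :
    Runs p s p.size (p.eval s) := by
  induction p generalizing s with
  | skip => exact fun K => ⟨1, le_rfl, rfl⟩
  | instr i => exact fun K => ⟨1, le_rfl, rfl⟩
  | seq p q ihp ihq => exact (ihp hp.1 s).seq (ihq hp.2 _)
  | cond b p q ihp ihq =>
    cases hb : b.eval s
    · have := (Runs.cond_false (p := p) hb (ihq hp.2 s)).mono
        (show q.size + 1 ≤ p.size + q.size + 1 by omega)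
      simpa [Program.eval, Program.size, hb] using this
    · have := (Runs.cond_true (q := q) hb (ihp hp.1 s)).mono
        (show p.size + 1 ≤ p.size + q.size + 1 by omega)
      simpa [Program.eval, Program.size, hb] using this
  | loop b p => exact hp.elim

/-- From every store with `P`, the program halts within `t` steps, in a store with `Q`. -/
def Triple (P : Store → Prop) (p : Program) (t : ℕ) (Q : Store → Prop) : Prop :=
  ∀ s, P s → ∃ s', Runs p s t s' ∧ Q s'

theorem Triple.mono {P Q : Store → Prop} {p : Program} {t t' : ℕ} (h : Triple P p t Q)
    (ht : t ≤ t') : Triple P p t' Q := fun s hs => by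
  obtain ⟨s', h1, h2⟩ := h s hs
  exact ⟨s', h1.mono ht, h2⟩

theorem Triple.of_loopFree {P Q : Store → Prop} {p : Program} (hp : p.LoopFree)
    (h : ∀ s, P s → Q (p.eval s)) : Triple P p p.size Q :=
  fun s hs => ⟨_, .of_loopFree hp s, h s hs⟩

theorem Triple.skip {P : Store → Prop} : Triple P .skip 1 P :=
  .of_loopFree (p := .skip) trivial fun _ h => h

theorem Triple.seq {P Q R : Store → Prop} {p q : Program} {t₁ t₂ : ℕ} (hp : Triple P p t₁ Q)
    (hq : Triple Q q t₂ R) : Triple P (.seq p q) (t₁ + t₂ + 1) R := fun s hs => by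
  obtain ⟨s₁, h1, h2⟩ := hp s hs
  obtain ⟨s₂, h3, h4⟩ := hq s₁ h2
  exact ⟨s₂, h1.seq h3, h4⟩

theorem Triple.cond {P Q : Store → Prop} {b : Test} {p q : Program} {t₁ t₂ : ℕ}
    (hp : Triple (fun s => P s ∧ b.eval s = true) p t₁ Q)
    (hq : Triple (fun s => P s ∧ b.eval s = false) q t₂ Q) :
    Triple P (.cond b p q) (t₁ + t₂ + 1) Q := fun s hs => by
  cases hb : b.eval s
  · obtain ⟨s', h1, h2⟩ := hq s ⟨hs, hb⟩
    exact ⟨s', (Runs.cond_false hb h1).mono (by omega), h2⟩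
  · obtain ⟨s', h1, h2⟩ := hp s ⟨hs, hb⟩
    exact ⟨s', (Runs.cond_true hb h1).mono (by omega), h2⟩

/-- The rule for a loop with a loop-free body: the invariant `I m` carries a bound `m` for the
number of iterations that are left. -/
theorem Triple.loop {b : Test} {p : Program} (hp : p.LoopFree) (I : ℕ → Store → Prop) {M : ℕ}
    (hstep : ∀ m s, I m s → b.eval s = true → ∃ m' < m, I m' (p.eval s)) :
    Triple (fun s => ∃ m ≤ M, I m s) (.loop b p) ((p.size + 1) * M + 1)
      (fun s => b.eval s = false ∧ ∃ m, I m s) := by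
  have key : ∀ m s, I m s → ∃ s', Runs (.loop b p) s ((p.size + 1) * m + 1) s' ∧
      b.eval s' = false ∧ ∃ m, I m s' := by
    intro m
    induction m using Nat.strong_induction_on with
    | _ m ih =>
      intro s hs
      cases hb : b.eval s
      · exact ⟨s, fun K => ⟨1, by omega, by simp [step, hb]⟩, hb, m, hs⟩
      · obtain ⟨m', hm, hs'⟩ := hstep m s hs hb
        obtain ⟨s', h1, h2⟩ := ih m' hm _ hs'
        refine ⟨s', ?_, h2⟩
        refine (Runs.of_step_two (fun K => by simp [step, hb]) (Runs.of_loopFree hp s) h1).mono ?_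
        obtain ⟨d, rfl⟩ := Nat.exists_eq_add_of_lt hm
        nlinarith
  rintro s ⟨m, hm, hs⟩
  obtain ⟨s', h1, h2⟩ := key m s hs
  exact ⟨s', h1.mono (by gcongr), h2⟩

end RAM

/-! ### Invariants of the breadth-first search -/

section Bfs

/-- The neighbour `w` of the vertex at position `a` has been inspected from there, when the head of
the queue is at position `h` and `rest` are the neighbours that remain to be inspected from
there. -/
def Seen (nb : ℕ → List ℕ) (h : ℕ) (rest : List ℕ) (Q : ℕ → ℕ) (a w : ℕ) : Prop :=
  w ∈ nb (Q a) ∧ (a < h ∨ a = h ∧ w ∉ rest)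

/-- The invariant of the search: the queue `Q` holds the visited vertices at the positions
`1, …, t - 1`, its inverse is `pos`, and `P` is the position of the discoverer. -/
structure BfsInv (n : ℕ) (nb : ℕ → List ℕ) (h t : ℕ) (rest : List ℕ) (Q pos P : ℕ → ℕ) : Prop where
  one_le : 1 ≤ h
  le : h ≤ t
  two_le : 2 ≤ t
  Q_one : Q 1 = 0
  Q_lt : ∀ k, 1 ≤ k → k < t → Q k < n
  pos_Q : ∀ k, 1 ≤ k → k < t → pos (Q k) = k
  Q_pos : ∀ v, pos v ≠ 0 → pos v < t ∧ Q (pos v) = v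
  first : P 1 = 0
  parent : ∀ k, 2 ≤ k → k < t → 1 ≤ P k ∧ P k < k ∧ P k ≤ h ∧ Seen nb h rest Q (P k) (Q k)
  mono : ∀ j k, 1 ≤ j → j ≤ k → k < t → P j ≤ P k
  visited : ∀ a w, 1 ≤ a → a < t → Seen nb h rest Q a w →
    pos w ≠ 0 ∧ (a < pos w → P (pos w) ≤ a)
  rest_sub : h < t → ∀ w ∈ rest, w ∈ nb (Q h)
  nodup : rest.Nodup

/-- The invariant for the second parents, as long as nothing has been rejected.  The cell `mark u`
holds the last position that was entered as a second parent next to the first parent `u`. -/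
structure PairInv (nb : ℕ → List ℕ) (h t : ℕ) (rest : List ℕ) (Q P₁ P₂ mark : ℕ → ℕ) : Prop where
  lt : ∀ k, P₂ k ≠ 0 → k < t
  second : ∀ k, P₂ k ≠ 0 → P₁ k < P₂ k ∧ P₂ k < k ∧ P₂ k ≤ h
  seen_iff : ∀ a k, 1 ≤ a → a < k → k < t → (Seen nb h rest Q a (Q k) ↔ P₁ k = a ∨ P₂ k = a)
  unique : ∀ j k, 1 ≤ j → j < k → k < t → P₂ k ≠ 0 → P₁ j = P₁ k → P₂ j = P₂ k → False
  mark_le : ∀ u, mark u ≤ h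
  mark_iff : ∀ u, mark u = h ↔ ∃ k, 1 ≤ k ∧ k < t ∧ P₁ k = u ∧ P₂ k = h

/-- A reason for rejection: a vertex with three earlier neighbours, or two vertices with two common
earlier neighbours. -/
def Conflict (nb : ℕ → List ℕ) (t : ℕ) (Q : ℕ → ℕ) : Prop :=
  (∃ a b c k, 1 ≤ a ∧ a < b ∧ b < c ∧ c < k ∧ k < t ∧
    Q k ∈ nb (Q a) ∧ Q k ∈ nb (Q b) ∧ Q k ∈ nb (Q c)) ∨
  (∃ a b j k, 1 ≤ a ∧ a < b ∧ b < j ∧ j < k ∧ k < t ∧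
    Q j ∈ nb (Q a) ∧ Q j ∈ nb (Q b) ∧ Q k ∈ nb (Q a) ∧ Q k ∈ nb (Q b))

variable {n : ℕ} {nb : ℕ → List ℕ} {h t w : ℕ} {rest : List ℕ} {Q pos P₁ P₂ mark : ℕ → ℕ}

theorem Seen.tail {a v : ℕ} (hs : Seen nb h (w :: rest) Q a v) : Seen nb h rest Q a v := by
  obtain ⟨h1, h2⟩ := hs
  refine ⟨h1, ?_⟩
  simp only [List.mem_cons, not_or] at h2
  tauto

theorem Seen.of_tail {a v : ℕ} (hs : Seen nb h rest Q a v) :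
    Seen nb h (w :: rest) Q a v ∨ (a = h ∧ v = w) := by
  obtain ⟨h1, h2⟩ := hs
  by_cases hvw : v = w
  · rcases h2 with h2 | h2
    · exact .inl ⟨h1, .inl h2⟩
    · exact .inr ⟨h2.1, hvw⟩
  · refine .inl ⟨h1, ?_⟩
    simp only [List.mem_cons, not_or]
    tauto

theorem not_seen_head :
    ¬ Seen nb h (w :: rest) Q h w := by
  rintro ⟨-, h2⟩
  simp at h2

theorem BfsInv.seen_head (B : BfsInv n nb h t (w :: rest) Q pos P₁) (ht : h < t) :
    Seen nb h rest Q h w :=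
  ⟨B.rest_sub ht w (by simp), .inr ⟨rfl, (List.nodup_cons.1 B.nodup).1⟩⟩

theorem BfsInv.skip (B : BfsInv n nb h t (w :: rest) Q pos P₁) (hw : pos w ≠ 0) :
    BfsInv n nb h t rest Q pos P₁ where
  __ := B
  parent k h2 hk := by
    obtain ⟨a, b, c, d⟩ := B.parent k h2 hk
    exact ⟨a, b, c, d.tail⟩
  visited a v ha hat hs := by
    rcases hs.of_tail (w := w) with hs | ⟨rfl, rfl⟩
    · exact B.visited a v ha hat hs
    · refine ⟨hw, fun hlt => ?_⟩
      have := B.Q_pos v hw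
      exact (B.parent _ (by omega) this.1).2.2.1
  rest_sub ht v hv := B.rest_sub ht v (List.mem_cons_of_mem _ hv)
  nodup := (List.nodup_cons.1 B.nodup).2

theorem BfsInv.visit (hlt : ∀ v, ∀ w ∈ nb v, w < n) (B : BfsInv n nb h t (w :: rest) Q pos P₁)
    (ht : h < t) (hw : pos w = 0) :
    BfsInv n nb h (t + 1) rest (Function.update Q t w) (Function.update pos w t)
      (Function.update P₁ t h) := by
  have hQ : ∀ k, k < t → Function.update Q t w k = Q k := fun k hk =>
    Function.update_of_ne hk.ne _ _
  have hP : ∀ k, k < t → Function.update P₁ t h k = P₁ k := fun k hk =>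
    Function.update_of_ne hk.ne _ _
  have hpos : ∀ v, v ≠ w → Function.update pos w t v = pos v := fun v hv =>
    Function.update_of_ne hv _ _
  have hQw : ∀ k, 1 ≤ k → k < t → Q k ≠ w := fun k h1 hk he => by
    have := B.pos_Q k h1 hk
    rw [he] at this
    omega
  have hle := B.one_le
  have h2 := B.two_le
  have hseen : ∀ a v, a < t → (Seen nb h rest (Function.update Q t w) a v ↔ Seen nb h rest Q a v) :=
    fun a v ha => by rw [Seen, Seen, hQ a ha]
  have hhead := B.seen_head ht
  refine ⟨hle, by omega, by omega, by rw [hQ 1 (by omega), B.Q_one], ?_, ?_, ?_,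
    by rw [hP 1 (by omega), B.first], ?_, ?_, ?_, ?_, (List.nodup_cons.1 B.nodup).2⟩
  · intro k h1 hk
    rcases (Nat.lt_succ_iff.1 hk).eq_or_lt with rfl | hk
    · rw [Function.update_self]
      exact hlt _ _ hhead.1
    · rw [hQ k hk]
      exact B.Q_lt k h1 hk
  · intro k h1 hk
    rcases (Nat.lt_succ_iff.1 hk).eq_or_lt with rfl | hk
    · rw [Function.update_self, Function.update_self]
    · rw [hQ k hk, hpos _ (hQw k h1 hk), B.pos_Q k h1 hk]
  · intro v hv
    by_cases hvw : v = w
    · subst hvw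
      rw [Function.update_self, Function.update_self]
      exact ⟨by omega, rfl⟩
    · rw [hpos v hvw] at hv ⊢
      obtain ⟨a, b⟩ := B.Q_pos v hv
      exact ⟨by omega, by rw [hQ _ a, b]⟩
  · intro k h1 hk
    rcases (Nat.lt_succ_iff.1 hk).eq_or_lt with rfl | hk
    · rw [Function.update_self, Function.update_self, hseen _ _ ht]
      exact ⟨hle, ht, le_rfl, hhead⟩
    · obtain ⟨a, b, c, d⟩ := B.parent k h1 hk
      rw [hP k hk, hQ k hk, hseen _ _ (by omega)]
      exact ⟨a, b, c, d.tail⟩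
  · intro j k h1 hjk hk
    rcases (Nat.lt_succ_iff.1 hk).eq_or_lt with rfl | hk
    · rw [Function.update_self]
      rcases hjk.eq_or_lt with rfl | hjk
      · rw [Function.update_self]
      · rw [hP j hjk]
        rcases h1.eq_or_lt with rfl | h1
        · rw [B.first]; omega
        · exact (B.parent j h1 hjk).2.2.1
    · rw [hP k hk, hP j (by omega)]
      exact B.mono j k h1 hjk hk
  · intro a v ha hat hs
    rcases (Nat.lt_succ_iff.1 hat).eq_or_lt with rfl | hat
    · exfalso
      obtain ⟨-, hs⟩ := hs
      omega
    · rw [hseen _ _ hat] at hs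
      by_cases hvw : v = w
      · subst hvw
        rw [Function.update_self, Function.update_self]
        rcases hs.of_tail (w := v) with hs | ⟨rfl, -⟩
        · exact absurd hw (B.visited a v ha hat hs).1
        · exact ⟨by omega, fun _ => le_rfl⟩
      · rw [hpos v hvw]
        rcases hs.of_tail (w := w) with hs | ⟨-, h'⟩
        · obtain ⟨a1, a2⟩ := B.visited a v ha hat hs
          refine ⟨a1, fun hlt => ?_⟩
          rw [hP _ (B.Q_pos v a1).1]
          exact a2 hlt
        · exact absurd h' hvw
  · intro _ v hv
    rw [hQ h ht]
    exact B.rest_sub ht v (List.mem_cons_of_mem _ hv)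

theorem Seen.advance_iff {rest' : List ℕ} {a v : ℕ} (hr : ∀ v ∈ nb (Q (h + 1)), v ∈ rest') :
    Seen nb (h + 1) rest' Q a v ↔ Seen nb h [] Q a v := by
  rw [Seen, Seen]
  constructor
  · rintro ⟨h1, h2 | ⟨rfl, h2⟩⟩
    · exact ⟨h1, by simp; omega⟩
    · exact absurd (hr v h1) h2
  · rintro ⟨h1, h2⟩
    refine ⟨h1, .inl ?_⟩
    simp at h2
    omega

theorem BfsInv.advance (B : BfsInv n nb h t [] Q pos P₁) (hnd : ∀ v, (nb v).Nodup) (ht : h < t) :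
    BfsInv n nb (h + 1) t (nb (Q (h + 1))) Q pos P₁ where
  __ := B
  one_le := by omega
  le := ht
  parent k h2 hk := by
    obtain ⟨a, b, c, d⟩ := B.parent k h2 hk
    exact ⟨a, b, by omega, (Seen.advance_iff (fun _ h => h)).2 d⟩
  visited a v ha hat hs := B.visited a v ha hat ((Seen.advance_iff (fun _ h => h)).1 hs)
  rest_sub _ _ hw := hw
  nodup := hnd _

theorem PairInv.skip (B : BfsInv n nb h t (w :: rest) Q pos P₁)
    (D : PairInv nb h t (w :: rest) Q P₁ P₂ mark) (hw : pos w ≤ h) :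
    PairInv nb h t rest Q P₁ P₂ mark where
  __ := D
  seen_iff a k ha hak hk := by
    rw [← D.seen_iff a k ha hak hk]
    refine ⟨fun hs => ?_, Seen.tail⟩
    rcases hs.of_tail (w := w) with hs | ⟨rfl, rfl⟩
    · exact hs
    · have := B.pos_Q k (by omega) hk
      omega

theorem PairInv.visit (B : BfsInv n nb h t (w :: rest) Q pos P₁)
    (D : PairInv nb h t (w :: rest) Q P₁ P₂ mark) (ht : h < t) (hw : pos w = 0) :
    PairInv nb h (t + 1) rest (Function.update Q t w) (Function.update P₁ t h) P₂ mark := by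
  have hQ : ∀ k, k < t → Function.update Q t w k = Q k := fun k hk =>
    Function.update_of_ne hk.ne _ _
  have hP : ∀ k, k < t → Function.update P₁ t h k = P₁ k := fun k hk =>
    Function.update_of_ne hk.ne _ _
  have hQw : ∀ k, 1 ≤ k → k < t → Q k ≠ w := fun k h1 hk he => by
    have := B.pos_Q k h1 hk
    rw [he] at this
    omega
  have hseen : ∀ a v, a < t → (Seen nb h rest (Function.update Q t w) a v ↔ Seen nb h rest Q a v) :=
    fun a v ha => by rw [Seen, Seen, hQ a ha]
  have hhead := B.seen_head ht
  have ht2 : P₂ t = 0 := by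
    by_contra h'
    exact absurd (D.lt t h') (by omega)
  have hle := B.one_le
  refine ⟨fun k hk => (D.lt k hk).trans (by omega), ?_, ?_, ?_, D.mark_le, ?_⟩
  · intro k hk
    rw [hP k (D.lt k hk)]
    exact D.second k hk
  · intro a k ha hak hk
    rw [hseen _ _ (by omega)]
    rcases (Nat.lt_succ_iff.1 hk).eq_or_lt with rfl | hk
    · rw [Function.update_self, Function.update_self, ht2]
      constructor
      · intro hs
        rcases hs.of_tail (w := w) with hs | ⟨rfl, -⟩
        · exact absurd hw (B.visited a w ha hak hs).1
        · exact .inl rfl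
      · rintro (rfl | h')
        · exact hhead
        · omega
    · rw [hP k hk, hQ k hk, ← D.seen_iff a k ha hak hk]
      refine ⟨fun hs => ?_, Seen.tail⟩
      rcases hs.of_tail (w := w) with hs | ⟨-, h'⟩
      · exact hs
      · exact absurd h' (hQw k (by omega) hk)
  · intro j k h1 hjk hk h2 e1 e2
    have hkt := D.lt k h2
    rw [hP k hkt, hP j (by omega)] at e1
    exact D.unique j k h1 hjk hkt h2 e1 e2
  · intro u
    rw [D.mark_iff]
    constructor
    · rintro ⟨k, h1, hk, e1, e2⟩
      exact ⟨k, h1, by omega, by rw [hP k hk, e1], e2⟩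
    · rintro ⟨k, h1, -, e1, e2⟩
      have hk := D.lt k (by omega)
      rw [hP k hk] at e1
      exact ⟨k, h1, hk, e1, e2⟩

theorem PairInv.second_parent (B : BfsInv n nb h t (w :: rest) Q pos P₁)
    (D : PairInv nb h t (w :: rest) Q P₁ P₂ mark) (ht : h < t) (hw : h < pos w)
    (h2 : P₂ (pos w) = 0) (hm : mark (P₁ (pos w)) ≠ h) :
    PairInv nb h t rest Q P₁ (Function.update P₂ (pos w) h)
      (Function.update mark (P₁ (pos w)) h) := by
  obtain ⟨hwt, hQw⟩ := B.Q_pos w (by omega)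
  have hhead := B.seen_head ht
  have hle := B.one_le
  obtain ⟨p1, p2, p3, p4⟩ := B.parent (pos w) (by omega) hwt
  have hP1 : P₁ (pos w) < h := by
    refine lt_of_le_of_ne p3 fun h' => ?_
    rw [h', hQw] at p4
    exact not_seen_head p4
  have hmark : ∀ j, P₁ j = P₁ (pos w) → 1 ≤ j → j < t → P₂ j ≠ h := by
    intro j e h1 hj h'
    exact hm ((D.mark_iff _).2 ⟨j, h1, hj, e, h'⟩)
  have hne : ∀ k, k ≠ pos w → Function.update P₂ (pos w) h k = P₂ k := fun k hk =>
    Function.update_of_ne hk _ _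
  refine ⟨?_, ?_, ?_, ?_, ?_, ?_⟩
  · intro k hk
    by_cases hkw : k = pos w
    · omega
    · rw [hne k hkw] at hk
      exact D.lt k hk
  · intro k hk
    by_cases hkw : k = pos w
    · subst hkw
      rw [Function.update_self]
      exact ⟨hP1, hw, le_rfl⟩
    · rw [hne k hkw] at hk ⊢
      exact D.second k hk
  · intro a k ha hak hk
    by_cases hkw : k = pos w
    · subst hkw
      rw [Function.update_self, hQw]
      have := D.seen_iff a _ ha hak hk
      rw [h2, hQw] at this
      constructor
      · intro hs
        rcases hs.of_tail (w := w) with hs | ⟨rfl, -⟩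
        · have := this.1 hs
          omega
        · exact .inr rfl
      · rintro (h' | rfl)
        · exact (this.2 (.inl h')).tail
        · exact hhead
    · rw [hne k hkw, ← D.seen_iff a k ha hak hk]
      refine ⟨fun hs => ?_, Seen.tail⟩
      rcases hs.of_tail (w := w) with hs | ⟨-, h'⟩
      · exact hs
      · exact absurd (h' ▸ B.pos_Q k (by omega) hk).symm hkw
  · intro j k h1 hjk hk h0 e1 e2
    by_cases hkw : k = pos w
    · rw [hkw, Function.update_self, hne j (by omega)] at e2
      rw [hkw] at e1
      exact hmark j e1 h1 (by omega) e2
    · rw [hne k hkw] at h0 e2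
      by_cases hjw : j = pos w
      · rw [hjw, Function.update_self] at e2
        rw [hjw] at e1
        exact hmark k e1.symm (by omega) hk e2.symm
      · rw [hne j hjw] at e2
        exact D.unique j k h1 hjk hk h0 e1 e2
  · intro u
    rw [Function.update_apply]
    split_ifs
    · exact le_rfl
    · exact D.mark_le u
  · intro u
    rw [Function.update_apply]
    split_ifs with hu
    · simp only [true_iff]
      exact ⟨pos w, by omega, hwt, hu.symm, Function.update_self ..⟩
    · rw [D.mark_iff]
      constructor
      · rintro ⟨k, h1, hk, e1, e2⟩
        exact ⟨k, h1, hk, e1, by rw [hne k (by rintro rfl; exact hu e1.symm), e2]⟩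
      · rintro ⟨k, h1, hk, e1, e2⟩
        rw [hne k (by rintro rfl; exact hu e1.symm)] at e2
        exact ⟨k, h1, hk, e1, e2⟩

theorem PairInv.advance {rest' : List ℕ} (D : PairInv nb h t [] Q P₁ P₂ mark)
    (hr : ∀ v ∈ nb (Q (h + 1)), v ∈ rest') : PairInv nb (h + 1) t rest' Q P₁ P₂ mark where
  __ := D
  second k hk := by
    obtain ⟨a, b, c⟩ := D.second k hk
    exact ⟨a, b, by omega⟩
  seen_iff a k ha hak hk := by rw [Seen.advance_iff hr, D.seen_iff a k ha hak hk]
  mark_le u := (D.mark_le u).trans (by omega)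
  mark_iff u := by
    constructor
    · intro h'
      have := D.mark_le u
      omega
    · rintro ⟨k, -, -, -, h'⟩
      have := (D.second k (by omega)).2.2
      omega

theorem Conflict.visit (h' : Conflict nb t Q) :
    Conflict nb (t + 1) (Function.update Q t w) := by
  have hQ : ∀ k, k < t → Function.update Q t w k = Q k := fun k hk =>
    Function.update_of_ne hk.ne _ _
  rcases h' with ⟨a, b, c, k, h1, h2, h3, h4, h5, h6⟩ | ⟨a, b, j, k, h1, h2, h3, h4, h5, h6⟩
  · refine .inl ⟨a, b, c, k, h1, h2, h3, h4, by omega, ?_⟩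
    rwa [hQ k h5, hQ a (by omega), hQ b (by omega), hQ c (by omega)]
  · refine .inr ⟨a, b, j, k, h1, h2, h3, h4, by omega, ?_⟩
    rwa [hQ k h5, hQ a (by omega), hQ b (by omega), hQ j (by omega)]

theorem PairInv.conflict_of_three (B : BfsInv n nb h t (w :: rest) Q pos P₁)
    (D : PairInv nb h t (w :: rest) Q P₁ P₂ mark) (ht : h < t) (hw : h < pos w)
    (h2 : P₂ (pos w) ≠ 0) : Conflict nb t Q := by
  obtain ⟨hwt, hQw⟩ := B.Q_pos w (by omega)
  have hle := B.one_le
  obtain ⟨p1, p2, p3, p4⟩ := B.parent (pos w) (by omega) hwt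
  obtain ⟨q1, q2, q3⟩ := D.second _ h2
  have hs := (D.seen_iff (P₂ (pos w)) (pos w) (by omega) q2 hwt).2 (.inr rfl)
  have hlt : P₂ (pos w) < h := by
    refine lt_of_le_of_ne q3 fun h' => ?_
    rw [h', hQw] at hs
    exact not_seen_head hs
  refine .inl ⟨_, _, h, pos w, p1, q1, hlt, hw, hwt, p4.1, hs.1, ?_⟩
  rw [hQw]
  exact (B.seen_head ht).1

theorem PairInv.conflict_of_mark (B : BfsInv n nb h t (w :: rest) Q pos P₁)
    (D : PairInv nb h t (w :: rest) Q P₁ P₂ mark) (ht : h < t) (hw : h < pos w)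
    (h2 : P₂ (pos w) = 0) (hm : mark (P₁ (pos w)) = h) : Conflict nb t Q := by
  obtain ⟨hwt, hQw⟩ := B.Q_pos w (by omega)
  have hle := B.one_le
  obtain ⟨p1, p2, p3, p4⟩ := B.parent (pos w) (by omega) hwt
  obtain ⟨k, h1, hk, e1, e2⟩ := (D.mark_iff _).1 hm
  obtain ⟨q1, q2, q3⟩ := D.second k (by omega)
  have s1 := ((D.seen_iff (P₁ k) k (by omega) (by omega) hk).2 (.inl rfl)).1
  have s2 := ((D.seen_iff (P₂ k) k (by omega) (by omega) hk).2 (.inr rfl)).1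
  have s3 := (B.seen_head ht).1
  rw [← hQw] at s3
  have s4 := p4.1
  rw [← e1] at s4
  rw [e2] at s2 q1 q2
  have hne : k ≠ pos w := by rintro rfl; omega
  rcases hne.lt_or_gt with hlt | hlt
  · exact .inr ⟨P₁ k, h, k, pos w, by omega, q1, q2, hlt, hwt, s1, s2, s4, s3⟩
  · exact .inr ⟨P₁ k, h, pos w, k, by omega, q1, hw, hlt, hk, s4, s3, s1, s2⟩

end Bfs

/-! ### Adjacency lists -/

namespace AdjacencyLists

variable {V : Type u} {G : SimpleGraph V} (A : AdjacencyLists G)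

/-- The list of the numbers of the neighbours of vertex number `v`. -/
def nb (v : ℕ) : List ℕ := if h : v < A.n then (A.nbrs ⟨v, h⟩).map Fin.val else []

/-- The vertex with number `v` (and vertex number `0` if there is no such vertex). -/
def label (hn : 0 < A.n) (v : ℕ) : V := if h : v < A.n then A.vertex ⟨v, h⟩ else A.vertex ⟨0, hn⟩

variable {A}

theorem label_inj (hn : 0 < A.n) {v w : ℕ} (hv : v < A.n) (hw : w < A.n)
    (h : A.label hn v = A.label hn w) : v = w := by
  rw [label, label, dif_pos hv, dif_pos hw] at h
  simpa using A.vertex.injective h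

theorem exists_label (hn : 0 < A.n) (x : V) : ∃ v < A.n, A.label hn v = x := by
  refine ⟨A.vertex.symm x, (A.vertex.symm x).2, ?_⟩
  rw [label, dif_pos (A.vertex.symm x).2]
  simp

theorem nb_lt {v w : ℕ} (h : w ∈ A.nb v) : w < A.n := by
  rw [nb] at h
  split_ifs at h
  · obtain ⟨i, -, rfl⟩ := List.mem_map.1 h
    exact i.2
  · simp at h

theorem mem_nb (hn : 0 < A.n) {v w : ℕ} (hv : v < A.n) (hw : w < A.n) :
    w ∈ A.nb v ↔ G.Adj (A.label hn v) (A.label hn w) := by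
  rw [nb, label, label, dif_pos hv, dif_pos hv, dif_pos hw, ← A.mem_nbrs, List.mem_map]
  constructor
  · rintro ⟨i, hi, rfl⟩
    exact hi
  · exact fun h => ⟨_, h, rfl⟩

theorem nodup_nb (v : ℕ) : (A.nb v).Nodup := by
  rw [nb]
  split_ifs
  · exact (A.nodup _).map Fin.val_injective
  · exact List.nodup_nil

theorem offset_succ {v : ℕ} (hv : v < A.n) : A.offset (v + 1) = A.offset v + (A.nb v).length := by
  rw [offset, offset, nb, dif_pos hv, List.take_succ_eq_append_getElem (by simpa using hv)]
  simp

theorem entries_getD {v : ℕ} (hv : v < A.n) {j : ℕ} (hj : j < (A.nb v).length) :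
    A.entries.getD (A.offset v + j) 0 = (A.nb v).getD j 0 := by
  have h := List.drop_take_succ_flatten_eq_getElem (List.ofFn A.nbrs) v (by simpa using hv)
  have e : A.nb v = (A.entries.take (A.offset (v + 1))).drop (A.offset v) := by
    rw [nb, dif_pos hv, entries, ← List.map_take, ← List.map_drop, offset, offset, List.map_take,
      List.map_take, h]
    simp
  have h1 : A.offset v + j < A.offset (v + 1) := by
    rw [offset_succ hv]
    omega
  rw [e, List.getD_eq_getElem?_getD, List.getD_eq_getElem?_getD, List.getElem?_drop,
    List.getElem?_take_of_lt h1]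

theorem sum_length_nb [Finite V] :
    ∑ v ∈ Finset.range A.n, (A.nb v).length = 2 * Nat.card G.edgeSet := by
  classical
  have := Fintype.ofFinite V
  rw [Nat.card_eq_fintype_card, ← SimpleGraph.edgeFinset_card,
    ← G.sum_degrees_eq_twice_card_edges, ← A.vertex.sum_comp, Finset.sum_range]
  refine Finset.sum_congr rfl fun i _ => ?_
  rw [nb, dif_pos i.2, List.length_map, ← List.toFinset_card_of_nodup (A.nodup i),
    ← SimpleGraph.card_neighborFinset_eq_degree, ← Finset.card_map A.vertex.toEmbedding]
  congr 1
  ext x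
  simp only [Finset.mem_map_equiv, List.mem_toFinset, A.mem_nbrs, SimpleGraph.mem_neighborFinset]
  simp

theorem card_eq : Nat.card V = A.n := by
  rw [← Nat.card_congr A.vertex, Nat.card_eq_fintype_card, Fintype.card_fin]

end AdjacencyLists

/-! ### The result of the breadth-first search -/

section BfsResult

variable {V : Type u} {G : SimpleGraph V} {A : AdjacencyLists G} {t : ℕ} {rest : List ℕ}
  {Q pos P₁ P₂ mark : ℕ → ℕ}

theorem bfsInv_init (hn : 0 < A.n) : BfsInv A.n A.nb 1 2 (A.nb 0) (fun _ => 0)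
    (Function.update (fun _ => 0) 0 1) (fun _ => 0) where
  one_le := le_rfl
  le := by omega
  two_le := le_rfl
  Q_one := rfl
  Q_lt _ _ _ := hn
  pos_Q k h1 h2 := by simp; omega
  Q_pos v hv := by
    rw [Function.update_apply] at hv ⊢
    split_ifs at hv ⊢ with h
    · exact ⟨by omega, h.symm⟩
    · exact absurd rfl hv
  first := rfl
  parent k h1 h2 := by omega
  mono _ _ _ _ _ := le_rfl
  visited a w ha hat hs := by
    obtain ⟨h1, h2 | ⟨-, h2⟩⟩ := hs
    · omega
    · exact absurd h1 h2
  rest_sub _ w hw := hw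
  nodup := A.nodup_nb 0

theorem pairInv_init : PairInv A.nb 1 2 (A.nb 0) (fun _ => 0) (fun _ => 0) (fun _ => 0)
    (fun _ => 0) where
  lt k h := absurd rfl h
  second k h := absurd rfl h
  seen_iff a k h1 h2 h3 := by omega
  unique j k h1 h2 h3 := by omega
  mark_le _ := by omega
  mark_iff _ := by simp

theorem BfsInv.injOn {n : ℕ} {nb : ℕ → List ℕ} {h : ℕ} (B : BfsInv n nb h t rest Q pos P₁) :
    Set.InjOn Q (Finset.Ico 1 t) := by
  intro a ha b hb hab
  simp only [Finset.coe_Ico, Set.mem_Ico] at ha hb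
  rw [← B.pos_Q a ha.1 ha.2, ← B.pos_Q b hb.1 hb.2, hab]

/-- If all vertices have been found, the search yields a search order. -/
theorem BfsInv.isSearchOrder (hn : 0 < A.n) (B : BfsInv A.n A.nb t t rest Q pos P₁)
    (ht : t = A.n + 1) : IsSearchOrder G A.n (fun k => A.label hn (Q k)) P₁ where
  one_le := hn
  inj a b ha ha' hb hb' h := by
    have := A.label_inj hn (B.Q_lt a ha (by omega)) (B.Q_lt b hb (by omega)) h
    rw [← B.pos_Q a ha (by omega), ← B.pos_Q b hb (by omega), this]
  surj x := by
    have himg : (Finset.Ico 1 t).image Q = Finset.range A.n := by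
      apply Finset.eq_of_subset_of_card_le
      · intro v hv
        obtain ⟨k, hk, rfl⟩ := Finset.mem_image.1 hv
        rw [Finset.mem_Ico] at hk
        exact Finset.mem_range.2 (B.Q_lt k hk.1 hk.2)
      · rw [Finset.card_image_of_injOn B.injOn]
        simp [ht]
    obtain ⟨v, hv, rfl⟩ := A.exists_label hn x
    rw [← Finset.mem_range, ← himg] at hv
    obtain ⟨k, hk, rfl⟩ := Finset.mem_image.1 hv
    rw [Finset.mem_Ico] at hk
    exact ⟨k, hk.1, by omega, rfl⟩
  first := B.first
  pos k h2 hk := by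
    have := B.parent k h2 (by omega)
    exact ⟨this.1, this.2.1⟩
  mono j k hj hjk hk := B.mono j k hj hjk (by omega)
  adj k h2 hk := by
    obtain ⟨a, b, -, d⟩ := B.parent k h2 (by omega)
    exact (A.mem_nb hn (B.Q_lt _ a (by omega)) (B.Q_lt _ (by omega) (by omega))).1 d.1
  min a k ha hak hk h := by
    have hm := (A.mem_nb hn (B.Q_lt _ ha (by omega)) (B.Q_lt k (by omega) (by omega))).2 h
    have := (B.visited a _ ha (by omega) ⟨hm, .inl (by omega)⟩).2
    rw [B.pos_Q k (by omega) (by omega)] at this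
    exact this hak

theorem PairInv.hasParentPairs (hn : 0 < A.n) (B : BfsInv A.n A.nb t t rest Q pos P₁)
    (D : PairInv A.nb t t rest Q P₁ P₂ mark) (ht : t = A.n + 1) :
    HasParentPairs G A.n (fun k => A.label hn (Q k)) P₁ P₂ where
  second k _ _ h2 := by
    obtain ⟨a, b, -⟩ := D.second k h2
    exact ⟨a, b⟩
  adj_iff a k ha hak hk := by
    rw [← D.seen_iff a k ha hak (by omega),
      ← A.mem_nb hn (B.Q_lt _ ha (by omega)) (B.Q_lt k (by omega) (by omega))]
    exact ⟨fun h => ⟨h, .inl (by omega)⟩, fun h => h.1⟩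
  unique j k hj hjk hk := D.unique j k hj hjk (by omega)

theorem BfsInv.not_isPartialDoubleTree_of_conflict (hn : 0 < A.n)
    (B : BfsInv A.n A.nb t t rest Q pos P₁) (h : Conflict A.nb t Q) (ht : t = A.n + 1) :
    ¬ IsPartialDoubleTree G := by
  intro hG
  have hS := B.isSearchOrder hn ht
  have adj : ∀ a k, 1 ≤ a → a < t → 1 ≤ k → k < t → Q k ∈ A.nb (Q a) →
      G.Adj (A.label hn (Q a)) (A.label hn (Q k)) := fun a k ha hat hk hkt h =>
    (A.mem_nb hn (B.Q_lt a ha hat) (B.Q_lt k hk hkt)).1 h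
  rcases h with ⟨a, b, c, k, h1, h2, h3, h4, h5, h6, h7, h8⟩ |
    ⟨a, b, j, k, h1, h2, h3, h4, h5, h6, h7, h8, h9⟩
  · exact hG.not_three_earlier hS h1 h2 h3 h4 (by omega)
      (adj a k h1 (by omega) (by omega) h5 h6)
      (adj b k (by omega) (by omega) (by omega) h5 h7)
      (adj c k (by omega) (by omega) (by omega) h5 h8)
  · exact hG.not_common_earlier hS h1 h2 h3 h4 (by omega)
      (adj a j h1 (by omega) (by omega) (by omega) h6)
      (adj b j (by omega) (by omega) (by omega) (by omega) h7)
      (adj a k h1 (by omega) (by omega) (by omega) h8)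
      (adj b k (by omega) (by omega) (by omega) (by omega) h9)

theorem BfsInv.eq_of_connected (hn : 0 < A.n) (B : BfsInv A.n A.nb t t rest Q pos P₁)
    (hG : G.Connected) : t = A.n + 1 := by
  have h2 := B.two_le
  have closed : ∀ x y, G.Walk x y → (∃ a, 1 ≤ a ∧ a < t ∧ A.label hn (Q a) = x) →
      ∃ a, 1 ≤ a ∧ a < t ∧ A.label hn (Q a) = y := by
    intro x y w
    induction w with
    | nil => exact id
    | @cons x z y hxz _ ih =>
      rintro ⟨a, ha, hat, rfl⟩
      obtain ⟨v, hv, rfl⟩ := A.exists_label hn z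
      have hm := (A.mem_nb hn (B.Q_lt a ha hat) hv).2 hxz
      have hp := (B.visited a v ha hat ⟨hm, .inl hat⟩).1
      obtain ⟨h3, h4⟩ := B.Q_pos v hp
      exact ih ⟨pos v, by omega, h3, by rw [h4]⟩
  have himg : (Finset.Ico 1 t).image Q = Finset.range A.n := by
    ext v
    rw [Finset.mem_image, Finset.mem_range]
    constructor
    · rintro ⟨k, hk, rfl⟩
      rw [Finset.mem_Ico] at hk
      exact B.Q_lt k hk.1 hk.2
    · intro hv
      obtain ⟨w⟩ := hG.preconnected (A.label hn (Q 1)) (A.label hn v)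
      obtain ⟨a, ha, hat, h⟩ := closed _ _ w ⟨1, le_rfl, by omega, rfl⟩
      exact ⟨a, Finset.mem_Ico.2 ⟨ha, hat⟩, A.label_inj hn (B.Q_lt a ha hat) hv h⟩
  have := congrArg Finset.card himg
  rw [Finset.card_image_of_injOn B.injOn] at this
  simp at this
  omega

end BfsResult

/-! ### The breadth-first search as a program -/

/-- A bound for the number of iterations that remain: one for every neighbour that is still to be
inspected, and one for every position that is still to be advanced to. -/
def bfsMeasure (n : ℕ) (nb : ℕ → List ℕ) (h t : ℕ) (rest : List ℕ) (pos : ℕ → ℕ) : ℕ :=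
  (if h < t then rest.length + 1 else 0) +
    ∑ v ∈ (Finset.range n).filter (fun v => pos v = 0 ∨ h < pos v), ((nb v).length + 1)

section Measure

variable {n : ℕ} {nb : ℕ → List ℕ} {h t w : ℕ} {rest : List ℕ} {Q pos P : ℕ → ℕ}

theorem bfsMeasure_skip (ht : h < t) :
    bfsMeasure n nb h t rest pos < bfsMeasure n nb h t (w :: rest) pos := by
  rw [bfsMeasure, bfsMeasure, if_pos ht, if_pos ht, List.length_cons]
  omega

theorem bfsMeasure_visit (ht : h < t) (hw : pos w = 0) :
    bfsMeasure n nb h (t + 1) rest (Function.update pos w t) <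
      bfsMeasure n nb h t (w :: rest) pos := by
  rw [bfsMeasure, bfsMeasure, if_pos ht, if_pos (by omega), List.length_cons]
  have : (Finset.range n).filter (fun v => Function.update pos w t v = 0 ∨
      h < Function.update pos w t v) =
      (Finset.range n).filter (fun v => pos v = 0 ∨ h < pos v) := by
    refine Finset.filter_congr fun v _ => ?_
    by_cases hv : v = w
    · subst hv
      simp [hw, ht]
    · rw [Function.update_of_ne hv]
  rw [this]
  omega

theorem bfsMeasure_advance (B : BfsInv n nb h t [] Q pos P) (ht : h < t) :
    bfsMeasure n nb (h + 1) t (nb (Q (h + 1))) pos < bfsMeasure n nb h t [] pos := by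
  have hle := B.one_le
  rw [bfsMeasure, bfsMeasure, if_pos ht]
  by_cases ht' : h + 1 < t
  · have hpos := B.pos_Q (h + 1) (by omega) ht'
    have hmem : Q (h + 1) ∈ (Finset.range n).filter (fun v => pos v = 0 ∨ h < pos v) := by
      rw [Finset.mem_filter, Finset.mem_range, hpos]
      exact ⟨B.Q_lt _ (by omega) ht', .inr (by omega)⟩
    have herase : (Finset.range n).filter (fun v => pos v = 0 ∨ h + 1 < pos v) ⊆
        ((Finset.range n).filter (fun v => pos v = 0 ∨ h < pos v)).erase (Q (h + 1)) := by
      intro v hv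
      rw [Finset.mem_filter] at hv
      rw [Finset.mem_erase, Finset.mem_filter]
      refine ⟨?_, hv.1, by omega⟩
      rintro rfl
      omega
    rw [if_pos ht', ← Finset.add_sum_erase _ _ hmem, List.length_nil]
    have := Finset.sum_le_sum_of_subset (f := fun v => (nb v).length + 1) herase
    omega
  · rw [if_neg ht']
    have hsub : (Finset.range n).filter (fun v => pos v = 0 ∨ h + 1 < pos v) ⊆
        (Finset.range n).filter (fun v => pos v = 0 ∨ h < pos v) := by
      intro v hv
      rw [Finset.mem_filter] at hv ⊢
      exact ⟨hv.1, by omega⟩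
    have := Finset.sum_le_sum_of_subset (f := fun v => (nb v).length + 1) hsub
    omega

end Measure

namespace RAM

/-- The sequential composition of a list of programs. -/
def block : List Program → Program
  | [] => .skip
  | p :: L => .seq p (block L)

/-- Setting up the search: position `1` of the queue (array `2`) holds vertex `0`, its inverse is
array `3`, and registers `1`–`5` are the head of the queue, its end, the range of positions
in the adjacency lists that is to be inspected, and the flag that nothing has been rejected.
Register `11` is always `0`, and register `12` is the number of vertices plus `1`. -/
def bfsInit : Program := block
  [.instr (.const 1 1), .instr (.store 3 11 1), .instr (.const 2 2), .instr (.const 5 1),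
   .instr (.copy 12 0), .instr (.inc 12), .instr (.load 4 0 1)]

/-- One step of the search: inspect the next neighbour of the head of the queue, or advance the
head.  Arrays `4` and `5` are the first and second parents, by position, and array `6` holds the
marks that detect repeated pairs of parents. -/
def bfsBody : Program :=
  .cond (.lt 3 4)
    (block [.instr (.load 7 1 3), .instr (.inc 3), .instr (.load 8 3 7),
      .cond (.eq 8 11)
        (block [.instr (.store 2 2 7), .instr (.store 3 7 2), .instr (.store 4 2 1),
          .instr (.inc 2)])
        (.cond (.lt 1 8)
          (block [.instr (.load 6 5 8),
            .cond (.eq 6 11)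
              (block [.instr (.load 9 4 8), .instr (.load 10 6 9),
                .cond (.eq 10 1)
                  (.instr (.const 5 0))
                  (block [.instr (.store 6 9 1), .instr (.store 5 8 1)])])
              (.instr (.const 5 0))])
          .skip)])
    (block [.instr (.inc 1), .instr (.load 6 2 1), .instr (.load 3 0 6), .instr (.inc 6),
      .instr (.load 4 0 6)])

variable {V : Type u} {G : SimpleGraph V} (A : AdjacencyLists G)

/-- What the search leaves alone: the input, the constants, and the arrays `9` and `12`, which are
needed later and are still empty. -/
def BfsFrame (s : Store) : Prop :=
  s.reg 0 = A.n ∧ s.reg 11 = 0 ∧ s.reg 12 = A.n + 1 ∧ (∀ v ≤ A.n, s.arr 0 v = A.offset v) ∧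
    (∀ i, s.arr 1 i = A.entries.getD i 0) ∧ (∀ i, s.arr 9 i = 0) ∧ ∀ i, s.arr 12 i = 0

/-- The invariant of the search in terms of the store. -/
structure BfsState (rest : List ℕ) (s : Store) : Prop where
  frame : BfsFrame A s
  bfs : BfsInv A.n A.nb (s.reg 1) (s.reg 2) rest (s.arr 2) (s.arr 3) (s.arr 4)
  range : s.reg 1 < s.reg 2 → s.reg 4 = s.reg 3 + rest.length ∧
    ∀ j < rest.length, s.arr 1 (s.reg 3 + j) = rest.getD j 0
  ok : (s.reg 5 = 1 ∧ PairInv A.nb (s.reg 1) (s.reg 2) rest (s.arr 2) (s.arr 4) (s.arr 5)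
    (s.arr 6)) ∨ (s.reg 5 = 0 ∧ Conflict A.nb (s.reg 2) (s.arr 2))

variable {A}

theorem range_tail {a : ℕ → ℕ} {i e w : ℕ} {rest : List ℕ}
    (h : e = i + (w :: rest).length ∧ ∀ j < (w :: rest).length, a (i + j) = (w :: rest).getD j 0) :
    e = i + 1 + rest.length ∧ ∀ j < rest.length, a (i + 1 + j) = rest.getD j 0 := by
  obtain ⟨h1, h2⟩ := h
  rw [List.length_cons] at h1
  refine ⟨by omega, fun j hj => ?_⟩
  have := h2 (j + 1) (by rw [List.length_cons]; omega)
  rw [List.getD_cons_succ] at this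
  rw [← this]
  congr 1
  omega

attribute [local simp] bfsBody bfsInit block Program.eval Instr.exec Test.eval Function.update_apply

theorem bfsBody_step {rest : List ℕ} {s : Store} (hs : BfsState A rest s)
    (ht : s.reg 1 < s.reg 2) : ∃ rest', BfsState A rest' (bfsBody.eval s) ∧
      bfsMeasure A.n A.nb ((bfsBody.eval s).reg 1) ((bfsBody.eval s).reg 2) rest'
        ((bfsBody.eval s).arr 3) <
      bfsMeasure A.n A.nb (s.reg 1) (s.reg 2) rest (s.arr 3) := by
  obtain ⟨reg, arr⟩ := s
  obtain ⟨F, B, hrange, hok⟩ := hs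
  obtain ⟨-, h11, -, hoff, hadj, -, -⟩ := id F
  simp only at *
  cases rest with
  | nil =>
    have h34 : ¬ reg 3 < reg 4 := by
      have := (hrange ht).1
      simp at this
      omega
    refine ⟨A.nb (arr 2 (reg 1 + 1)), ⟨?_, ?_, ?_, ?_⟩, ?_⟩
    · simpa [BfsFrame, h34] using F
    · simpa [h34] using B.advance A.nodup_nb ht
    · intro ht'
      have ht' : reg 1 + 1 < reg 2 := by simpa [h34] using ht'
      have hQ := B.Q_lt (reg 1 + 1) (by omega) ht'
      have e1 := hoff _ hQ.le
      have e2 := hoff (arr 2 (reg 1 + 1) + 1) hQ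
      have e3 := A.offset_succ hQ
      have e4 := fun j hj => A.entries_getD hQ (j := j) hj
      simpa [h34, e1, e2, e3, hadj] using e4
    · rcases hok with ⟨h5, D⟩ | ⟨h5, D⟩
      · exact .inl ⟨by simpa [h34] using h5, by simpa [h34] using D.advance fun _ h => h⟩
      · exact .inr ⟨by simpa [h34] using h5, by simpa [h34] using D⟩
    · simpa [h34] using bfsMeasure_advance B ht
  | cons w rest =>
    have h34 : reg 3 < reg 4 := by
      have := (hrange ht).1
      simp at this
      omega
    have hw : arr 1 (reg 3) = w := by simpa using (hrange ht).2 0 (by simp)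
    have hrange' := range_tail (hrange ht)
    refine ⟨rest, ?_⟩
    by_cases hp : arr 3 w = 0
    · refine ⟨⟨?_, ?_, ?_, ?_⟩, ?_⟩
      · simpa [BfsFrame, h34, hw, hp, h11] using F
      · simpa [h34, hw, hp, h11] using B.visit (fun _ _ h => A.nb_lt h) ht hp
      · intro _
        simpa [h34, hw, hp, h11] using hrange'
      · rcases hok with ⟨h5, D⟩ | ⟨h5, D⟩
        · exact .inl ⟨by simpa [h34, hw, hp, h11] using h5,
            by simpa [h34, hw, hp, h11] using D.visit B ht hp⟩
        · exact .inr ⟨by simpa [h34, hw, hp, h11] using h5,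
            by simpa [h34, hw, hp, h11] using D.visit⟩
      · simpa [h34, hw, hp, h11] using bfsMeasure_visit ht hp
    by_cases hlt : reg 1 < arr 3 w
    swap
    · refine ⟨⟨?_, ?_, ?_, ?_⟩, ?_⟩
      · simpa [BfsFrame, h34, hw, hp, h11, hlt] using F
      · simpa [h34, hw, hp, h11, hlt] using B.skip hp
      · intro _
        simpa [h34, hw, hp, h11, hlt] using hrange'
      · rcases hok with ⟨h5, D⟩ | ⟨h5, D⟩
        · exact .inl ⟨by simpa [h34, hw, hp, h11, hlt] using h5,
            by simpa [h34, hw, hp, h11, hlt] using D.skip B (by omega)⟩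
        · exact .inr ⟨by simpa [h34, hw, hp, h11, hlt] using h5,
            by simpa [h34, hw, hp, h11, hlt] using D⟩
      · simpa [h34, hw, hp, h11, hlt] using bfsMeasure_skip (pos := arr 3) ht
    by_cases h2 : arr 5 (arr 3 w) = 0
    swap
    · refine ⟨⟨?_, ?_, ?_, ?_⟩, ?_⟩
      · simpa [BfsFrame, h34, hw, hp, h11, hlt, h2] using F
      · simpa [h34, hw, hp, h11, hlt, h2] using B.skip hp
      · intro _
        simpa [h34, hw, hp, h11, hlt, h2] using hrange'
      · refine .inr ⟨by simp [h34, hw, hp, h11, hlt, h2], ?_⟩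
        have : Conflict A.nb (reg 2) (arr 2) := by
          rcases hok with ⟨-, D⟩ | ⟨-, D⟩
          · exact D.conflict_of_three B ht hlt h2
          · exact D
        simpa [h34, hw, hp, h11, hlt, h2] using this
      · simpa [h34, hw, hp, h11, hlt, h2] using bfsMeasure_skip (pos := arr 3) ht
    by_cases hm : arr 6 (arr 4 (arr 3 w)) = reg 1
    · refine ⟨⟨?_, ?_, ?_, ?_⟩, ?_⟩
      · simpa [BfsFrame, h34, hw, hp, h11, hlt, h2, hm] using F
      · simpa [h34, hw, hp, h11, hlt, h2, hm] using B.skip hp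
      · intro _
        simpa [h34, hw, hp, h11, hlt, h2, hm] using hrange'
      · refine .inr ⟨by simp [h34, hw, hp, h11, hlt, h2, hm], ?_⟩
        have : Conflict A.nb (reg 2) (arr 2) := by
          rcases hok with ⟨-, D⟩ | ⟨-, D⟩
          · exact D.conflict_of_mark B ht hlt h2 hm
          · exact D
        simpa [h34, hw, hp, h11, hlt, h2, hm] using this
      · simpa [h34, hw, hp, h11, hlt, h2, hm] using bfsMeasure_skip (pos := arr 3) ht
    · refine ⟨⟨?_, ?_, ?_, ?_⟩, ?_⟩
      · simpa [BfsFrame, h34, hw, hp, h11, hlt, h2, hm] using F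
      · simpa [h34, hw, hp, h11, hlt, h2, hm] using B.skip hp
      · intro _
        simpa [h34, hw, hp, h11, hlt, h2, hm] using hrange'
      · rcases hok with ⟨h5, D⟩ | ⟨h5, D⟩
        · exact .inl ⟨by simpa [h34, hw, hp, h11, hlt, h2, hm] using h5,
            by simpa [h34, hw, hp, h11, hlt, h2, hm] using D.second_parent B ht hlt h2 hm⟩
        · exact .inr ⟨by simpa [h34, hw, hp, h11, hlt, h2, hm] using h5,
            by simpa [h34, hw, hp, h11, hlt, h2, hm] using D⟩
      · simpa [h34, hw, hp, h11, hlt, h2, hm] using bfsMeasure_skip (pos := arr 3) ht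

/-- Reject if not all vertices have been found. -/
def bfsCheck : Program := .cond (.eq 2 12) .skip (.instr (.const 5 0))

/-- After the search: either it is known that `G` is not a partial double tree, or arrays `4` and
`5` describe a search order of all vertices with its parent pairs. -/
def Searched (A : AdjacencyLists G) (s : Store) : Prop :=
  s.reg 11 = 0 ∧ ((s.reg 5 = 0 ∧ ¬ IsPartialDoubleTree G) ∨
    (s.reg 5 = 1 ∧ s.reg 12 = A.n + 1 ∧ (∀ i, s.arr 9 i = 0) ∧ (∀ i, s.arr 12 i = 0) ∧
      ∃ q : ℕ → V, IsSearchOrder G A.n q (s.arr 4) ∧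
        HasParentPairs G A.n q (s.arr 4) (s.arr 5)))

theorem bfsMeasure_init [Finite V] (hn : 0 < A.n) :
    bfsMeasure A.n A.nb 1 2 (A.nb 0) (Function.update (fun _ => 0) 0 1) ≤
      2 * Nat.card G.edgeSet + A.n := by
  have hsub : ∑ v ∈ (Finset.range A.n).filter (fun v =>
      Function.update (fun _ : ℕ => 0) 0 1 v = 0 ∨ 1 < Function.update (fun _ : ℕ => 0) 0 1 v),
      ((A.nb v).length + 1) ≤ ∑ v ∈ (Finset.range A.n).erase 0, ((A.nb v).length + 1) := by
    refine Finset.sum_le_sum_of_subset fun v hv => ?_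
    rw [Finset.mem_filter, Function.update_apply] at hv
    rw [Finset.mem_erase]
    refine ⟨fun h => ?_, hv.1⟩
    simp [h] at hv
  have hsum := Finset.add_sum_erase (Finset.range A.n) (fun v => (A.nb v).length + 1)
    (Finset.mem_range.2 hn)
  have htot : ∑ v ∈ Finset.range A.n, ((A.nb v).length + 1) = 2 * Nat.card G.edgeSet + A.n := by
    rw [Finset.sum_add_distrib, A.sum_length_nb, Finset.sum_const, Finset.card_range,
      smul_eq_mul, mul_one]
  rw [bfsMeasure, if_pos (by omega)]
  omega

theorem bfs_triple [Finite V] (hn : 0 < A.n) :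
    Triple (fun s => s = A.initialStore)
      (block [bfsInit, .loop (.lt 1 2) bfsBody, bfsCheck])
      (bfsInit.size + ((bfsBody.size + 1) * (2 * Nat.card G.edgeSet + A.n) + 1) +
        bfsCheck.size + 10) (Searched A) := by
  have h1 : Triple (fun s => s = A.initialStore) bfsInit bfsInit.size
      (fun s => ∃ m ≤ 2 * Nat.card G.edgeSet + A.n, ∃ rest, BfsState A rest s ∧
        m = bfsMeasure A.n A.nb (s.reg 1) (s.reg 2) rest (s.arr 3)) := by
    refine .of_loopFree (by simp [Program.LoopFree]) ?_
    rintro s rfl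
    refine ⟨_, ?_, A.nb 0, ⟨?_, ?_, ?_, ?_⟩, rfl⟩
    · simpa [AdjacencyLists.initialStore] using bfsMeasure_init hn
    · simp [BfsFrame, AdjacencyLists.initialStore]
      omega
    · simpa [AdjacencyLists.initialStore] using bfsInv_init hn
    · intro _
      have e1 := A.offset_succ hn
      have e2 := fun j hj => A.entries_getD hn (j := j) hj
      have e3 : A.offset 0 = 0 := by simp [AdjacencyLists.offset]
      rw [e3] at e1
      simp only [e3] at e2
      have e4 : 1 ≤ A.n := hn
      simp only [zero_add, List.getD_eq_getElem?_getD] at e1 e2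
      simpa [AdjacencyLists.initialStore, e1, e4] using e2
    · exact .inl ⟨by simp, by simpa [AdjacencyLists.initialStore] using pairInv_init⟩
  have h2 := Triple.loop (b := .lt 1 2) (p := bfsBody) (by simp [Program.LoopFree])
    (fun m s => ∃ rest, BfsState A rest s ∧
      m = bfsMeasure A.n A.nb (s.reg 1) (s.reg 2) rest (s.arr 3))
    (M := 2 * Nat.card G.edgeSet + A.n) (by
      rintro m s ⟨rest, hs, rfl⟩ ht
      obtain ⟨rest', hs', hm⟩ := bfsBody_step hs (by simpa using ht)
      exact ⟨_, hm, rest', hs', rfl⟩)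
  have h3 : Triple (fun s => (Test.lt 1 2).eval s = false ∧ ∃ m, ∃ rest, BfsState A rest s ∧
      m = bfsMeasure A.n A.nb (s.reg 1) (s.reg 2) rest (s.arr 3)) bfsCheck bfsCheck.size
      (Searched A) := by
    refine .of_loopFree (by simp [bfsCheck, Program.LoopFree]) ?_
    rintro ⟨reg, arr⟩ ⟨ht, -, rest, ⟨F, B, -, hok⟩, -⟩
    obtain ⟨-, h11, h12, -, -, h9, hcol⟩ := id F
    simp only [Test.eval, decide_eq_false_iff_not] at *
    have h12' : reg 1 = reg 2 := by
      have := B.le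
      omega
    rw [h12'] at B hok
    by_cases heq : reg 2 = A.n + 1
    · refine ⟨by simpa [bfsCheck, heq, h12] using h11, ?_⟩
      rcases hok with ⟨h5, D⟩ | ⟨h5, D⟩
      · refine .inr ⟨by simpa [bfsCheck, heq, h12] using h5,
          by simp [bfsCheck, heq, h12], by simpa [bfsCheck, heq, h12] using h9,
          by simpa [bfsCheck, heq, h12] using hcol, _,
          by simpa [bfsCheck, heq, h12] using B.isSearchOrder hn heq,
          by simpa [bfsCheck, heq, h12] using D.hasParentPairs hn B heq⟩
      · exact .inl ⟨by simpa [bfsCheck, heq, h12] using h5,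
          B.not_isPartialDoubleTree_of_conflict hn D heq⟩
    · exact ⟨by simpa [bfsCheck, heq, h12] using h11, .inl ⟨by simp [bfsCheck, heq, h12],
        fun hG => heq (B.eq_of_connected hn hG.1)⟩⟩
  exact (h1.seq (h2.seq (h3.seq .skip))).mono (by omega)

end RAM

/-! ### Labelling the classes -/

section Classes

variable {V : Type u} {G : SimpleGraph V} {n m : ℕ} {q : ℕ → V} {P₁ P₂ c₁ c₂ c₁' c₂' : ℕ → ℕ}

theorem IsDownEdge.congr {k p c : ℕ} (h : IsDownEdge P₁ P₂ c₁ c₂ k p c) (h₁ : c₁' k = c₁ k)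
    (h₂ : c₂' k = c₂ k) : IsDownEdge P₁ P₂ c₁' c₂' k p c := by
  rwa [IsDownEdge, h₁, h₂]

/-- The labels can be assigned one position after the other. -/
theorem IsClassLabel.extend (hS : IsSearchOrder G n q P₁) (hP : HasParentPairs G n q P₁ P₂)
    (hL : IsClassLabel m P₁ P₂ c₁ c₂) (hm : m < n) {a b : ℕ}
    (h₁ : P₂ (m + 1) = 0 → a = m + 1)
    (h₂ : P₂ (m + 1) ≠ 0 → ∃ x, IsDownEdge P₁ P₂ c₁ c₂ (P₂ (m + 1)) x a ∧
      IsDownEdge P₁ P₂ c₁ c₂ (P₁ (m + 1)) x b) :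
    IsClassLabel (m + 1) P₁ P₂ (Function.update c₁ (m + 1) a) (Function.update c₂ (m + 1) b) := by
  intro k h1 hk
  have hlt := hS.lt h1 (by omega)
  have hsec := hP.second k h1 (by omega)
  have old : ∀ j, j < k → ∀ x c, IsDownEdge P₁ P₂ c₁ c₂ j x c →
      IsDownEdge P₁ P₂ (Function.update c₁ (m + 1) a) (Function.update c₂ (m + 1) b) j x c :=
    fun j hj x c h => h.congr (Function.update_of_ne (by omega) _ _)
      (Function.update_of_ne (by omega) _ _)
  rcases hk.eq_or_lt with rfl | hk
  · simp only [Function.update_self]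
    refine ⟨h₁, fun h => ?_⟩
    obtain ⟨x, hx, hx'⟩ := h₂ h
    exact ⟨x, old _ (hsec h).2 _ _ hx, old _ hlt _ _ hx'⟩
  · rw [Function.update_of_ne (by omega), Function.update_of_ne (by omega)]
    refine ⟨(hL k h1 (by omega)).1, fun h => ?_⟩
    obtain ⟨x, hx, hx'⟩ := (hL k h1 (by omega)).2 h
    exact ⟨x, old _ (hsec h).2 _ _ hx, old _ hlt _ _ hx'⟩

theorem IsClassLabel.range (hS : IsSearchOrder G n q P₁) (hP : HasParentPairs G n q P₁ P₂)
    (hL : IsClassLabel n P₁ P₂ c₁ c₂) {k p c : ℕ} (h1 : 1 ≤ k) (hn : k ≤ n)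
    (h : IsDownEdge P₁ P₂ c₁ c₂ k p c) : 1 ≤ c ∧ c ≤ n := by
  induction k using Nat.strong_induction_on generalizing p c with
  | _ k ih =>
    by_cases h2 : P₂ k = 0
    · rcases h with ⟨-, rfl⟩ | ⟨h, -⟩
      · rw [(hL k h1 hn).1 h2]
        exact ⟨h1, hn⟩
      · exact absurd h2 h
    · obtain ⟨x, hw, hu⟩ := (hL k h1 hn).2 h2
      obtain ⟨h12, h2k⟩ := hP.second k h1 hn h2
      rcases h with ⟨-, rfl⟩ | ⟨-, -, rfl⟩
      · exact ih _ h2k (by omega) (by omega) hw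
      · exact ih _ (by omega) (hS.pos k (by omega) hn).1 (by omega) hu

end Classes

namespace RAM

/-- Give the edges down from position `13` the classes that arrays `a` and `b` hold for the
parents in registers `15` and `14`. -/
def copyClasses (a b : ℕ) : Program := block
  [.instr (.load 20 a 15), .instr (.store 7 13 20), .instr (.load 20 b 14),
    .instr (.store 8 13 20)]

/-- Label the edges down from position `13`; the labels are stored in arrays `7` and `8`.  If there
are two parents, one has to find a common parent of them, and reject if there is none. -/
def classBody : Program := block
  [.instr (.load 15 5 13),
    .cond (.eq 15 11)
      (.instr (.store 7 13 13))
      (block [.instr (.load 14 4 13), .instr (.load 16 4 14), .instr (.load 17 5 14),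
        .instr (.load 18 4 15), .instr (.load 19 5 15),
        .cond (.eq 16 18) (copyClasses 7 7)
          (.cond (.eq 17 18) (copyClasses 7 8)
            (.cond (.eq 19 11) (.instr (.const 5 0))
              (.cond (.eq 16 19) (copyClasses 8 7)
                (.cond (.eq 17 19) (copyClasses 8 8) (.instr (.const 5 0))))))]),
    .instr (.inc 13)]

variable {V : Type u} {G : SimpleGraph V} {n : ℕ} {q : ℕ → V} {P₁ P₂ : ℕ → ℕ}

/-- What the labelling leaves alone. -/
def ClassFrame (n : ℕ) (P₁ P₂ : ℕ → ℕ) (s : Store) : Prop :=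
  s.reg 11 = 0 ∧ s.reg 12 = n + 1 ∧ s.arr 4 = P₁ ∧ s.arr 5 = P₂ ∧ (∀ i, s.arr 9 i = 0) ∧
    ∀ i, s.arr 12 i = 0

/-- The invariant of the labelling: positions up to `m` are done. -/
structure ClassState (G : SimpleGraph V) (n : ℕ) (P₁ P₂ : ℕ → ℕ) (m : ℕ) (s : Store) : Prop where
  frame : ClassFrame n P₁ P₂ s
  next : s.reg 13 = m + 1
  le : m ≤ n
  ok : (s.reg 5 = 1 ∧ IsClassLabel m P₁ P₂ (s.arr 7) (s.arr 8)) ∨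
    (s.reg 5 = 0 ∧ ¬ IsPartialDoubleTree G)

attribute [local simp] classBody copyClasses block Program.eval Instr.exec Test.eval
  Function.update_apply

theorem classBody_step (hS : IsSearchOrder G n q P₁) (hP : HasParentPairs G n q P₁ P₂) {m : ℕ}
    {s : Store} (hs : ClassState G n P₁ P₂ m s) (hm : m < n) :
    ClassState G n P₁ P₂ (m + 1) (classBody.eval s) := by
  obtain ⟨reg, arr⟩ := s
  obtain ⟨F, h13, -, hok⟩ := hs
  obtain ⟨h11, -, h4, h5, -, -⟩ := id F
  simp only at *
  have hlt := hS.lt (k := m + 1) (by omega) hm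
  have hsec := hP.second (m + 1) (by omega) hm
  by_cases h2 : P₂ (m + 1) = 0
  · refine ⟨by simpa [ClassFrame, h11, h13, h5, h2] using F, by simp [h11, h13, h5, h2], hm, ?_⟩
    rcases hok with ⟨hok, hL⟩ | hok
    · refine .inl ⟨by simpa [h11, h13, h5, h2] using hok, ?_⟩
      have := hL.extend hS hP hm (a := m + 1) (b := arr 8 (m + 1)) (fun _ => rfl)
        fun h => absurd h2 h
      rw [Function.update_eq_self] at this
      simpa [h11, h13, h5, h2] using this
    · exact .inr ⟨by simpa [h11, h13, h5, h2] using hok.1, hok.2⟩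
  obtain ⟨h12, h2m⟩ := hsec h2
  have hu1 := (hS.pos (m + 1) (by omega) hm).1
  have hw1 := (hS.pos (P₂ (m + 1)) (by omega) (by omega)).1
  have found : ∀ x a b, IsClassLabel m P₁ P₂ (arr 7) (arr 8) →
      IsDownEdge P₁ P₂ (arr 7) (arr 8) (P₂ (m + 1)) x a →
      IsDownEdge P₁ P₂ (arr 7) (arr 8) (P₁ (m + 1)) x b →
      IsClassLabel (m + 1) P₁ P₂ (Function.update (arr 7) (m + 1) a)
        (Function.update (arr 8) (m + 1) b) := fun x a b hL ha hb =>
    hL.extend hS hP hm (fun h => absurd h h2) fun _ => ⟨x, ha, hb⟩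
  by_cases e1 : P₁ (P₁ (m + 1)) = P₁ (P₂ (m + 1))
  · have : P₁ (m + 1) ≠ m + 1 := by omega
    refine ⟨by simpa [ClassFrame, h11, h13, h4, h5, h2, e1] using F,
      by simp [h11, h13, h4, h5, h2, e1], hm, ?_⟩
    rcases hok with ⟨hok, hL⟩ | hok
    · refine .inl ⟨by simpa [h11, h13, h4, h5, h2, e1] using hok, ?_⟩
      simpa [h11, h13, h4, h5, h2, e1, hlt.ne] using
        found _ _ _ hL (.inl ⟨rfl, rfl⟩) (.inl ⟨e1.symm, rfl⟩)
    · exact .inr ⟨by simpa [h11, h13, h4, h5, h2, e1] using hok.1, hok.2⟩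
  by_cases e2 : P₂ (P₁ (m + 1)) = P₁ (P₂ (m + 1))
  · refine ⟨by simpa [ClassFrame, h11, h13, h4, h5, h2, e1, e2] using F,
      by simp [h11, h13, h4, h5, h2, e1, e2], hm, ?_⟩
    rcases hok with ⟨hok, hL⟩ | hok
    · refine .inl ⟨by simpa [h11, h13, h4, h5, h2, e1, e2] using hok, ?_⟩
      simpa [h11, h13, h4, h5, h2, e1, e2, hlt.ne] using
        found _ _ _ hL (.inl ⟨rfl, rfl⟩) (.inr ⟨by omega, e2.symm, rfl⟩)
    · exact .inr ⟨by simpa [h11, h13, h4, h5, h2, e1, e2] using hok.1, hok.2⟩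
  have reject : (¬ ∃ x, IsParent P₁ P₂ (P₁ (m + 1)) x ∧ IsParent P₁ P₂ (P₂ (m + 1)) x) →
      ¬ IsPartialDoubleTree G := by
    intro h hG
    obtain ⟨_, _, _, _, _, _, E⟩ := hG.exists_embedding
    exact h (hP.exists_square hS E (by omega) hm h2)
  by_cases e3 : P₂ (P₂ (m + 1)) = 0
  · refine ⟨by simpa [ClassFrame, h11, h13, h4, h5, h2, e1, e2, e3] using F,
      by simp [h11, h13, h4, h5, h2, e1, e2, e3], hm, .inr
      ⟨by simp [h11, h13, h4, h5, h2, e1, e2, e3], reject ?_⟩⟩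
    rintro ⟨x, rfl | ⟨-, rfl⟩, h | ⟨h, -⟩⟩
    exacts [e1 h, h e3, e2 h, h e3]
  by_cases e4 : P₁ (P₁ (m + 1)) = P₂ (P₂ (m + 1))
  · have e1' : P₂ (P₂ (m + 1)) ≠ P₁ (P₂ (m + 1)) := e4 ▸ e1
    refine ⟨by simpa [ClassFrame, h11, h13, h4, h5, h2, e1', e2, e3, e4] using F,
      by simp [h11, h13, h4, h5, h2, e1', e2, e3, e4], hm, ?_⟩
    rcases hok with ⟨hok, hL⟩ | hok
    · refine .inl ⟨by simpa [h11, h13, h4, h5, h2, e1', e2, e3, e4] using hok, ?_⟩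
      simpa [h11, h13, h4, h5, h2, e1', e2, e3, e4, hlt.ne] using
        found _ _ _ hL (.inr ⟨e3, rfl, rfl⟩) (.inl ⟨e4.symm, rfl⟩)
    · exact .inr ⟨by simpa [h11, h13, h4, h5, h2, e1', e2, e3, e4] using hok.1, hok.2⟩
  by_cases e5 : P₂ (P₁ (m + 1)) = P₂ (P₂ (m + 1))
  · have e2' : P₂ (P₂ (m + 1)) ≠ P₁ (P₂ (m + 1)) := e5 ▸ e2
    refine ⟨by simpa [ClassFrame, h11, h13, h4, h5, h2, e1, e2', e3, e4, e5] using F,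
      by simp [h11, h13, h4, h5, h2, e1, e2', e3, e4, e5], hm, ?_⟩
    rcases hok with ⟨hok, hL⟩ | hok
    · refine .inl ⟨by simpa [h11, h13, h4, h5, h2, e1, e2', e3, e4, e5] using hok, ?_⟩
      simpa [h11, h13, h4, h5, h2, e1, e2', e3, e4, e5, hlt.ne] using
        found _ _ _ hL (.inr ⟨e3, rfl, rfl⟩) (.inr ⟨by rwa [e5], e5.symm, rfl⟩)
    · exact .inr ⟨by simpa [h11, h13, h4, h5, h2, e1, e2', e3, e4, e5] using hok.1, hok.2⟩
  · refine ⟨by simpa [ClassFrame, h11, h13, h4, h5, h2, e1, e2, e3, e4, e5] using F,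
      by simp [h11, h13, h4, h5, h2, e1, e2, e3, e4, e5], hm, .inr
      ⟨by simp [h11, h13, h4, h5, h2, e1, e2, e3, e4, e5], reject ?_⟩⟩
    rintro ⟨x, rfl | ⟨-, rfl⟩, h | ⟨-, h⟩⟩
    exacts [e1 h, e4 h, e2 h, e5 h]

/-- After the labelling: either it is known that `G` is not a partial double tree, or arrays `7` and
`8` hold class labels. -/
def Labelled (A : AdjacencyLists G) (s : Store) : Prop :=
  s.reg 11 = 0 ∧ ((s.reg 5 = 0 ∧ ¬ IsPartialDoubleTree G) ∨
    (s.reg 5 = 1 ∧ s.reg 12 = A.n + 1 ∧ (∀ i, s.arr 9 i = 0) ∧ (∀ i, s.arr 12 i = 0) ∧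
      ∃ q : ℕ → V, IsSearchOrder G A.n q (s.arr 4) ∧
        HasParentPairs G A.n q (s.arr 4) (s.arr 5) ∧
        IsClassLabel A.n (s.arr 4) (s.arr 5) (s.arr 7) (s.arr 8)))

/-- Go through the positions with register `13`, starting with position `1`. -/
def forPositions (p : Program) : Program :=
  block [.instr (.const 13 1), .loop (.lt 13 12) p]

/-- The rule for a loop over all positions; `I m` is the invariant after `m` positions. -/
theorem Triple.forPositions {p : Program} (hp : p.LoopFree) (I : ℕ → Store → Prop)
    (hI : ∀ m s, I m s → s.reg 13 = m + 1 ∧ s.reg 12 = n + 1 ∧ m ≤ n)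
    (hstep : ∀ m s, I m s → m < n → I (m + 1) (p.eval s)) :
    Triple (fun s => I 0 ((Program.instr (.const 13 1)).eval s)) (forPositions p)
      ((p.size + 1) * n + 6) (I n) := by
  have h1 : Triple (fun s => I 0 ((Program.instr (.const 13 1)).eval s)) (.instr (.const 13 1)) 1
      (fun s => ∃ m ≤ n, ∃ k, k + m = n ∧ I k s) :=
    .of_loopFree (p := .instr (.const 13 1)) trivial fun s hs => ⟨n, le_rfl, 0, by omega, hs⟩
  have h2 := Triple.loop (b := .lt 13 12) hp (fun m s => ∃ k, k + m = n ∧ I k s) (M := n) (by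
    rintro m s ⟨k, hk, hs⟩ ht
    have := hI k s hs
    simp only [Test.eval, decide_eq_true_eq] at ht
    exact ⟨m - 1, by omega, k + 1, by omega, hstep k s hs (by omega)⟩)
  have h3 : Triple (fun s => (Test.lt 13 12).eval s = false ∧ ∃ m k, k + m = n ∧ I k s)
      (block []) 1 (I n) := by
    refine .of_loopFree (p := .skip) trivial ?_
    rintro s ⟨ht, m, k, hk, hs⟩
    have := hI k s hs
    simp only [Test.eval, decide_eq_false_iff_not] at ht
    obtain rfl : k = n := by omega
    exact hs
  exact (h1.seq (h2.seq h3)).mono (by omega)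

theorem class_triple {A : AdjacencyLists G} :
    Triple (fun s => Searched A s ∧ s.reg 5 = 1) (forPositions classBody)
      ((classBody.size + 1) * A.n + 6) (Labelled A) := by
  rintro s ⟨⟨h11, h⟩, h5⟩
  rcases h with h | ⟨-, h12, h9, hcol, q, hS, hP⟩
  · omega
  obtain ⟨s', hr, hs'⟩ := Triple.forPositions (p := classBody) (n := A.n)
    (by simp [Program.LoopFree]) (ClassState G A.n (s.arr 4) (s.arr 5))
    (fun m s hs => ⟨hs.next, hs.frame.2.1, hs.le⟩) (fun m s hs hm => classBody_step hS hP hs hm) s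
    ⟨by simpa [ClassFrame] using ⟨h11, h12, h9, hcol⟩, by simp, by omega,
      .inl ⟨by simpa using h5, fun k hk hk' => by omega⟩⟩
  refine ⟨s', hr, ?_⟩
  obtain ⟨⟨h11, h12, h4, h5, h9, hcol⟩, -, -, hok⟩ := hs'
  refine ⟨h11, hok.symm.imp id fun hok => ⟨hok.1, h12, h9, hcol, q, ?_⟩⟩
  rw [h4, h5]
  exact ⟨hS, hP, hok.2⟩

end RAM

/-! ### Adjacency lists of the crossing graph -/

/-- From the entry `e` on, the linked list with links `nxt` and contents `val` is `l`; it uses only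
entries below `b`. -/
inductive IsLinkedList (nxt val : ℕ → ℕ) (b : ℕ) : ℕ → List ℕ → Prop
  | nil : IsLinkedList nxt val b 0 []
  | cons {e : ℕ} {l : List ℕ} (h0 : e ≠ 0) (hb : e < b) (h : IsLinkedList nxt val b (nxt e) l) :
      IsLinkedList nxt val b e (val e :: l)

theorem IsLinkedList.update {nxt val : ℕ → ℕ} {b e x y : ℕ} {l : List ℕ}
    (h : IsLinkedList nxt val b e l) :
    IsLinkedList (Function.update nxt b x) (Function.update val b y) (b + 1) e l := by
  induction h with
  | nil => exact .nil
  | @cons e l h0 hb _ ih =>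
    rw [show val e = Function.update val b y e from (Function.update_of_ne hb.ne _ _).symm]
    refine .cons h0 (by omega) ?_
    rwa [Function.update_of_ne hb.ne]

theorem IsLinkedList.eq_nil {nxt val : ℕ → ℕ} {b : ℕ} {l : List ℕ}
    (h : IsLinkedList nxt val b 0 l) : l = [] := by
  cases h with
  | nil => rfl
  | cons h0 => exact absurd rfl h0

theorem IsLinkedList.eq_cons {nxt val : ℕ → ℕ} {b e : ℕ} {l : List ℕ}
    (h : IsLinkedList nxt val b e l) (he : e ≠ 0) :
    ∃ l', l = val e :: l' ∧ IsLinkedList nxt val b (nxt e) l' := by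
  cases h with
  | nil => exact absurd rfl he
  | cons _ _ h => exact ⟨_, rfl, h⟩

/-- The linked lists that start at the entries `hd c` are `L c`. -/
def IsLinkedLists (hd nxt val : ℕ → ℕ) (b : ℕ) (L : ℕ → List ℕ) : Prop :=
  1 ≤ b ∧ ∀ c, IsLinkedList nxt val b (hd c) (L c)

theorem IsLinkedLists.add {hd nxt val : ℕ → ℕ} {b : ℕ} {L : ℕ → List ℕ}
    (h : IsLinkedLists hd nxt val b L) (c d : ℕ) :
    IsLinkedLists (Function.update hd c b) (Function.update nxt b (hd c))
      (Function.update val b d) (b + 1) (Function.update L c (d :: L c)) := by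
  refine ⟨by omega, fun c' => ?_⟩
  by_cases hc : c' = c
  · subst hc
    rw [Function.update_self, Function.update_self]
    have := IsLinkedList.cons (nxt := Function.update nxt b (hd c'))
      (val := Function.update val b d) (b := b + 1) (e := b) (l := L c')
      (by have := h.1; omega) (by omega)
      (by rw [Function.update_self]; exact (h.2 c').update)
    rwa [Function.update_self] at this
  · rw [Function.update_of_ne hc, Function.update_of_ne hc]
    exact (h.2 c').update

/-- The classes `c` and `d` cross at one of the positions up to `m`: they are the classes of its
two downward edges. -/
def Cross (P₂ c₁ c₂ : ℕ → ℕ) (m c d : ℕ) : Prop :=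
  ∃ k, 1 ≤ k ∧ k ≤ m ∧ P₂ k ≠ 0 ∧ ((c₁ k = c ∧ c₂ k = d) ∨ (c₂ k = c ∧ c₁ k = d))

theorem cross_succ_of_eq {P₂ c₁ c₂ : ℕ → ℕ} {m c d : ℕ} (h : P₂ (m + 1) = 0) :
    Cross P₂ c₁ c₂ (m + 1) c d ↔ Cross P₂ c₁ c₂ m c d := by
  constructor
  · rintro ⟨k, h1, hk, h2, h3⟩
    rcases hk.eq_or_lt with rfl | hk
    · exact absurd h h2
    · exact ⟨k, h1, by omega, h2, h3⟩
  · rintro ⟨k, h1, hk, h2, h3⟩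
    exact ⟨k, h1, by omega, h2, h3⟩

theorem cross_succ_of_ne {P₂ c₁ c₂ : ℕ → ℕ} {m c d : ℕ} (h : P₂ (m + 1) ≠ 0) :
    Cross P₂ c₁ c₂ (m + 1) c d ↔ Cross P₂ c₁ c₂ m c d ∨
      (c₁ (m + 1) = c ∧ c₂ (m + 1) = d) ∨ (c₂ (m + 1) = c ∧ c₁ (m + 1) = d) := by
  constructor
  · rintro ⟨k, h1, hk, h2, h3⟩
    rcases hk.eq_or_lt with rfl | hk
    · exact .inr h3
    · exact .inl ⟨k, h1, by omega, h2, h3⟩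
  · rintro (⟨k, h1, hk, h2, h3⟩ | h3)
    · exact ⟨k, h1, by omega, h2, h3⟩
    · exact ⟨m + 1, by omega, le_rfl, h, h3⟩

theorem mem_update_cons {L : ℕ → List ℕ} {c d x y : ℕ} :
    y ∈ Function.update L c (d :: L c) x ↔ y ∈ L x ∨ (c = x ∧ d = y) := by
  by_cases hx : x = c
  · subst hx
    simp only [Function.update_self, List.mem_cons, true_and]
    rw [or_comm, eq_comm]
  · rw [Function.update_of_ne hx]
    simp [Ne.symm hx]

theorem sum_length_update_cons_le {L : ℕ → List ℕ} {c d n : ℕ} :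
    ∑ x ∈ Finset.range (n + 1), (Function.update L c (d :: L c) x).length ≤
      ∑ x ∈ Finset.range (n + 1), (L x).length + 1 := by
  have : ∀ x, (Function.update L c (d :: L c) x).length =
      (L x).length + if x = c then 1 else 0 := by
    intro x
    by_cases hx : x = c
    · subst hx
      simp
    · rw [Function.update_of_ne hx]
      simp [hx]
  simp only [this, Finset.sum_add_distrib, Finset.sum_ite_eq']
  split_ifs <;> omega

namespace RAM

/-- Add an entry for register `d` at the front of the list of register `c`.  The heads, links
and contents of the lists are in arrays `9`, `10` and `11`, and register `21` is the next free
entry. -/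
def addEntry (c d : ℕ) : Program := block
  [.instr (.store 11 21 d), .instr (.load 24 9 c), .instr (.store 10 21 24),
    .instr (.store 9 c 21), .instr (.inc 21)]

/-- Enter the crossing at position `13`, if there is one, into the lists of both classes. -/
def crossBody : Program := block
  [.instr (.load 15 5 13),
    .cond (.eq 15 11) .skip
      (block [.instr (.load 22 7 13), .instr (.load 23 8 13), addEntry 22 23, addEntry 23 22]),
    .instr (.inc 13)]

/-- What the construction of the lists leaves alone. -/
def CrossFrame (n : ℕ) (P₁ P₂ c₁ c₂ : ℕ → ℕ) (s : Store) : Prop :=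
  s.reg 5 = 1 ∧ s.reg 11 = 0 ∧ s.reg 12 = n + 1 ∧ s.arr 4 = P₁ ∧ s.arr 5 = P₂ ∧ s.arr 7 = c₁ ∧
    s.arr 8 = c₂ ∧ ∀ i, s.arr 12 i = 0

/-- The invariant: the lists hold the crossings at the positions up to `m`. -/
structure CrossState (n : ℕ) (P₁ P₂ c₁ c₂ : ℕ → ℕ) (m : ℕ) (s : Store) : Prop where
  frame : CrossFrame n P₁ P₂ c₁ c₂ s
  next : s.reg 13 = m + 1
  le : m ≤ n
  chains : ∃ L, IsLinkedLists (s.arr 9) (s.arr 10) (s.arr 11) (s.reg 21) L ∧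
    (∀ c d, d ∈ L c ↔ Cross P₂ c₁ c₂ m c d) ∧
    ∑ c ∈ Finset.range (n + 1), (L c).length ≤ 2 * m

attribute [local simp] crossBody addEntry block Program.eval Instr.exec Test.eval
  Function.update_apply

theorem crossBody_step {n m : ℕ} {P₁ P₂ c₁ c₂ : ℕ → ℕ} {s : Store}
    (hs : CrossState n P₁ P₂ c₁ c₂ m s) (hm : m < n) :
    CrossState n P₁ P₂ c₁ c₂ (m + 1) (crossBody.eval s) := by
  obtain ⟨reg, arr⟩ := s
  obtain ⟨F, h13, -, L, hL, hmem, hsum⟩ := hs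
  obtain ⟨-, h11, -, -, h5, h7, h8, -⟩ := id F
  simp only at *
  by_cases h2 : P₂ (m + 1) = 0
  · refine ⟨by simpa [CrossFrame, h11, h13, h5, h2] using F, by simp [h11, h13, h5, h2], hm,
      L, by simpa [h11, h13, h5, h2] using hL, fun c d => ?_, by omega⟩
    rw [hmem, cross_succ_of_eq h2]
  · obtain ⟨L', hL', hmem', hsum'⟩ : ∃ L', IsLinkedLists _ _ _ _ L' ∧
        (∀ c d, d ∈ L' c ↔ Cross P₂ c₁ c₂ (m + 1) c d) ∧
        ∑ c ∈ Finset.range (n + 1), (L' c).length ≤ 2 * (m + 1) := by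
      refine ⟨_, (hL.add (c₁ (m + 1)) (c₂ (m + 1))).add (c₂ (m + 1)) (c₁ (m + 1)),
        fun c d => ?_, ?_⟩
      · rw [cross_succ_of_ne h2, mem_update_cons, mem_update_cons, hmem, or_assoc]
      · have h1 := sum_length_update_cons_le (L := L) (c := c₁ (m + 1)) (d := c₂ (m + 1)) (n := n)
        have h2 := sum_length_update_cons_le (c := c₂ (m + 1)) (d := c₁ (m + 1)) (n := n)
          (L := Function.update L (c₁ (m + 1)) (c₂ (m + 1) :: L (c₁ (m + 1))))
        omega
    exact ⟨by simpa [CrossFrame, h11, h13, h5, h2] using F, by simp [h11, h13, h5, h2], hm,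
      L', by simpa [h11, h13, h5, h7, h8, h2] using hL', hmem', hsum'⟩

end RAM

/-! ### Colouring the crossing graph -/

section Coloring

/-- The invariant of the search that colours the graph with the adjacency lists `L` on the vertices
`1, …, n` with the colours `1` and `2`, where `0` stands for uncoloured.  The coloured vertices
are `Q 0, …, Q (t - 1)`; the neighbours of the first `h` of them have been inspected, except for
those in `cur`, which are neighbours of `Q (h - 1)` and are going to get the colour `y`.  All
vertices below `s` are coloured. -/
structure ColorInv (n : ℕ) (L : ℕ → List ℕ) (s : ℕ) (cur : List ℕ) (y h t : ℕ)
    (col Q : ℕ → ℕ) : Prop where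
  one_le : 1 ≤ s
  s_le : s ≤ n + 1
  Q_mem : ∀ j, j < t → 1 ≤ Q j ∧ Q j ≤ n ∧ col (Q j) ≠ 0
  Q_inj : ∀ i j, i < t → j < t → Q i = Q j → i = j
  mem_Q : ∀ c, col c ≠ 0 → ∃ j < t, Q j = c
  col_le : ∀ c, col c ≤ 2
  done : ∀ c, 1 ≤ c → c < s → col c ≠ 0
  le : h ≤ t
  cur_sub : cur ≠ [] → 1 ≤ h ∧ ∀ d ∈ cur, d ∈ L (Q (h - 1))
  opp : cur ≠ [] → (y = 1 ∨ y = 2) ∧ y ≠ col (Q (h - 1))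
  full : ∀ j, j < h → ∀ d ∈ L (Q j), col d ≠ 0 ∨ (j + 1 = h ∧ d ∈ cur)

/-- If `g` is a proper colouring, then the search follows it up to a swap of the two colours on
every connected component; the swap in effect is `f`. -/
structure ColorProper (L : ℕ → List ℕ) (g : ℕ → Bool) (cur : List ℕ) (h t : ℕ)
    (col Q : ℕ → ℕ) : Prop where
  active : ∃ f : Bool, ∀ j, j < t → (h ≤ j ∨ j + 1 = h ∧ cur ≠ []) → (col (Q j) = 1 ↔ g (Q j) = f)
  proper : ∀ a d, d ∈ L a → col a ≠ 0 → col d ≠ 0 → col a ≠ col d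

variable {n : ℕ} {L : ℕ → List ℕ} {g : ℕ → Bool} {s d y y' h t : ℕ} {cur : List ℕ}
  {col Q : ℕ → ℕ}

theorem ColorInv.ne_of_uncolored (B : ColorInv n L s cur y h t col Q) (hd : col d = 0) {j : ℕ}
    (hj : j < t) : Q j ≠ d := by
  rintro rfl
  exact (B.Q_mem j hj).2.2 hd

/-- Giving a colour to an uncoloured vertex and adding it to the queue. -/
theorem ColorInv.color (B : ColorInv n L s cur y h t col Q) (hd : col d = 0) (hd1 : 1 ≤ d)
    (hdn : d ≤ n) {x : ℕ} (hx : x = 1 ∨ x = 2) {cur' : List ℕ}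
    (hsub : ∀ c ∈ cur', c ∈ cur) (hcur : ∀ c ∈ cur, c = d ∨ c ∈ cur') :
    ColorInv n L s cur' y h (t + 1) (Function.update col d x) (Function.update Q t d) := by
  have hQ : ∀ j, j < t → Function.update Q t d j = Q j := fun j hj =>
    Function.update_of_ne hj.ne _ _
  have hcol : ∀ c, col c ≠ 0 → Function.update col d x c = col c := fun c hc =>
    Function.update_of_ne (by rintro rfl; exact hc hd) _ _
  have hmono : ∀ c, col c ≠ 0 → Function.update col d x c ≠ 0 := fun c hc => by rwa [hcol c hc]
  have hne : cur' ≠ [] → cur ≠ [] := fun h1 h2 => by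
    obtain ⟨c, hc⟩ := List.exists_mem_of_ne_nil _ h1
    have := hsub c hc
    simp [h2] at this
  refine ⟨B.one_le, B.s_le, ?_, ?_, ?_, ?_, fun c h1 h2 => hmono c (B.done c h1 h2),
    B.le.trans (by omega), ?_, ?_, ?_⟩
  · intro j hj
    rcases (Nat.lt_succ_iff.1 hj).eq_or_lt with rfl | hj
    · rw [Function.update_self, Function.update_self]
      exact ⟨hd1, hdn, by omega⟩
    · rw [hQ j hj]
      obtain ⟨a, b, c⟩ := B.Q_mem j hj
      exact ⟨a, b, hmono _ c⟩
  · intro i j hi hj hij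
    rcases (Nat.lt_succ_iff.1 hi).eq_or_lt with rfl | hi <;>
      rcases (Nat.lt_succ_iff.1 hj).eq_or_lt with rfl | hj
    · rfl
    · rw [Function.update_self, hQ j hj] at hij
      exact absurd hij.symm (B.ne_of_uncolored hd hj)
    · rw [Function.update_self, hQ i hi] at hij
      exact absurd hij (B.ne_of_uncolored hd hi)
    · rw [hQ i hi, hQ j hj] at hij
      exact B.Q_inj i j hi hj hij
  · intro c hc
    by_cases hcd : c = d
    · exact ⟨t, by omega, by rw [Function.update_self, hcd]⟩
    · rw [Function.update_of_ne hcd] at hc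
      obtain ⟨j, hj, hjc⟩ := B.mem_Q c hc
      exact ⟨j, by omega, by rw [hQ j hj, hjc]⟩
  · intro c
    rw [Function.update_apply]
    split_ifs
    · omega
    · exact B.col_le c
  · intro h1
    obtain ⟨a, b⟩ := B.cur_sub (hne h1)
    have := B.le
    refine ⟨a, fun c hc => ?_⟩
    rw [hQ _ (by omega)]
    exact b c (hsub c hc)
  · intro h1
    obtain ⟨a, b⟩ := B.opp (hne h1)
    obtain ⟨h2, -⟩ := B.cur_sub (hne h1)
    have := B.le
    rw [hQ _ (by omega), hcol _ (B.Q_mem _ (by omega)).2.2]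
    exact ⟨a, b⟩
  · intro j hj c hc
    have := B.le
    rw [hQ j (by omega)] at hc
    by_cases hcd : c = d
    · subst hcd
      rw [Function.update_self]
      exact .inl (by omega)
    · refine (B.full j hj c hc).imp (hmono c) fun h' => ⟨h'.1, (hcur c h'.2).resolve_left hcd⟩

theorem ColorInv.skip (B : ColorInv n L s (d :: cur) y h t col Q) (hd : col d ≠ 0) :
    ColorInv n L s cur y h t col Q where
  __ := B
  cur_sub hne := by
    obtain ⟨a, b⟩ := B.cur_sub (by simp)
    exact ⟨a, fun c hc => b c (List.mem_cons_of_mem _ hc)⟩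
  opp hne := B.opp (by simp)
  full j hj c hc := by
    rcases B.full j hj c hc with h' | ⟨h', h''⟩
    · exact .inl h'
    · rcases List.mem_cons.1 h'' with rfl | h''
      · exact .inl hd
      · exact .inr ⟨h', h''⟩

theorem ColorInv.pop (B : ColorInv n L s [] y h t col Q) (ht : h < t)
    (hy : (y' = 1 ∨ y' = 2) ∧ y' ≠ col (Q h)) :
    ColorInv n L s (L (Q h)) y' (h + 1) t col Q where
  __ := B
  le := ht
  cur_sub _ := ⟨by omega, fun c hc => by simpa using hc⟩
  opp _ := by simpa using hy
  full j hj c hc := by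
    rcases (Nat.lt_succ_iff.1 hj).eq_or_lt with rfl | hj
    · exact .inr ⟨rfl, hc⟩
    · rcases B.full j hj c hc with h' | ⟨-, h'⟩
      · exact .inl h'
      · simp at h'

theorem ColorInv.next (B : ColorInv n L s [] y h t col Q) (hs : s ≤ n) (hcol : col s ≠ 0) :
    ColorInv n L (s + 1) [] y h t col Q where
  __ := B
  one_le := by omega
  s_le := by omega
  done c h1 h2 := by
    rcases (Nat.lt_succ_iff.1 h2).eq_or_lt with rfl | h2
    · exact hcol
    · exact B.done c h1 h2

/-- A newly coloured vertex is adjacent to active vertices only, and differs from them. -/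
theorem ColorProper.color (B : ColorInv n L s cur y h t col Q)
    (D : ColorProper L g cur h t col Q) (hsymm : ∀ a b, b ∈ L a → a ∈ L b)
    (hg : ∀ a b, b ∈ L a → g a ≠ g b) (hd : col d = 0) {x : ℕ} {cur' : List ℕ}
    (hsub : ∀ c ∈ cur', c ∈ cur) {f : Bool}
    (hf : ∀ j, j < t → (h ≤ j ∨ j + 1 = h ∧ cur ≠ []) → (col (Q j) = 1 ↔ g (Q j) = f))
    (hfx : x = 1 ↔ g d = f) :
    ColorProper L g cur' h (t + 1) (Function.update col d x) (Function.update Q t d) := by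
  have hQ : ∀ j, j < t → Function.update Q t d j = Q j := fun j hj =>
    Function.update_of_ne hj.ne _ _
  have hcol : ∀ c, col c ≠ 0 → Function.update col d x c = col c := fun c hc =>
    Function.update_of_ne (by rintro rfl; exact hc hd) _ _
  have hne : cur' ≠ [] → cur ≠ [] := fun h1 h2 => by
    obtain ⟨c, hc⟩ := List.exists_mem_of_ne_nil _ h1
    have := hsub c hc
    simp [h2] at this
  have key : ∀ a, d ∈ L a → col a ≠ 0 → col a ≠ x := by
    intro a had ha
    obtain ⟨j, hj, rfl⟩ := B.mem_Q a ha
    have hact : h ≤ j ∨ j + 1 = h ∧ cur ≠ [] := by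
      by_contra! hact
      rcases B.full j hact.1 d had with h' | ⟨h', h''⟩
      · exact h' hd
      · rw [hact.2 h'] at h''
        simp at h''
    have h1 := hf j hj hact
    have h2 := hg _ _ had
    have h3 := B.col_le (Q j)
    intro he
    rw [he] at h1
    apply h2
    by_cases hx1 : x = 1
    · rw [h1.1 hx1, hfx.1 hx1]
    · have n1 := mt h1.2 hx1
      have n2 := mt hfx.2 hx1
      revert n1 n2
      cases g (Q j) <;> cases g d <;> cases f <;> simp
  refine ⟨⟨f, ?_⟩, ?_⟩
  · intro j hj hact
    rcases (Nat.lt_succ_iff.1 hj).eq_or_lt with rfl | hj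
    · rw [Function.update_self, Function.update_self]
      exact hfx
    · rw [hQ j hj, hcol _ (B.Q_mem j hj).2.2]
      exact hf j hj (hact.imp id fun h' => ⟨h'.1, hne h'.2⟩)
  · intro a b hab ha hb
    by_cases had : a = d
    · subst had
      by_cases hbd : b = a
      · subst hbd
        exact absurd rfl (hg _ _ hab)
      · rw [Function.update_of_ne hbd] at hb ⊢
        rw [Function.update_self]
        exact (key b (hsymm _ _ hab) hb).symm
    · rw [Function.update_of_ne had] at ha ⊢
      by_cases hbd : b = d
      · subst hbd
        rw [Function.update_self]
        exact key a hab ha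
      · rw [Function.update_of_ne hbd] at hb ⊢
        exact D.proper a b hab ha hb

theorem ColorProper.visit (B : ColorInv n L s (d :: cur) y h t col Q)
    (D : ColorProper L g (d :: cur) h t col Q) (hsymm : ∀ a b, b ∈ L a → a ∈ L b)
    (hg : ∀ a b, b ∈ L a → g a ≠ g b) (hd : col d = 0) :
    ColorProper L g cur h (t + 1) (Function.update col d y) (Function.update Q t d) := by
  obtain ⟨f, hf⟩ := D.active
  obtain ⟨h1, h2⟩ := B.cur_sub (by simp)
  obtain ⟨h3, h4⟩ := B.opp (by simp)
  have hle := B.le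
  have h5 := hf (h - 1) (by omega) (.inr ⟨by omega, by simp⟩)
  have h6 := hg _ _ (h2 d (by simp))
  have h7 := B.col_le (Q (h - 1))
  have h8 := (B.Q_mem (h - 1) (by omega)).2.2
  refine D.color B hsymm hg hd (fun c hc => List.mem_cons_of_mem _ hc) hf ?_
  by_cases hc : col (Q (h - 1)) = 1
  · have e := h5.1 hc
    rw [e] at h6
    exact ⟨fun hy => by omega, fun hy => absurd hy.symm h6⟩
  · have n1 := mt h5.2 hc
    refine ⟨fun _ => ?_, fun _ => by omega⟩
    revert n1 h6
    cases g (Q (h - 1)) <;> cases g d <;> cases f <;> simp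

theorem ColorProper.source (B : ColorInv n L s [] y h t col Q)
    (D : ColorProper L g [] h t col Q) (hsymm : ∀ a b, b ∈ L a → a ∈ L b)
    (hg : ∀ a b, b ∈ L a → g a ≠ g b) (ht : h = t) (hd : col d = 0) :
    ColorProper L g [] h (t + 1) (Function.update col d 1) (Function.update Q t d) :=
  D.color B hsymm hg hd (fun _ h => h) (f := g d)
    (fun j hj h' => by
      rcases h' with h' | h'
      · omega
      · exact absurd rfl h'.2) (by simp)

theorem ColorProper.skip (D : ColorProper L g (d :: cur) h t col Q) :
    ColorProper L g cur h t col Q := by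
  obtain ⟨⟨f, hf⟩, hp⟩ := D
  exact ⟨⟨f, fun j hj h' => hf j hj (h'.imp id fun h' => ⟨h'.1, by simp⟩)⟩, hp⟩

theorem ColorProper.pop (D : ColorProper L g [] h t col Q) :
    ColorProper L g cur (h + 1) t col Q := by
  obtain ⟨⟨f, hf⟩, hp⟩ := D
  exact ⟨⟨f, fun j hj h' => hf j hj (.inl (by omega))⟩, hp⟩

/-- A bound for the number of iterations that remain. -/
def colorMeasure (n : ℕ) (L : ℕ → List ℕ) (s : ℕ) (cur : List ℕ) (h : ℕ) (col Q : ℕ → ℕ) : ℕ :=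
  (n + 1 - s) + cur.length + ((Finset.Icc 1 n).filter (fun c => col c = 0)).card +
    ∑ c ∈ Finset.Icc 1 n \ (Finset.range h).image Q, ((L c).length + 1)

theorem colorMeasure_color {cur' : List ℕ} (B : ColorInv n L s cur y h t col Q) (hd : col d = 0)
    (hd1 : 1 ≤ d) (hdn : d ≤ n) {x : ℕ} (hx : x ≠ 0) (hcur : cur'.length ≤ cur.length) :
    colorMeasure n L s cur' h (Function.update col d x) (Function.update Q t d) <
      colorMeasure n L s cur h col Q := by
  have h1 : (Finset.range h).image (Function.update Q t d) = (Finset.range h).image Q := by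
    refine Finset.image_congr fun j hj => ?_
    have := B.le
    simp only [Finset.coe_range, Set.mem_Iio] at hj
    exact Function.update_of_ne (by omega) _ _
  have h2 : ((Finset.Icc 1 n).filter (fun c => Function.update col d x c = 0)).card <
      ((Finset.Icc 1 n).filter (fun c => col c = 0)).card := by
    refine Finset.card_lt_card ⟨fun c hc => ?_, fun h' => ?_⟩
    · rw [Finset.mem_filter, Function.update_apply] at hc
      rw [Finset.mem_filter]
      refine ⟨hc.1, ?_⟩
      by_cases hcd : c = d
      · rw [hcd, hd]
      · rw [← hc.2, if_neg hcd]
    · have := h' (Finset.mem_filter.2 ⟨Finset.mem_Icc.2 ⟨hd1, hdn⟩, hd⟩)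
      rw [Finset.mem_filter, Function.update_self] at this
      exact hx this.2
  rw [colorMeasure, colorMeasure, h1]
  omega

theorem colorMeasure_pop (B : ColorInv n L s [] y h t col Q) (ht : h < t) :
    colorMeasure n L s (L (Q h)) (h + 1) col Q < colorMeasure n L s [] h col Q := by
  obtain ⟨h1, h2, -⟩ := B.Q_mem h ht
  have hmem : Q h ∈ Finset.Icc 1 n \ (Finset.range h).image Q := by
    rw [Finset.mem_sdiff, Finset.mem_Icc, Finset.mem_image]
    refine ⟨⟨h1, h2⟩, ?_⟩
    rintro ⟨j, hj, he⟩
    rw [Finset.mem_range] at hj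
    have := B.Q_inj j h (by omega) ht he
    omega
  have he : Finset.Icc 1 n \ (Finset.range (h + 1)).image Q =
      (Finset.Icc 1 n \ (Finset.range h).image Q).erase (Q h) := by
    rw [Finset.range_add_one, Finset.image_insert]
    ext c
    simp only [Finset.mem_sdiff, Finset.mem_insert, Finset.mem_erase, not_or]
    tauto
  rw [colorMeasure, colorMeasure, he, ← Finset.add_sum_erase _ _ hmem, List.length_nil]
  omega

theorem colorMeasure_skip :
    colorMeasure n L s cur h col Q < colorMeasure n L s (d :: cur) h col Q := by
  rw [colorMeasure, colorMeasure, List.length_cons]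
  omega

theorem colorMeasure_next (hs : s ≤ n) :
    colorMeasure n L (s + 1) cur h col Q < colorMeasure n L s cur h col Q := by
  rw [colorMeasure, colorMeasure]
  omega

end Coloring

/-! ### The colouring as a program -/

namespace RAM

/-- Prepare the search that colours the crossing graph: register `25` runs through the possible
starting points, register `26` is the next entry of the list under inspection, register `27` the
colour that its members are going to get, and registers `28` and `29` delimit the queue. -/
def colorInit : Program := block
  [.instr (.const 25 1), .instr (.const 26 0), .instr (.const 28 0), .instr (.const 29 0)]

/-- One step of the colouring: inspect the next entry of the current list, or take the next list
from the queue, or look for an uncoloured vertex.  Array `12` holds the colours, array `13`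
the queue. -/
def colorBody : Program :=
  .cond (.lt 11 26)
    (block [.instr (.load 30 11 26), .instr (.load 26 10 26), .instr (.load 31 12 30),
      .cond (.eq 31 11)
        (block [.instr (.store 12 30 27), .instr (.store 13 29 30), .instr (.inc 29)])
        .skip])
    (.cond (.lt 28 29)
      (block [.instr (.load 32 13 28), .instr (.inc 28), .instr (.load 26 9 32),
        .instr (.load 31 12 32), .instr (.const 27 1),
        .cond (.eq 31 27) (.instr (.const 27 2)) .skip])
      (block [.instr (.load 31 12 25),
        .cond (.eq 31 11)
          (block [.instr (.const 31 1), .instr (.store 12 25 31), .instr (.store 13 29 25),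
            .instr (.inc 29)])
          (.instr (.inc 25))]))

/-- Reject if the two classes that cross at position `13` have the same colour. -/
def checkBody : Program := block
  [.instr (.load 15 5 13),
    .cond (.eq 15 11) .skip
      (block [.instr (.load 22 7 13), .instr (.load 23 8 13), .instr (.load 22 12 22),
        .instr (.load 23 12 23), .cond (.eq 22 23) (.instr (.const 5 0)) .skip]),
    .instr (.inc 13)]

/-- What the colouring leaves alone. -/
def ColorFrame (n : ℕ) (P₁ P₂ c₁ c₂ : ℕ → ℕ) (b : ℕ) (L : ℕ → List ℕ) (s : Store) : Prop :=
  s.reg 5 = 1 ∧ s.reg 11 = 0 ∧ s.reg 12 = n + 1 ∧ s.arr 4 = P₁ ∧ s.arr 5 = P₂ ∧ s.arr 7 = c₁ ∧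
    s.arr 8 = c₂ ∧ IsLinkedLists (s.arr 9) (s.arr 10) (s.arr 11) b L

/-- The invariant of the colouring in terms of the store. -/
structure ColorState (n : ℕ) (P₁ P₂ c₁ c₂ : ℕ → ℕ) (b : ℕ) (L : ℕ → List ℕ) (cur : List ℕ)
    (s : Store) : Prop where
  frame : ColorFrame n P₁ P₂ c₁ c₂ b L s
  list : IsLinkedList (s.arr 10) (s.arr 11) b (s.reg 26) cur
  inv : ColorInv n L (s.reg 25) cur (s.reg 27) (s.reg 28) (s.reg 29) (s.arr 12) (s.arr 13)
  proper : ∀ g : ℕ → Bool, (∀ c d, d ∈ L c → g c ≠ g d) →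
    ColorProper L g cur (s.reg 28) (s.reg 29) (s.arr 12) (s.arr 13)

attribute [local simp] colorBody colorInit checkBody block Program.eval Instr.exec Test.eval
  Function.update_apply

theorem colorBody_step {n b : ℕ} {P₁ P₂ c₁ c₂ : ℕ → ℕ} {L : ℕ → List ℕ} {cur : List ℕ} {s : Store}
    (hr : ∀ c d, d ∈ L c → 1 ≤ d ∧ d ≤ n) (hsymm : ∀ c d, d ∈ L c → c ∈ L d)
    (hs : ColorState n P₁ P₂ c₁ c₂ b L cur s) (hlt : s.reg 25 < s.reg 12) :
    ∃ cur', ColorState n P₁ P₂ c₁ c₂ b L cur' (colorBody.eval s) ∧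
      colorMeasure n L ((colorBody.eval s).reg 25) cur' ((colorBody.eval s).reg 28)
        ((colorBody.eval s).arr 12) ((colorBody.eval s).arr 13) <
      colorMeasure n L (s.reg 25) cur (s.reg 28) (s.arr 12) (s.arr 13) := by
  obtain ⟨reg, arr⟩ := s
  obtain ⟨F, hl, B, hp⟩ := hs
  obtain ⟨-, h11, h12, -, -, -, -, hL⟩ := id F
  simp only at *
  by_cases he : reg 26 = 0
  · rw [he] at hl
    obtain rfl := hl.eq_nil
    by_cases ht : reg 28 < reg 29
    · have hpop := fun y' hy => B.pop (y' := y') ht hy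
      by_cases h1 : arr 12 (arr 13 (reg 28)) = 1
      · refine ⟨_, ⟨by simpa [ColorFrame, h11, he, ht, h1] using F,
          by simpa [h11, he, ht, h1] using hL.2 (arr 13 (reg 28)),
          by simpa [h11, he, ht, h1] using hpop 2 ⟨.inr rfl, by omega⟩,
          fun g hg => by simpa [h11, he, ht, h1] using (hp g hg).pop⟩,
          by simpa [h11, he, ht, h1] using colorMeasure_pop B ht⟩
      · refine ⟨_, ⟨by simpa [ColorFrame, h11, he, ht, h1] using F,
          by simpa [h11, he, ht, h1] using hL.2 (arr 13 (reg 28)),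
          by simpa [h11, he, ht, h1] using hpop 1 ⟨.inl rfl, Ne.symm h1⟩,
          fun g hg => by simpa [h11, he, ht, h1] using (hp g hg).pop⟩,
          by simpa [h11, he, ht, h1] using colorMeasure_pop B ht⟩
    · have hs1 := B.one_le
      by_cases hc : arr 12 (reg 25) = 0
      · have heq : reg 28 = reg 29 := by
          have := B.le
          omega
        have hB := B.color hc hs1 (by omega) (x := 1) (.inl rfl) (cur' := []) (by simp) (by simp)
        have hm := colorMeasure_color B hc hs1 (by omega) (x := 1) (cur' := []) (by simp) (by simp)
        exact ⟨[], ⟨by simpa [ColorFrame, h11, he, ht, hc] using F,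
          by simpa [h11, he, ht, hc] using hl, by simpa [h11, he, ht, hc] using hB,
          fun g hg => by simpa [h11, he, ht, hc] using (hp g hg).source B hsymm hg heq hc⟩,
          by simpa [h11, he, ht, hc] using hm⟩
      · exact ⟨[], ⟨by simpa [ColorFrame, h11, he, ht, hc] using F,
          by simpa [h11, he, ht, hc] using hl,
          by simpa [h11, he, ht, hc] using B.next (by omega) hc,
          fun g hg => by simpa [h11, he, ht, hc] using hp g hg⟩,
          by simpa [h11, he, ht, hc] using colorMeasure_next (by omega)⟩
  · obtain ⟨cur, rfl, hl'⟩ := hl.eq_cons he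
    have he' : 0 < reg 26 := by omega
    obtain ⟨-, hsub⟩ := B.cur_sub (by simp)
    obtain ⟨hd1, hdn⟩ := hr _ _ (hsub (arr 11 (reg 26)) (by simp))
    obtain ⟨hy, -⟩ := B.opp (by simp)
    refine ⟨cur, ?_⟩
    by_cases hc : arr 12 (arr 11 (reg 26)) = 0
    · have hB := B.color hc hd1 hdn hy (cur' := cur) (fun c h => List.mem_cons_of_mem _ h)
        (fun c h => List.mem_cons.1 h)
      exact ⟨⟨by simpa [ColorFrame, h11, he', hc] using F,
        by simpa [h11, he', hc] using hl', by simpa [h11, he', hc] using hB,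
        fun g hg => by simpa [h11, he', hc] using (hp g hg).visit B hsymm hg hc⟩,
        by simpa [h11, he', hc] using colorMeasure_color B hc hd1 hdn (by omega) (by simp)⟩
    · exact ⟨⟨by simpa [ColorFrame, h11, he', hc] using F,
        by simpa [h11, he', hc] using hl',
        by simpa [h11, he', hc] using B.skip hc,
        fun g hg => by simpa [h11, he', hc] using (hp g hg).skip⟩,
        by simpa [h11, he', hc] using colorMeasure_skip (d := arr 11 (reg 26))⟩

/-- The end of the program: build the crossing graph, colour it, and check the colouring. -/
def crossPhases : Program := block
  [.instr (.const 21 1), forPositions crossBody, block [colorInit, .loop (.lt 25 12) colorBody],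
    forPositions checkBody]

variable {V : Type u} {G : SimpleGraph V} {n : ℕ} {q : ℕ → V} {P₁ P₂ c₁ c₂ : ℕ → ℕ}

/-- Register `5` tells whether `G` is a partial double tree. -/
def Decided (G : SimpleGraph V) (s : Store) : Prop :=
  (s.reg 5 = 0 ∧ ¬ IsPartialDoubleTree G) ∨ (s.reg 5 = 1 ∧ IsPartialDoubleTree G)

/-- After the colouring: the colours are `1` and `2`, and the colouring is proper if there is a
proper one. -/
def Colored (n : ℕ) (P₂ c₁ c₂ col : ℕ → ℕ) : Prop :=
  (∀ c, 1 ≤ c → c ≤ n → col c = 1 ∨ col c = 2) ∧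
    ((∃ g : ℕ → Bool, ∀ k, 1 ≤ k → k ≤ n → P₂ k ≠ 0 → g (c₁ k) ≠ g (c₂ k)) →
      ∀ k, 1 ≤ k → k ≤ n → P₂ k ≠ 0 → col (c₁ k) ≠ col (c₂ k))

theorem Colored.isPartialDoubleTree_iff (hS : IsSearchOrder G n q P₁)
    (hP : HasParentPairs G n q P₁ P₂) (hL : IsClassLabel n P₁ P₂ c₁ c₂)
    {col : ℕ → ℕ} (hC : Colored n P₂ c₁ c₂ col) :
    IsPartialDoubleTree G ↔ ∀ k, 1 ≤ k → k ≤ n → P₂ k ≠ 0 → col (c₁ k) ≠ col (c₂ k) := by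
  refine ⟨fun hG => hC.2 (hP.exists_coloring hS hL hG), fun h => ?_⟩
  refine isPartialDoubleTree_of_coloring hS hP hL (col := fun c => decide (col c = 1))
    fun k h1 hn h2 he => h k h1 hn h2 ?_
  have r1 := hL.range hS hP h1 hn (.inl ⟨rfl, rfl⟩)
  have r2 := hL.range hS hP h1 hn (.inr ⟨h2, rfl, rfl⟩)
  have := hC.1 _ r1.1 r1.2
  have := hC.1 _ r2.1 r2.2
  rw [decide_eq_decide] at he
  omega

/-- The invariant of the final check: positions up to `m` are checked. -/
structure CheckState (n : ℕ) (P₁ P₂ c₁ c₂ col : ℕ → ℕ) (m : ℕ) (s : Store) : Prop where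
  frame : s.reg 11 = 0 ∧ s.reg 12 = n + 1 ∧ s.arr 4 = P₁ ∧ s.arr 5 = P₂ ∧ s.arr 7 = c₁ ∧
    s.arr 8 = c₂ ∧ s.arr 12 = col
  next : s.reg 13 = m + 1
  le : m ≤ n
  ok : (s.reg 5 = 1 ∧ ∀ k, 1 ≤ k → k ≤ m → P₂ k ≠ 0 → col (c₁ k) ≠ col (c₂ k)) ∨
    (s.reg 5 = 0 ∧ ∃ k, 1 ≤ k ∧ k ≤ n ∧ P₂ k ≠ 0 ∧ col (c₁ k) = col (c₂ k))

theorem checkBody_step {col : ℕ → ℕ} {m : ℕ} {s : Store}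
    (hs : CheckState n P₁ P₂ c₁ c₂ col m s) (hm : m < n) :
    CheckState n P₁ P₂ c₁ c₂ col (m + 1) (checkBody.eval s) := by
  obtain ⟨reg, arr⟩ := s
  obtain ⟨F, h13, -, hok⟩ := hs
  obtain ⟨h11, -, -, h5, h7, h8, hcol⟩ := id F
  simp only at *
  have last : ∀ k, k ≤ m + 1 → k ≤ m ∨ k = m + 1 := by omega
  by_cases h2 : P₂ (m + 1) = 0
  · refine ⟨by simpa [h11, h13, h5, h2] using F, by simp [h11, h13, h5, h2], hm, ?_⟩
    refine hok.imp (fun h => ⟨by simpa [h11, h13, h5, h2] using h.1, fun k h1 hk h2' => ?_⟩)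
      fun h => ⟨by simpa [h11, h13, h5, h2] using h.1, h.2⟩
    rcases last k hk with hk | rfl
    · exact h.2 k h1 hk h2'
    · exact absurd h2 h2'
  by_cases hc : col (c₁ (m + 1)) = col (c₂ (m + 1))
  · exact ⟨by simpa [h11, h13, h5, h7, h8, hcol, h2, hc] using F,
      by simp [h11, h13, h5, h7, h8, hcol, h2, hc], hm,
      .inr ⟨by simp [h11, h13, h5, h7, h8, hcol, h2, hc], m + 1, by omega, hm, h2, hc⟩⟩
  · refine ⟨by simpa [h11, h13, h5, h7, h8, hcol, h2, hc] using F,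
      by simp [h11, h13, h5, h7, h8, hcol, h2, hc], hm, ?_⟩
    refine hok.imp (fun h => ⟨by simpa [h11, h13, h5, h7, h8, hcol, h2, hc] using h.1,
      fun k h1 hk h2' => ?_⟩)
      fun h => ⟨by simpa [h11, h13, h5, h7, h8, hcol, h2, hc] using h.1, h.2⟩
    rcases last k hk with hk | rfl
    · exact h.2 k h1 hk h2'
    · exact hc

theorem colorMeasure_init {L : ℕ → List ℕ} {col Q : ℕ → ℕ}
    (hsum : ∑ c ∈ Finset.range (n + 1), (L c).length ≤ 2 * n) :
    colorMeasure n L 1 [] 0 col Q ≤ 5 * n := by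
  have h1 := Finset.card_filter_le (Finset.Icc 1 n) (fun c => col c = 0)
  have h2 : ∑ c ∈ Finset.Icc 1 n, (L c).length ≤ ∑ c ∈ Finset.range (n + 1), (L c).length :=
    Finset.sum_le_sum_of_subset fun c hc => by
      rw [Finset.mem_Icc] at hc
      exact Finset.mem_range.2 (by omega)
  have h3 : ∑ c ∈ Finset.Icc 1 n, ((L c).length + 1) = ∑ c ∈ Finset.Icc 1 n, (L c).length + n := by
    rw [Finset.sum_add_distrib]
    simp
  simp only [colorMeasure, Finset.range_zero, Finset.image_empty, Finset.sdiff_empty, h3,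
    List.length_nil]
  rw [Nat.card_Icc] at h1
  omega

/-- The number of steps after the labelling. -/
def crossTime (n : ℕ) : ℕ :=
  ((crossBody.size + 1) * n + (colorBody.size + 1) * (5 * n) + (checkBody.size + 1) * n) +
    colorInit.size + 30

theorem cross_triple (hS : IsSearchOrder G n q P₁) (hP : HasParentPairs G n q P₁ P₂)
    (hL : IsClassLabel n P₁ P₂ c₁ c₂) :
    Triple (fun s => CrossFrame n P₁ P₂ c₁ c₂ s ∧ ∀ i, s.arr 9 i = 0) crossPhases (crossTime n)
      (Decided G) := by
  have h1 : Triple (fun s => CrossFrame n P₁ P₂ c₁ c₂ s ∧ ∀ i, s.arr 9 i = 0)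
      (.instr (.const 21 1)) 1
      (fun s => CrossState n P₁ P₂ c₁ c₂ 0 ((Program.instr (.const 13 1)).eval s)) := by
    refine .of_loopFree (p := .instr (.const 21 1)) trivial fun s hs => ?_
    refine ⟨by simpa [CrossFrame] using hs.1, by simp, by omega, fun _ => [], ⟨by simp,
      fun c => ?_⟩, fun c d => ?_, by simp⟩
    · have := hs.2 c
      simpa [this] using IsLinkedList.nil
    · simp only [List.not_mem_nil, false_iff]
      rintro ⟨k, hk, hk', -⟩
      omega
  have h2 := Triple.forPositions (p := crossBody) (n := n)
    (by simp [crossBody, addEntry, Program.LoopFree])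
    (CrossState n P₁ P₂ c₁ c₂) (fun m s hs => ⟨hs.next, hs.frame.2.2.1, hs.le⟩)
    (fun m s hs hm => crossBody_step hs hm)
  -- the lists are fixed from here on; only the colours remain to be found
  have h3 : Triple (CrossState n P₁ P₂ c₁ c₂ n) (block [colorInit, .loop (.lt 25 12) colorBody])
      (colorInit.size + ((colorBody.size + 1) * (5 * n) + 1) + 3)
      (fun s => CheckState n P₁ P₂ c₁ c₂ (s.arr 12) 0 ((Program.instr (.const 13 1)).eval s) ∧
        Colored n P₂ c₁ c₂ (s.arr 12)) := by
    rintro s ⟨F, -, -, L, hLL, hmem, hsum⟩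
    have hsymm : ∀ c d, d ∈ L c → c ∈ L d := by
      intro c d h
      rw [hmem] at h ⊢
      obtain ⟨k, h1, h2, h3, h4⟩ := h
      exact ⟨k, h1, h2, h3, h4.symm.imp (fun h => ⟨h.2, h.1⟩) fun h => ⟨h.2, h.1⟩⟩
    have hr : ∀ c d, d ∈ L c → 1 ≤ d ∧ d ≤ n := by
      intro c d h
      rw [hmem] at h
      obtain ⟨k, h1, h2, h3, ⟨-, rfl⟩ | ⟨-, rfl⟩⟩ := h
      · exact hL.range hS hP h1 h2 (.inr ⟨h3, rfl, rfl⟩)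
      · exact hL.range hS hP h1 h2 (.inl ⟨rfl, rfl⟩)
    have i1 : Triple (fun s' => s' = s) colorInit colorInit.size (fun s' => ∃ m ≤ 5 * n, ∃ cur,
        ColorState n P₁ P₂ c₁ c₂ (s.reg 21) L cur s' ∧
        m = colorMeasure n L (s'.reg 25) cur (s'.reg 28) (s'.arr 12) (s'.arr 13)) := by
      refine .of_loopFree (by simp [Program.LoopFree]) ?_
      rintro s' rfl
      obtain ⟨f5, f11, f12, f4, fP, f7, f8, fcol⟩ := F
      refine ⟨_, ?_, [], ⟨⟨by simpa using f5, by simpa using f11, by simpa using f12,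
        by simpa using f4, by simpa using fP, by simpa using f7, by simpa using f8,
        by simpa using hLL⟩, by simpa using IsLinkedList.nil, ?_, fun g hg => ?_⟩, rfl⟩
      · simpa using colorMeasure_init hsum
      · constructor <;> simp [fcol]
        omega
      · constructor <;> simp [fcol]
    have i2 := Triple.loop (b := .lt 25 12) (p := colorBody) (by simp [Program.LoopFree])
      (fun m s' => ∃ cur, ColorState n P₁ P₂ c₁ c₂ (s.reg 21) L cur s' ∧
        m = colorMeasure n L (s'.reg 25) cur (s'.reg 28) (s'.arr 12) (s'.arr 13)) (M := 5 * n) (by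
        rintro m s' ⟨cur, hs', rfl⟩ hlt
        obtain ⟨cur', h, hm⟩ := colorBody_step hr hsymm hs' (by simpa using hlt)
        exact ⟨_, hm, cur', h, rfl⟩)
    obtain ⟨s', hrun, hlt, -, cur, hs', -⟩ :=
      (i1.seq (i2.seq .skip)).mono
        (t' := colorInit.size + ((colorBody.size + 1) * (5 * n) + 1) + 3)
        (by omega) s rfl
    refine ⟨s', hrun, ?_, ?_, ?_⟩
    · obtain ⟨f5, f11, f12, f4, fP, f7, f8, -⟩ := hs'.frame
      exact ⟨⟨by simpa using f11, by simpa using f12, by simpa using f4, by simpa using fP,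
        by simpa using f7, by simpa using f8, by simp⟩, by simp, by omega,
        .inl ⟨by simpa using f5, fun k h1 h2 => by omega⟩⟩
    · intro c h1 hn
      have h2 := hs'.inv.s_le
      have h3 := hs'.frame.2.2.1
      simp only [Test.eval, decide_eq_false_iff_not] at hlt
      have := hs'.inv.done c h1 (by omega)
      have := hs'.inv.col_le c
      omega
    · rintro ⟨g, hg⟩ k h1 hn h2
      have h2' := hs'.inv.s_le
      have h3 := hs'.frame.2.2.1
      simp only [Test.eval, decide_eq_false_iff_not] at hlt
      have r1 := hL.range hS hP h1 hn (.inl ⟨rfl, rfl⟩)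
      have r2 := hL.range hS hP h1 hn (.inr ⟨h2, rfl, rfl⟩)
      refine (hs'.proper g ?_).proper _ _ ((hmem _ _).2 ⟨k, h1, hn, h2, .inl ⟨rfl, rfl⟩⟩)
        (hs'.inv.done _ r1.1 (by omega)) (hs'.inv.done _ r2.1 (by omega))
      intro c d hcd
      rw [hmem] at hcd
      obtain ⟨j, j1, jn, j2, ⟨rfl, rfl⟩ | ⟨rfl, rfl⟩⟩ := hcd
      · exact hg j j1 jn j2
      · exact (hg j j1 jn j2).symm
  have h4 : Triple (fun s => CheckState n P₁ P₂ c₁ c₂ (s.arr 12) 0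
        ((Program.instr (.const 13 1)).eval s) ∧ Colored n P₂ c₁ c₂ (s.arr 12))
      (forPositions checkBody) ((checkBody.size + 1) * n + 6) (Decided G) := by
    rintro s ⟨hs, hC⟩
    obtain ⟨s', hrun, hs'⟩ := Triple.forPositions (p := checkBody) (n := n)
      (by simp [Program.LoopFree]) (CheckState n P₁ P₂ c₁ c₂ (s.arr 12))
      (fun m s hs => ⟨hs.next, hs.frame.2.1, hs.le⟩) (fun m s hs hm => checkBody_step hs hm) s hs
    refine ⟨s', hrun, ?_⟩
    rw [Decided, hC.isPartialDoubleTree_iff hS hP hL]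
    refine hs'.ok.symm.imp (fun h => ⟨h.1, fun h' => ?_⟩) id
    obtain ⟨k, k1, kn, k2, hk⟩ := h.2
    exact h' k k1 kn k2 hk
  refine (h1.seq (h2.seq (h3.seq (h4.seq .skip)))).mono
    ?_
  simp only [crossTime]
  omega

end RAM

/-! ### The whole program -/

namespace RAM

/-- The search, the labelling of the edges, and the colouring; a phase is skipped if there are no
vertices or if an earlier one has rejected. -/
def partialDoubleTreeProgram : Program :=
  .cond (.lt 11 0)
    (block [block [bfsInit, .loop (.lt 1 2) bfsBody, bfsCheck],
      .cond (.lt 11 5)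
        (block [forPositions classBody, .cond (.lt 11 5) crossPhases .skip])
        .skip,
      .instr (.copy 0 5)])
    .skip

variable {V : Type u} {G : SimpleGraph V}

theorem labelled_triple (A : AdjacencyLists G) :
    Triple (Labelled A) (.cond (.lt 11 5) crossPhases .skip) (crossTime A.n + 1 + 1)
      (Decided G) := by
  refine .cond ?_ (.of_loopFree (p := .skip) trivial ?_)
  · rintro s ⟨⟨h11, h⟩, ht⟩
    simp only [Test.eval, decide_eq_true_eq] at ht
    rcases h with h | ⟨h5, h12, h9, hcol, q, hS, hP, hL⟩
    · omega
    · exact cross_triple hS hP hL s ⟨⟨h5, h11, h12, rfl, rfl, rfl, rfl, hcol⟩, h9⟩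
  · rintro s ⟨⟨h11, h⟩, ht⟩
    simp only [Test.eval, decide_eq_false_iff_not] at ht
    exact .inl (h.resolve_right fun h => by omega)

theorem searched_triple (A : AdjacencyLists G) :
    Triple (Searched A)
      (.cond (.lt 11 5) (block [forPositions classBody, .cond (.lt 11 5) crossPhases .skip]) .skip)
      ((classBody.size + 1) * A.n + crossTime A.n + 20) (Decided G) := by
  refine (Triple.cond ?_ (.of_loopFree (p := .skip) trivial ?_)).mono
    (t := ((classBody.size + 1) * A.n + 6) + ((crossTime A.n + 1 + 1) + 1 + 1) + 1 + 1 + 1) ?_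
  · rintro s ⟨hs, ht⟩
    refine (class_triple.seq ((labelled_triple A).seq
      .skip)) s ⟨hs, ?_⟩
    simp only [Test.eval, decide_eq_true_eq] at ht
    obtain ⟨h11, h⟩ := hs
    omega
  · rintro s ⟨⟨h11, h⟩, ht⟩
    simp only [Test.eval, decide_eq_false_iff_not] at ht
    exact .inl (h.resolve_right fun h => by omega)
  · omega

/-- The running time of the program on a graph with `n` vertices and `m` edges. -/
def totalTime (n m : ℕ) : ℕ :=
  (bfsInit.size + ((bfsBody.size + 1) * (2 * m + n) + 1) + bfsCheck.size + 10) +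
    ((classBody.size + 1) * n + crossTime n + 20) + 10

/-- The program stops with the answer in register `0`. -/
theorem partialDoubleTree_triple [Finite V] (A : AdjacencyLists G) :
    Triple (fun s => s = A.initialStore) partialDoubleTreeProgram
      (totalTime A.n (Nat.card G.edgeSet)) (fun s => (IsPartialDoubleTree G → s.reg 0 = 1) ∧
        (¬ IsPartialDoubleTree G → s.reg 0 = 0)) := by
  by_cases hn : 0 < A.n
  · have h := (bfs_triple (A := A) hn).seq ((searched_triple A).seq
      (Triple.seq (.of_loopFree (p := .instr (.copy 0 5)) (Q := fun s =>
        (IsPartialDoubleTree G → s.reg 0 = 1) ∧ (¬ IsPartialDoubleTree G → s.reg 0 = 0)) trivial ?_)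
        .skip))
    · rintro s rfl
      obtain ⟨s', h1, h2⟩ := h _ rfl
      refine ⟨s', (Runs.cond_true ?_ h1).mono ?_, h2⟩
      · simpa [Test.eval, AdjacencyLists.initialStore] using hn
      · simp only [Program.size, totalTime]
        omega
    · rintro s (⟨h5, hG⟩ | ⟨h5, hG⟩) <;> simp [Program.eval, Instr.exec, h5, hG]
  · rintro s rfl
    refine ⟨_, (Runs.cond_false ?_ (.of_loopFree (p := .skip) trivial _)).mono ?_, ?_⟩
    · simpa [Test.eval, AdjacencyLists.initialStore] using hn
    · simp only [Program.size, totalTime]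
      omega
    -- a connected graph has a vertex
    have hG : ¬ IsPartialDoubleTree G := fun hG => by
      obtain ⟨x⟩ := hG.1.nonempty
      exact hn (A.vertex.symm x).pos
    exact ⟨fun h => absurd h hG, fun _ => by
      simpa [Program.eval, AdjacencyLists.initialStore] using hn⟩

theorem exists_totalTime_le : ∃ C, ∀ n m, totalTime n m ≤ C * (n + m + 1) := by
  refine ⟨(bfsInit.size + 1 + bfsCheck.size + 10) + 2 * (bfsBody.size + 1) + (classBody.size + 1) +
    ((crossBody.size + 1) + (colorBody.size + 1) * 5 + (checkBody.size + 1) + colorInit.size + 30) +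
    20 + 10, fun n m => ?_⟩
  simp only [totalTime, crossTime]
  generalize bfsInit.size = a₁, bfsBody.size = a₂, bfsCheck.size = a₃, classBody.size = a₄,
    crossBody.size = a₅, colorBody.size = a₆, checkBody.size = a₇, colorInit.size = a₈
  nlinarith [Nat.zero_le (a₁ * (n + m)), Nat.zero_le (a₂ * n), Nat.zero_le (a₂ * m),
    Nat.zero_le (a₃ * (n + m)), Nat.zero_le (a₄ * m), Nat.zero_le (a₅ * m), Nat.zero_le (a₆ * m),
    Nat.zero_le (a₇ * m), Nat.zero_le (a₈ * (n + m)), Nat.zero_le n, Nat.zero_le m]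

end RAM

theorem theorem3 :
    ∃ (p : RAM.Program) (C : ℕ),
      ∀ (V : Type u) [Finite V] (G : SimpleGraph V) (A : AdjacencyLists G),
        ∃ s : RAM.Store,
          RAM.HaltsWithin p A.initialStore (C * (Nat.card V + Nat.card G.edgeSet + 1)) s ∧
            (IsPartialDoubleTree G → s.reg 0 = 1) ∧
            (¬ IsPartialDoubleTree G → s.reg 0 = 0) := by
  obtain ⟨C, hC⟩ := RAM.exists_totalTime_le
  refine ⟨RAM.partialDoubleTreeProgram, C, fun V _ G A => ?_⟩
  obtain ⟨s, h1, h2⟩ := RAM.partialDoubleTree_triple A _ rfl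
  refine ⟨s, (h1.mono ?_).haltsWithin, h2⟩
  rw [A.card_eq]
  exact hC _ _
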